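/- Let $0\le\delta<1$, $K_1=1+\delta$, $K_3=1-\delta$. For $0<R_1\le R_2<\infty$ let $A_{R_1,R_2}=\{z\in\mathbb C:\ R_1\le|z|\le R_2\}$ and let $C_R(0)$ be the circle of radius $R$ centered at $0$. For $u=v+\imath w\in H^1(A_{R_1,R_2};\mathbb C)$ set $$E_0(u)=\frac{K_1}{2}\int_{A_{R_1,R_2}}(\operatorname{div}u)^2+\frac{K_3}{2}\int_{A_{R_1,R_2}}(\operatorname{curl}u)^2,\qquad \operatorname{div}u=v_x+w_y,\quad \operatorname{curl}u=w_x-v_y.$$ For $C\ge 1$ let $\mathscr H_{R_1,R_2,C}$ be the class of maps $u\in H^1(A_{R_1,R_2};\mathbb S^1)$ whose traces on $C_{R_1}(0)$ and $C_{R_2}(0)$ satisfy $|u_\theta|\le C$ ($\theta$ being the polar angle, so that the traces are $C$-Lipschitz functions of $\theta$) and have degree $-1$. Let $$I_{R_1,R_2,C}=\inf\{E_0(u);\ u\in\mathscr H_{R_1,R_2,C}\}$$ (with $I_{R,R,C}=0$ for the degenerate annulus). The class $\mathscr H_{R_1,R_2,C}$ is non-empty, so that $I_{R_1,R_2,C}$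 is a real number, and the following hold. 1. For all $C\ge1$ and $0<R_1\le R_2$: $\displaystyle (1-\delta)\pi\ln\frac{R_2}{R_1}-(1-\delta)\pi\le I_{R_1,R_2,C}\le\pi\ln\frac{R_2}{R_1}$. 2. For all $C\ge1$, $0<R_1\le R_2$ and $t>0$: $I_{tR_1,tR_2,C}=I_{R_1,R_2,C}$. 3. For every $C\ge1$ there are constants $C_1,C_2$ depending only on $C$ and $\delta$ such that, for all $0<R_1\le R_2\le R_3\le R_4$ with $R_3/R_2\ge2$, $$I_{R_1,R_4,C}\le I_{R_1,R_2,C}+I_{R_3,R_4,C}+C_1\ln\frac{R_3}{R_2}+C_2,$$ and, for all $0<R_1\le R_2$ and $t\ge2$, $\ I_{R_1,tR_2,C}\le I_{R_1,R_2,C}+C_1\ln t+C_2$. 4. For every $C\ge1$ there are constants $C_3,C_4$ depending only on $C$ and $\delta$ such that, for all $C'\ge1$, $0<R_1\le R_2$ and $t\ge2$, $\ I_{R_1,tR_2,C'}\le I_{R_1,R_2,C}+C_3\ln t+C_4$. 5. There is a constant $C_\delta$ with $(1-\delta)\pi\le C_\delta\le\pi$ such that $$\lim_{t\to\infty}\frac{I_{R_1,tR_1,C}}{\ln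 t}=C_\delta\qquad\text{for all }R_1>0\text{ and all }C\ge1.$$ Moreover, if $\delta>0$, then $(1-\delta)\pi<C_\delta<\pi$. -/

import Mathlib

open MeasureTheory Filter Topology
open scoped ContDiff

/-- The open annulus `{z : R₁ < |z| < R₂}` of the plane (identified with `ℂ`). Sobolev maps and
integrals on the closed annulus are, up to a null set, the same as on the open one. -/
def openAnnulus (R₁ R₂ : ℝ) : Set ℂ := {z : ℂ | R₁ < ‖z‖ ∧ ‖z‖ < R₂}

/-- `u'` is the weak derivative of `u` in the direction `e` on the open set `U`. -/
def HasWeakDirDeriv (U : Set ℂ) (e : ℂ) (u u' : ℂ → ℂ) : Prop :=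
  ∀ φ : ℂ → ℝ, ContDiff ℝ ∞ φ → HasCompactSupport φ → tsupport φ ⊆ U →
    ∫ z in U, (fderiv ℝ φ z e : ℝ) • u z = -∫ z in U, φ z • u' z

/-- `u ∈ H¹(U; ℂ)`, with weak partial derivatives `∂u/∂x = ux` and `∂u/∂y = uy`. -/
structure IsH1 (U : Set ℂ) (u ux uy : ℂ → ℂ) : Prop where
  memLp : MemLp u 2 (volume.restrict U)
  memLp_x : MemLp ux 2 (volume.restrict U)
  memLp_y : MemLp uy 2 (volume.restrict U)
  weak_x : HasWeakDirDeriv U 1 u ux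
  weak_y : HasWeakDirDeriv U Complex.I u uy

/-- The functions `g₁`, `g₂` of the polar angle `θ` are the traces on the circles `|z| = R₁` and
`|z| = R₂` of the map `u ∈ H¹` of the annulus (with weak partial derivatives `ux`, `uy`). The trace
is characterized by Green's formula
`∫_A u ∂ⱼφ = - ∫_A ∂ⱼu φ + ∫_{∂A} (tr u) φ νⱼ`, for all test functions `φ` of the whole plane,
where the outer unit normal `ν` is `e^{iθ}` on the outer circle and `-e^{iθ}` on the inner one. -/
def HasTraces (R₁ R₂ : ℝ) (u ux uy : ℂ → ℂ) (g₁ g₂ : ℝ → ℂ) : Prop :=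
  ∀ φ : ℂ → ℝ, ContDiff ℝ ∞ φ → HasCompactSupport φ →
    (∫ z in openAnnulus R₁ R₂, (fderiv ℝ φ z 1 : ℝ) • u z =
      -(∫ z in openAnnulus R₁ R₂, φ z • ux z)
        + (∫ θ in (0 : ℝ)..(2 * Real.pi), (R₂ * φ (circleMap 0 R₂ θ) * Real.cos θ) • g₂ θ)
        - ∫ θ in (0 : ℝ)..(2 * Real.pi), (R₁ * φ (circleMap 0 R₁ θ) * Real.cos θ) • g₁ θ) ∧
    (∫ z in openAnnulus R₁ R₂, (fderiv ℝ φ z Complex.I : ℝ) • u z =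
      -(∫ z in openAnnulus R₁ R₂, φ z • uy z)
        + (∫ θ in (0 : ℝ)..(2 * Real.pi), (R₂ * φ (circleMap 0 R₂ θ) * Real.sin θ) • g₂ θ)
        - ∫ θ in (0 : ℝ)..(2 * Real.pi), (R₁ * φ (circleMap 0 R₁ θ) * Real.sin θ) • g₁ θ)

/-- `g`, as a function of the polar angle, is a continuous map from the circle to the unit circle,
of degree `d`: it has a continuous phase that increases by `2πd` in one counterclockwise turn. -/
def HasCircleDegree (g : ℝ → ℂ) (d : ℤ) : Prop :=
  ∃ φ : ℝ → ℝ, Continuous φ ∧ (∀ θ, g θ = Complex.exp (φ θ * Complex.I)) ∧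
    ∀ θ, φ (θ + 2 * Real.pi) = φ θ + 2 * Real.pi * d

/-- The boundary condition on a circle: `|g_θ| ≤ C` (that is, `g` is `C`-Lipschitz in the angle)
and `deg g = -1`. -/
def IsBoundaryDatum (C : ℝ) (g : ℝ → ℂ) : Prop :=
  (∀ θ θ' : ℝ, ‖g θ - g θ'‖ ≤ C * |θ - θ'|) ∧ HasCircleDegree g (-1)

/-- `u` (with weak partial derivatives `ux`, `uy`) is a competitor: a map in `H¹(A; 𝕊¹)`, where `A`
is the annulus, whose traces `v` on the two boundary circles satisfy `|v_θ| ≤ C` and have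
degree `-1`. -/
def IsCompetitor (R₁ R₂ C : ℝ) (u ux uy : ℂ → ℂ) : Prop :=
  IsH1 (openAnnulus R₁ R₂) u ux uy ∧
  (∀ᵐ z ∂(volume.restrict (openAnnulus R₁ R₂)), ‖u z‖ = 1) ∧
  ∃ g₁ g₂ : ℝ → ℂ, HasTraces R₁ R₂ u ux uy g₁ g₂ ∧ IsBoundaryDatum C g₁ ∧ IsBoundaryDatum C g₂

/-- The energy `(K₁/2) ∫ (div u)² + (K₃/2) ∫ (curl u)²` on `U` of a map `u = v + i w` with
partial derivatives `ux = vₓ + i wₓ` and `uy = v_y + i w_y`; `div u = vₓ + w_y` and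
`curl u = wₓ - v_y`. -/
noncomputable def anisoEnergy (K₁ K₃ : ℝ) (U : Set ℂ) (ux uy : ℂ → ℂ) : ℝ :=
  K₁ / 2 * (∫ z in U, ((ux z).re + (uy z).im) ^ 2) +
    K₃ / 2 * ∫ z in U, ((ux z).im - (uy z).re) ^ 2

/-- The set of the energies `E₀(u)` of all competitors `u`, with `K₁ = 1 + δ` and `K₃ = 1 - δ`. -/
def competitorEnergies (δ R₁ R₂ C : ℝ) : Set ℝ :=
  {E : ℝ | ∃ u ux uy : ℂ → ℂ, IsCompetitor R₁ R₂ C u ux uy ∧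
    E = anisoEnergy (1 + δ) (1 - δ) (openAnnulus R₁ R₂) ux uy}

/-- The minimal energy `I_{R₁,R₂,C}`. -/
noncomputable def minEnergy (δ R₁ R₂ C : ℝ) : ℝ := sInf (competitorEnergies δ R₁ R₂ C)

/-! Locally u = e^{iΦ}, and then (div u)² + (curl u)² = |∇Φ|², so the energy density is (1-δ)/2
|∇Φ|² + δ (div u)².

Lower bound. The degree -1 of the trace forces ∫ |z|⁻² ∂_θΦ = -2π ln(R₂/R₁), and |∇Φ|² ≥ |z|⁻²
(∂_θΦ)² ≥ |z|⁻² (-2 ∂_θΦ - 1) gives (1-δ)π ln(R₂/R₁). For δ > 0 there is a gain: near equality ∇Φ is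
close to the gradient of -θ, so |z| div u is close to -cos(Φ-θ), while the exact identity ∫
e^{2i(Φ-θ)} (1 - ∂_θΦ) dθ = 0 on circles makes cos²(Φ-θ) average about 1/2. Hence δ (div u)² cannot
be small as well (`IsH1.integral_fourier_mode`, `energy_density_lower_aux`,
`IsUnimodularH1.anisoEnergy_ge`).

Upper bound. The 0-homogeneous map with phase -θ has energy exactly π ln(R₂/R₁); perturbing the
phase by ε sin 4θ lowers the factor by 3δε at first order (`exists_wavy_competitor`).

Asymptotics. Lipschitz boundary phases are interpolated linearly in ln r across an annulus at
bounded cost (`exists_interpolation`). With gluing and scaling this makes the minimal energy almost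
subadditive in ln(R₂/R₁), and also makes different bounds C comparable up to a constant; Fekete's
lemma gives a limit independent of C (`exists_tendsto_minEnergy`), to which both strict bounds pass.

The phase Φ of an H¹ map is never constructed. The argument uses only its weak gradient, the real
functions Im(conj u · ∂u), which is curl-free by mollification. Since traces are encoded by Green's
formula, gluing is the addition of two such formulas, and the degree is read off by gluing on an
explicit outer map. -/

open scoped ComplexConjugate Pointwise

/-! ### Mollification of square integrable maps. -/

open scoped Convolution in
/-- The convolution of two square integrable functions is continuous. -/
theorem continuous_convolution_of_memLp_two {𝕜 : Type*} [RCLike 𝕜] {f g : ℂ → 𝕜}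
    (hf : MemLp f 2 volume) (hg : MemLp g 2 volume) :
    Continuous (f ⋆[ContinuousLinearMap.mul ℝ 𝕜, volume] g) := by
  have hf' : MemLp (fun t => star (f t)) 2 volume := hf.star
  have hm : ∀ w : ℂ, MeasurePreserving (fun t : ℂ => w - t) volume volume :=
    fun w => Measure.measurePreserving_sub_left volume w
  let c : C(ℂ, C(ℂ, ℂ)) := (ContinuousMap.mk (fun p : ℂ × ℂ => p.1 - p.2) (by fun_prop)).curry
  -- The value at w is an L² inner product of conj f with a reflected translate of g, and
  -- translation is continuous in L².
  have h1 : Continuous fun w : ℂ => Lp.compMeasurePreserving (c w) (hm w) (hg.toLp g) :=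
    Continuous.compMeasurePreservingLp continuous_const c.continuous hm (by simp)
  have h2 : Continuous fun w : ℂ =>
      inner 𝕜 (hf'.toLp _) (Lp.compMeasurePreserving (c w) (hm w) (hg.toLp g)) :=
    continuous_const.inner h1
  convert h2 using 2 with w
  rw [L2.inner_def, convolution_def]
  refine integral_congr_ae ?_
  have h3 := Lp.coeFn_compMeasurePreserving (hg.toLp g) (hm w)
  have h4 := (hm w).quasiMeasurePreserving.ae_eq_comp hg.coeFn_toLp
  filter_upwards [h3, h4, hf'.coeFn_toLp] with t ht3 ht4 ht5
  have : (Lp.compMeasurePreserving (c w) (hm w) (hg.toLp g)) t = g (w - t) := by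
    refine Eq.trans ht3 ?_
    simpa using ht4
  rw [this, ht5]
  simp [RCLike.inner_apply, mul_comm]

-- With ψ reflected to ψ(-z), associativity turns the integral of ψ (φₙ ⋆ f) into the value at 0 of
-- φₙ ⋆ (f ⋆ ψ(-·)). The inner convolution is continuous, so only convergence of mollifications of a
-- continuous function at one point is needed.
open scoped Convolution in
theorem tendsto_integral_mul_mollify {φ : ℕ → ContDiffBump (0 : ℂ)}
    (hφ : Tendsto (fun n => (φ n).rOut) atTop (𝓝 0)) {f ψ : ℂ → ℂ}
    (hf : MemLp f 2 volume) (hψ : MemLp ψ 2 volume) :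
    Tendsto (fun n => ∫ z, ψ z *
        ((φ n).normed volume ⋆[ContinuousLinearMap.lsmul ℝ ℝ, volume] f) z) atTop
      (𝓝 (∫ z, ψ z * f z)) := by
  have hψ' : MemLp (fun z => ψ (-z)) 2 volume :=
    hψ.comp_measurePreserving (Measure.measurePreserving_neg volume)
  have hK := continuous_convolution_of_memLp_two hf hψ'
  have hK' := continuous_convolution_of_memLp_two hf.norm hψ'.norm
  have key := ContDiffBump.convolution_tendsto_right_of_continuous (μ := volume) hφ hK 0
  have e0 : (f ⋆[ContinuousLinearMap.mul ℝ ℂ, volume] fun z => ψ (-z)) 0 = ∫ z, ψ z * f z := by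
    simp [convolution_def, mul_comm]
  rw [e0] at key
  refine key.congr fun n => ?_
  have hloc : LocallyIntegrable f volume := hf.locallyIntegrable (by norm_num)
  have h1 := convolution_assoc (μ := volume) (ν := volume) (ContinuousLinearMap.lsmul ℝ ℝ)
    (ContinuousLinearMap.mul ℝ ℂ) (ContinuousLinearMap.lsmul ℝ ℝ) (ContinuousLinearMap.mul ℝ ℂ)
    (f := (φ n).normed volume) (g := f) (k := fun z => ψ (-z)) (x₀ := 0)
    (by intro x y z; simp [mul_assoc])
    (φ n).continuous_normed.aestronglyMeasurable hf.1 hψ'.1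
    (Eventually.of_forall
      (((φ n).hasCompactSupport_normed.convolutionExists_left _ (φ n).continuous_normed hloc)))
    (Eventually.of_forall fun x => by
      have hm : MemLp (fun t : ℂ => ‖ψ (-(x - t))‖) 2 volume :=
        hψ'.norm.comp_measurePreserving (Measure.measurePreserving_sub_left volume x)
      exact hf.norm.integrable_mul hm)
    ((HasCompactSupport.convolutionExists_left _ (φ n).hasCompactSupport_normed.norm
      (φ n).continuous_normed.norm hK'.locallyIntegrable) 0)
  rw [← h1]
  simp [convolution_def, mul_comm]

-- The derivative falls on the kernel, and t ↦ φ(z - t) is an admissible test function once the ball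
-- around z lies in U. The sign produced by the reflection cancels the one in the weak derivative.
open scoped Convolution in
theorem fderiv_mollify {U : Set ℂ} (hU : MeasurableSet U) {e : ℂ} {u u' : ℂ → ℂ}
    (h : HasWeakDirDeriv U e u u') (hu : MemLp u 2 (volume.restrict U))
    (φ : ContDiffBump (0 : ℂ)) {z : ℂ} (hz : Metric.closedBall z φ.rOut ⊆ U) :
    fderiv ℝ (φ.normed volume ⋆[ContinuousLinearMap.lsmul ℝ ℝ, volume] (U.indicator u)) z e =
      (φ.normed volume ⋆[ContinuousLinearMap.lsmul ℝ ℝ, volume] (U.indicator u')) z := by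
  have hloc : LocallyIntegrable (U.indicator u) volume :=
    ((memLp_indicator_iff_restrict hU).2 hu).locallyIntegrable (by norm_num)
  have hsm : ContDiff ℝ ∞ (φ.normed volume) := φ.contDiff_normed
  have hd := (φ.hasCompactSupport_normed (μ := volume)).hasFDerivAt_convolution_left (μ := volume)
    (ContinuousLinearMap.lsmul ℝ ℝ (E := ℂ)) (φ.contDiff_normed (n := 1)) hloc z
  rw [hd.fderiv]
  have hce : ConvolutionExistsAt (fderiv ℝ (φ.normed volume)) (U.indicator u) z
      ((ContinuousLinearMap.lsmul ℝ ℝ (E := ℂ)).precompL ℂ) volume :=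
    HasCompactSupport.convolutionExists_left _ (φ.hasCompactSupport_normed.fderiv ℝ)
      (hsm.continuous_fderiv (by simp)) hloc z
  set τ : ℂ → ℝ := fun t => φ.normed volume (z - t) with hτ
  have hτd : ∀ t, fderiv ℝ τ t e = -fderiv ℝ (φ.normed volume) (z - t) e := by
    intro t
    have : HasFDerivAt τ ((fderiv ℝ (φ.normed volume) (z - t)).comp
        (-ContinuousLinearMap.id ℝ ℂ)) t :=
      ((hsm.differentiable (by simp)) (z - t)).hasFDerivAt.comp t
        ((hasFDerivAt_id t).const_sub z)
    rw [this.fderiv]; simp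
  have hw := h τ (hsm.comp (by fun_prop))
    (φ.hasCompactSupport_normed.comp_homeomorph (Homeomorph.subLeft z)) (by
      refine subset_trans ?_ hz
      refine closure_minimal ?_ Metric.isClosed_closedBall
      intro t ht
      have : z - t ∈ Function.support (φ.normed volume) := ht
      rw [φ.support_normed_eq] at this
      have h2 := Metric.ball_subset_closedBall this
      simpa [dist_eq_norm, norm_sub_rev] using h2)
  rw [convolution_eq_swap, convolution_eq_swap]
  rw [ContinuousLinearMap.integral_apply hce.integrable_swap]
  simp only [ContinuousLinearMap.precompL_apply, ContinuousLinearMap.lsmul_apply]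
  have e1 : ∀ (p : ℂ → ℝ) (q : ℂ → ℂ), ∫ t, p t • U.indicator q t = ∫ t in U, p t • q t := by
    intro p q
    rw [← integral_indicator hU]
    congr 1; ext t
    by_cases ht : t ∈ U <;> simp [ht]
  rw [e1, e1]
  simp only [hτd, neg_smul, integral_neg, neg_inj] at hw
  exact hw

/-- Mollification: a square integrable map is approximated, on a compact subset of its domain, by
smooth maps whose directional derivatives converge weakly in `L²` to the weak ones. -/
theorem exists_smooth_approx {U : Set ℂ} (hU : IsOpen U) {u : ℂ → ℂ}
    (hu : MemLp u 2 (volume.restrict U)) {K : Set ℂ} (hK : IsCompact K) (hKU : K ⊆ U) :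
    ∃ v : ℕ → ℂ → ℂ, (∀ n, ContDiff ℝ ∞ (v n)) ∧
      ∀ ψ : ℂ → ℂ, MemLp ψ 2 (volume.restrict U) → (∀ z, z ∉ K → ψ z = 0) →
        Tendsto (fun n => ∫ z in U, ψ z * v n z) atTop (𝓝 (∫ z in U, ψ z * u z)) ∧
        ∀ (e : ℂ) (u' : ℂ → ℂ), MemLp u' 2 (volume.restrict U) → HasWeakDirDeriv U e u u' →
          Tendsto (fun n => ∫ z in U, ψ z * fderiv ℝ (v n) z e) atTop
            (𝓝 (∫ z in U, ψ z * u' z)) := by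
  -- All radii ε/(n+1) keep the balls around points of K inside U, so for every n, on K, the
  -- derivative of the mollified map is the mollified weak derivative.
  obtain ⟨ε, hε, hεU⟩ := hK.exists_cthickening_subset_open hU hKU
  let φ : ℕ → ContDiffBump (0 : ℂ) := fun n =>
    ⟨ε / (n + 1) / 2, ε / (n + 1), by positivity, by
      have : (0 : ℝ) < ε / (n + 1) := by positivity
      linarith⟩
  have hφ : Tendsto (fun n => (φ n).rOut) atTop (𝓝 0) :=
    tendsto_const_div_atTop_nhds_zero_nat ε |>.comp (tendsto_add_atTop_nat 1) |>.congr
      fun n => by simp [φ]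
  have hball : ∀ n, ∀ z ∈ K, Metric.closedBall z (φ n).rOut ⊆ U := by
    intro n z hz
    refine subset_trans ?_ hεU
    refine subset_trans (Metric.closedBall_subset_closedBall ?_)
      (Metric.closedBall_subset_cthickening hz ε)
    exact div_le_self hε.le (by linarith [(Nat.cast_nonneg n : (0 : ℝ) ≤ n)])
  have hi : ∀ f : ℂ → ℂ, MemLp f 2 (volume.restrict U) → MemLp (U.indicator f) 2 volume :=
    fun f hf => (memLp_indicator_iff_restrict hU.measurableSet).2 hf
  have e1 : ∀ p q : ℂ → ℂ, (∀ z, z ∉ K → p z = 0) → ∫ t in U, p t * q t = ∫ t, p t * q t := by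
    intro p q hp
    refine setIntegral_eq_integral_of_forall_compl_eq_zero fun z hz => ?_
    rw [hp z fun hzK => hz (hKU hzK), zero_mul]
  have e2 : ∀ p q : ℂ → ℂ, (∀ z, z ∉ K → p z = 0) →
      ∫ t, p t * U.indicator q t = ∫ t, p t * q t := by
    intro p q hp
    congr 1; ext z
    by_cases hz : z ∈ K
    · rw [Set.indicator_of_mem (hKU hz)]
    · rw [hp z hz, zero_mul, zero_mul]
  refine ⟨fun n => (convolution ((φ n).normed volume) (U.indicator u)
    (ContinuousLinearMap.lsmul ℝ ℝ) volume), fun n => ?_, fun ψ hψ hψK => ?_⟩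
  · exact (φ n).hasCompactSupport_normed.contDiff_convolution_left _ (φ n).contDiff_normed
      ((hi u hu).locallyIntegrable (by norm_num))
  · have hψ' : MemLp ψ 2 volume := by
      have := hi ψ hψ
      rwa [Set.indicator_eq_self.2] at this
      intro z hz
      by_contra hzU
      exact hz (hψK z fun hzK => hzU (hKU hzK))
    have key : ∀ f : ℂ → ℂ, MemLp f 2 (volume.restrict U) → ∀ w : ℕ → ℂ → ℂ,
        (∀ n, ∀ z ∈ K, w n z = (convolution ((φ n).normed volume) (U.indicator f)
          (ContinuousLinearMap.lsmul ℝ ℝ) volume) z) →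
        Tendsto (fun n => ∫ z in U, ψ z * w n z) atTop (𝓝 (∫ z in U, ψ z * f z)) := by
      intro f hf w hw
      have h1 := tendsto_integral_mul_mollify hφ (hi f hf) hψ'
      rw [e2 ψ f hψK, ← e1 ψ f hψK] at h1
      refine h1.congr fun n => ?_
      rw [e1 ψ _ hψK]
      congr 1; ext z
      by_cases hz : z ∈ K
      · rw [hw n z hz]
      · rw [hψK z hz, zero_mul, zero_mul]
    exact ⟨key u hu _ fun n z _ => rfl, fun e u' hu' hw =>
      key u' hu' _ fun n z hz => fderiv_mollify hU.measurableSet hw hu (φ n) (hball n z hz)⟩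

/-! ### Calculus of weak derivatives. -/

theorem ContDiff.memLp_top_of_hasCompactSupport {E : Type*} [NormedAddCommGroup E]
    [NormedSpace ℝ E] {φ : ℂ → E} {n : WithTop ℕ∞}
    (hφ : ContDiff ℝ n φ) (hc : HasCompactSupport φ) (μ : Measure ℂ) : MemLp φ ⊤ μ := by
  obtain ⟨C, hC⟩ := hc.exists_bound_of_continuous hφ.continuous
  exact memLp_top_of_bound hφ.continuous.aestronglyMeasurable C (Eventually.of_forall hC)

theorem MemLp.bdd_mul_left {p : ENNReal} {μ : Measure ℂ} {φ f : ℂ → ℂ} (hf : MemLp f p μ)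
    (hφ : MemLp φ ⊤ μ) : MemLp (fun z => φ z * f z) p μ :=
  hf.mul hφ

theorem MemLp.integrable_of_compact {U : Set ℂ} {φ f : ℂ → ℂ} (hf : MemLp f 2 (volume.restrict U))
    (hφ : Continuous φ) (hc : HasCompactSupport φ) :
    Integrable (fun z => φ z * f z) (volume.restrict U) :=
  (hφ.memLp_of_hasCompactSupport (p := 2) hc).integrable_mul hf

/-- Test functions in `HasWeakDirDeriv` are real, whereas products of a cutoff with a mollified map
are complex; real and imaginary parts are tested separately. -/
theorem HasWeakDirDeriv.integral_fderiv_mul {U : Set ℂ} {e : ℂ} {u u' : ℂ → ℂ}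
    (h : HasWeakDirDeriv U e u u') (hu : MemLp u 2 (volume.restrict U))
    (hu' : MemLp u' 2 (volume.restrict U)) {φ : ℂ → ℂ} (hφ : ContDiff ℝ ∞ φ)
    (hc : HasCompactSupport φ) (hs : tsupport φ ⊆ U) :
    ∫ z in U, fderiv ℝ φ z e * u z = -∫ z in U, φ z * u' z := by
  have key : ∀ ℓ : ℂ →L[ℝ] ℝ, 
      ContDiff ℝ ∞ (fun z => ℓ (φ z)) ∧ HasCompactSupport (fun z => ℓ (φ z)) ∧
      (∀ z, fderiv ℝ (fun z => ℓ (φ z)) z e = ℓ (fderiv ℝ φ z e)) ∧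
      ∫ z in U, (ℓ (fderiv ℝ φ z e) : ℂ) * u z = -∫ z in U, (ℓ (φ z) : ℂ) * u' z := by
    intro ℓ
    have h1 : ContDiff ℝ ∞ (fun z => ℓ (φ z)) := ℓ.contDiff.comp hφ
    have h2 : HasCompactSupport (fun z => ℓ (φ z)) := hc.comp_left (map_zero ℓ)
    have h3 : ∀ z, fderiv ℝ (fun z => ℓ (φ z)) z e = ℓ (fderiv ℝ φ z e) := by
      intro z
      have := ℓ.hasFDerivAt.comp z ((hφ.differentiable (by simp)) z).hasFDerivAt
      rw [show (fun z => ℓ (φ z)) = ℓ ∘ φ from rfl, this.fderiv]; rfl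
    refine ⟨h1, h2, h3, ?_⟩
    have h4 := h _ h1 h2 ((tsupport_comp_subset (map_zero ℓ) φ).trans hs)
    simpa only [h3, Complex.real_smul] using h4
  have hdc : Continuous fun z => fderiv ℝ φ z e := (hφ.continuous_fderiv (by simp)).clm_apply
    continuous_const
  have hds : HasCompactSupport fun z => fderiv ℝ φ z e := hc.fderiv_apply ℝ e
  have split : ∀ (p q : ℂ → ℂ), Continuous p → HasCompactSupport p →
      MemLp q 2 (volume.restrict U) → ∫ z in U, p z * q z =
        (∫ z in U, (Complex.reCLM (p z) : ℂ) * q z) +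
          Complex.I * ∫ z in U, (Complex.imCLM (p z) : ℂ) * q z := by
    intro p q hp hpc hq
    rw [← integral_const_mul, ← integral_add]
    · congr 1; ext z
      simp only [Complex.reCLM_apply, Complex.imCLM_apply]
      linear_combination (-q z) * Complex.re_add_im (p z)
    · exact MemLp.integrable_of_compact hq (by fun_prop) (hpc.comp_left (g := fun w : ℂ => ((Complex.reCLM w : ℝ) : ℂ)) (by simp))
    · exact (MemLp.integrable_of_compact hq (by fun_prop) (hpc.comp_left (g := fun w : ℂ => ((Complex.imCLM w : ℝ) : ℂ)) (by simp))).const_mul _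
  rw [split _ _ hdc hds hu, split _ _ hφ.continuous hc hu', (key Complex.reCLM).2.2.2,
    (key Complex.imCLM).2.2.2]
  ring

theorem fderiv_mul_apply {f g : ℂ → ℂ} (hf : ContDiff ℝ ∞ f) (hg : ContDiff ℝ ∞ g) (z e : ℂ) :
    fderiv ℝ (fun w => f w * g w) z e = fderiv ℝ f z e * g z + f z * fderiv ℝ g z e := by
  have := (((hf.differentiable (by simp)) z).hasFDerivAt.mul
    ((hg.differentiable (by simp)) z).hasFDerivAt)
  rw [show (fun w => f w * g w) = f * g from rfl, this.fderiv]
  simp; ring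

/-- The product rule for weak derivatives of square integrable maps. -/
theorem HasWeakDirDeriv.integral_fderiv_mul_mul {U : Set ℂ} (hU : IsOpen U) {e : ℂ}
    {f f' g g' : ℂ → ℂ} (hf : HasWeakDirDeriv U e f f') (hfL : MemLp f 2 (volume.restrict U))
    (hfL' : MemLp f' 2 (volume.restrict U)) (hg : HasWeakDirDeriv U e g g')
    (hgL : MemLp g 2 (volume.restrict U)) (hgL' : MemLp g' 2 (volume.restrict U))
    {φ : ℂ → ℂ} (hφ : ContDiff ℝ ∞ φ) (hc : HasCompactSupport φ) (hs : tsupport φ ⊆ U) :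
    ∫ z in U, fderiv ℝ φ z e * (f z * g z) = -∫ z in U, φ z * (f' z * g z + f z * g' z) := by
  -- Only g is mollified: φ vₙ is then a test function for f, and every term is linear in vₙ, so
  -- weak convergence suffices for the limit.
  obtain ⟨v, hv, hlim⟩ := exists_smooth_approx hU hgL hc hs
  have hφ' : ContDiff ℝ ∞ fun z => fderiv ℝ φ z e := (hφ.fderiv_right (by simp)).clm_apply
    contDiff_const
  have hds : HasCompactSupport fun z => fderiv ℝ φ z e := hc.fderiv_apply ℝ e
  have hT := hφ.memLp_top_of_hasCompactSupport hc (volume.restrict U)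
  have hT' := hφ'.memLp_top_of_hasCompactSupport hds (volume.restrict U)
  have z0 : ∀ z, z ∉ tsupport φ → φ z = 0 := fun z hz => image_eq_zero_of_notMem_tsupport hz
  have z1 : ∀ z, z ∉ tsupport φ → fderiv ℝ φ z e = 0 := fun z hz => by
    have : z ∉ tsupport (fderiv ℝ φ) := fun h => hz (tsupport_fderiv_subset ℝ h)
    rw [image_eq_zero_of_notMem_tsupport this]; rfl
  have l1 := (hlim (fun z => fderiv ℝ φ z e * f z) (MemLp.bdd_mul_left hfL hT')
    (fun z hz => by rw [z1 z hz, zero_mul])).1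
  have l2 := (hlim (fun z => φ z * f z) (MemLp.bdd_mul_left hfL hT)
    (fun z hz => by rw [z0 z hz, zero_mul])).2 e g' hgL' hg
  have l3 := (hlim (fun z => φ z * f' z) (MemLp.bdd_mul_left hfL' hT)
    (fun z hz => by rw [z0 z hz, zero_mul])).1
  have hn : ∀ n, (∫ z in U, fderiv ℝ φ z e * f z * v n z) +
      (∫ z in U, φ z * f z * fderiv ℝ (v n) z e) = -∫ z in U, φ z * f' z * v n z := by
    intro n
    have h1 := hf.integral_fderiv_mul hfL hfL' (φ := fun z => φ z * v n z) (hφ.mul (hv n))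
      hc.mul_right ((tsupport_mul_subset_left).trans hs)
    simp only [fderiv_mul_apply hφ (hv n)] at h1
    rw [← integral_add]
    · convert h1 using 2
      · ext z; ring
      · congr 1; ext z; ring
    · refine (MemLp.integrable_of_compact (φ := fun z => fderiv ℝ φ z e * v n z) hfL
        (hφ'.continuous.mul (hv n).continuous) hds.mul_right).congr (Eventually.of_forall ?_)
      intro z; ring
    · refine (MemLp.integrable_of_compact (φ := fun z => φ z * fderiv ℝ (v n) z e) hfL
        (hφ.continuous.mul (((hv n).continuous_fderiv (by simp)).clm_apply continuous_const))
        hc.mul_right).congr (Eventually.of_forall ?_)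
      intro z; ring
  have h2 := tendsto_nhds_unique (l1.add l2) (by simpa only [hn] using l3.neg)
  have h3 : ∫ z in U, φ z * (f' z * g z + f z * g' z) =
      ∫ z in U, (φ z * f' z * g z + φ z * f z * g' z) := by
    congr 1; ext z; ring
  rw [h3, integral_add, neg_add, ← h2]
  · simp only [mul_assoc]; ring
  · exact (MemLp.bdd_mul_left hfL' hT).integrable_mul hgL
  · exact (MemLp.bdd_mul_left hfL hT).integrable_mul hgL'

/-- The weak form of `∂₂(f ∂₁g) - ∂₁(f ∂₂g) = ∂₂f ∂₁g - ∂₁f ∂₂g`. -/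
theorem HasWeakDirDeriv.integral_mul_jacobian {U : Set ℂ} (hU : IsOpen U) {e₁ e₂ : ℂ}
    {f f₁ f₂ g g₁ g₂ : ℂ → ℂ} (hf₁ : HasWeakDirDeriv U e₁ f f₁) (hf₂ : HasWeakDirDeriv U e₂ f f₂)
    (hfL : MemLp f 2 (volume.restrict U)) (hfL₁ : MemLp f₁ 2 (volume.restrict U))
    (hfL₂ : MemLp f₂ 2 (volume.restrict U))
    (hg₁ : HasWeakDirDeriv U e₁ g g₁) (hg₂ : HasWeakDirDeriv U e₂ g g₂)
    (hgL : MemLp g 2 (volume.restrict U)) (hgL₁ : MemLp g₁ 2 (volume.restrict U))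
    (hgL₂ : MemLp g₂ 2 (volume.restrict U))
    {φ : ℂ → ℂ} (hφ : ContDiff ℝ ∞ φ) (hc : HasCompactSupport φ) (hs : tsupport φ ⊆ U) :
    ∫ z in U, f z * (g₁ z * fderiv ℝ φ z e₂ - g₂ z * fderiv ℝ φ z e₁) =
      -∫ z in U, φ z * (f₂ z * g₁ z - f₁ z * g₂ z) := by
  obtain ⟨v, hv, hlim⟩ := exists_smooth_approx hU hgL hc hs
  have hφ' : ∀ e, ContDiff ℝ ∞ fun z => fderiv ℝ φ z e :=
    fun e => (hφ.fderiv_right (by simp)).clm_apply contDiff_const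
  have hds : ∀ e, HasCompactSupport fun z => fderiv ℝ φ z e := fun e => hc.fderiv_apply ℝ e
  have hT := hφ.memLp_top_of_hasCompactSupport hc (volume.restrict U)
  have hT' := fun e => (hφ' e).memLp_top_of_hasCompactSupport (hds e) (volume.restrict U)
  have z0 : ∀ z, z ∉ tsupport φ → φ z = 0 := fun z hz => image_eq_zero_of_notMem_tsupport hz
  have z1 : ∀ e z, z ∉ tsupport φ → fderiv ℝ φ z e = 0 := fun e z hz => by
    have : z ∉ tsupport (fderiv ℝ φ) := fun h => hz (tsupport_fderiv_subset ℝ h)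
    rw [image_eq_zero_of_notMem_tsupport this]; rfl
  have hv' : ∀ n e, ContDiff ℝ ∞ fun z => fderiv ℝ (v n) z e :=
    fun n e => ((hv n).fderiv_right (by simp)).clm_apply contDiff_const
  have l1 := (hlim (fun z => fderiv ℝ φ z e₂ * f z) (MemLp.bdd_mul_left hfL (hT' e₂))
    (fun z hz => by rw [z1 _ z hz, zero_mul])).2 e₁ g₁ hgL₁ hg₁
  have l2 := (hlim (fun z => fderiv ℝ φ z e₁ * f z) (MemLp.bdd_mul_left hfL (hT' e₁))
    (fun z hz => by rw [z1 _ z hz, zero_mul])).2 e₂ g₂ hgL₂ hg₂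
  have l3 := (hlim (fun z => φ z * f₂ z) (MemLp.bdd_mul_left hfL₂ hT)
    (fun z hz => by rw [z0 z hz, zero_mul])).2 e₁ g₁ hgL₁ hg₁
  have l4 := (hlim (fun z => φ z * f₁ z) (MemLp.bdd_mul_left hfL₁ hT)
    (fun z hz => by rw [z0 z hz, zero_mul])).2 e₂ g₂ hgL₂ hg₂
  -- The e₂-derivative of f is tested with φ ∂₁vₙ and the e₁-derivative with φ ∂₂vₙ; in the
  -- difference the second derivatives of vₙ cancel, and only first derivatives have to converge.
  have hsym : ∀ n z, fderiv ℝ (fun w => fderiv ℝ (v n) w e₁) z e₂ =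
      fderiv ℝ (fun w => fderiv ℝ (v n) w e₂) z e₁ := by
    intro n z
    have hd : DifferentiableAt ℝ (fderiv ℝ (v n)) z :=
      ((hv n).fderiv_right (m := ∞) (by simp)).differentiable (by simp) z
    have := ((hv n).contDiffAt (x := z)).isSymmSndFDerivAt (by simpa using WithTop.coe_le_coe.2 (le_top (a := (2 : ℕ∞))))
    rw [fderiv_clm_apply hd (by fun_prop), fderiv_clm_apply hd (by fun_prop)]
    simpa using (this e₁ e₂).symm
  have hI : ∀ (p q : ℂ → ℂ), ContDiff ℝ ∞ p → HasCompactSupport p → 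
      MemLp q 2 (volume.restrict U) → Integrable (fun z => p z * q z) (volume.restrict U) :=
    fun p q hp hpc hq => MemLp.integrable_of_compact hq hp.continuous hpc
  have hn : ∀ n, (∫ z in U, fderiv ℝ φ z e₂ * f z * fderiv ℝ (v n) z e₁) -
      (∫ z in U, fderiv ℝ φ z e₁ * f z * fderiv ℝ (v n) z e₂) =
      -((∫ z in U, φ z * f₂ z * fderiv ℝ (v n) z e₁) -
        ∫ z in U, φ z * f₁ z * fderiv ℝ (v n) z e₂) := by
    intro n
    have A := hf₂.integral_fderiv_mul hfL hfL₂ (φ := fun z => φ z * fderiv ℝ (v n) z e₁)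
      (hφ.mul (hv' n e₁)) hc.mul_right ((tsupport_mul_subset_left).trans hs)
    have B := hf₁.integral_fderiv_mul hfL hfL₁ (φ := fun z => φ z * fderiv ℝ (v n) z e₂)
      (hφ.mul (hv' n e₂)) hc.mul_right ((tsupport_mul_subset_left).trans hs)
    simp only [fderiv_mul_apply hφ (hv' n _), add_mul, hsym] at A B
    rw [integral_add (hI _ _ ((hφ' e₂).mul (hv' n e₁)) (hds e₂).mul_right hfL)
      (hI (fun z => φ z * fderiv ℝ (fun w => fderiv ℝ (v n) w e₂) z e₁) _
        (hφ.mul (((hv' n e₂).fderiv_right (by simp)).clm_apply contDiff_const))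
        hc.mul_right hfL)] at A
    rw [integral_add (hI _ _ ((hφ' e₁).mul (hv' n e₂)) (hds e₁).mul_right hfL)
      (hI (fun z => φ z * fderiv ℝ (fun w => fderiv ℝ (v n) w e₂) z e₁) _
        (hφ.mul (((hv' n e₂).fderiv_right (by simp)).clm_apply contDiff_const))
        hc.mul_right hfL)] at B
    simp only [mul_right_comm _ (f _), mul_right_comm _ (f₁ _), mul_right_comm _ (f₂ _)] 
    linear_combination A - B
  have h2 := tendsto_nhds_unique (l1.sub l2) (by simpa only [hn] using (l3.sub l4).neg)
  have h3 : ∫ z in U, φ z * (f₂ z * g₁ z - f₁ z * g₂ z) =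
      ∫ z in U, (φ z * f₂ z * g₁ z - φ z * f₁ z * g₂ z) := by
    congr 1; ext z; ring
  have h4 : ∫ z in U, f z * (g₁ z * fderiv ℝ φ z e₂ - g₂ z * fderiv ℝ φ z e₁) =
      ∫ z in U, (fderiv ℝ φ z e₂ * f z * g₁ z - fderiv ℝ φ z e₁ * f z * g₂ z) := by
    congr 1; ext z; ring
  rw [h3, h4, integral_sub, h2, integral_sub]
  · exact (MemLp.bdd_mul_left hfL₂ hT).integrable_mul hgL₁
  · exact (MemLp.bdd_mul_left hfL₁ hT).integrable_mul hgL₂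
  · exact (MemLp.bdd_mul_left hfL (hT' e₂)).integrable_mul hgL₁
  · exact (MemLp.bdd_mul_left hfL (hT' e₁)).integrable_mul hgL₂

theorem HasWeakDirDeriv.conj {U : Set ℂ} {e : ℂ} {u u' : ℂ → ℂ} (h : HasWeakDirDeriv U e u u') :
    HasWeakDirDeriv U e (fun z => conj (u z)) fun z => conj (u' z) := by
  intro φ h1 h2 h3
  have := congrArg (starRingEnd ℂ) (h φ h1 h2 h3)
  rw [map_neg, ← integral_conj, ← integral_conj] at this
  simpa [Complex.real_smul] using this

theorem MemLp.conj {p : ENNReal} {μ : Measure ℂ} {f : ℂ → ℂ} (hf : MemLp f p μ) :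
    MemLp (fun z => conj (f z)) p μ := hf.star

theorem integral_fderiv_eq_zero_of_hasCompactSupport {φ : ℂ → ℂ} (hφ : ContDiff ℝ ∞ φ)
    (hc : HasCompactSupport φ) (e : ℂ) : ∫ z, fderiv ℝ φ z e = 0 := by
  have hi : Integrable (fun z => fderiv ℝ φ z e) :=
    ((hφ.continuous_fderiv (by simp)).clm_apply continuous_const).integrable_of_hasCompactSupport
      (hc.fderiv_apply ℝ e)
  have := integral_mul_fderiv_eq_neg_fderiv_mul_of_integrable (μ := (volume : Measure ℂ))
    (f := fun _ : ℂ => (1 : ℂ)) (g := φ) (v := e) (by simp)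
    (by simpa using hi) (by simpa using hφ.continuous.integrable_of_hasCompactSupport hc)
    (by simp) (fun x _ => (hφ.differentiable (by simp)) x)
  simpa using this

theorem ContDiff.ofReal_comp {φ : ℂ → ℝ} (h : ContDiff ℝ ∞ φ) :
    ContDiff ℝ ∞ fun z => (φ z : ℂ) :=
  Complex.ofRealCLM.contDiff.comp h

theorem fderiv_ofReal_comp {φ : ℂ → ℝ} (h : ContDiff ℝ ∞ φ) (z e : ℂ) :
    fderiv ℝ (fun w => (φ w : ℂ)) z e = (fderiv ℝ φ z e : ℂ) := by
  have := Complex.ofRealCLM.hasFDerivAt.comp z ((h.differentiable (by simp)) z).hasFDerivAt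
  rw [show (fun w => (φ w : ℂ)) = Complex.ofRealCLM ∘ φ from rfl, this.fderiv]; rfl

/-! ### The weak phase gradient of a unimodular map. -/

/-- For a map `u = exp (i Φ)` with directional derivative `u'`, this is the directional
derivative of the phase `Φ`. -/
noncomputable def current (u u' : ℂ → ℂ) (z : ℂ) : ℝ := (conj (u z) * u' z).im

/-- A weak derivative of a unimodular map is tangential. -/
theorem HasWeakDirDeriv.eq_current_mul {U : Set ℂ} (hU : IsOpen U) {e : ℂ} {u u' : ℂ → ℂ}
    (h : HasWeakDirDeriv U e u u') (hu : MemLp u 2 (volume.restrict U))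
    (hu' : MemLp u' 2 (volume.restrict U)) (h1 : ∀ᵐ z ∂(volume.restrict U), ‖u z‖ = 1) :
    ∀ᵐ z ∂(volume.restrict U), u' z = Complex.I * current u u' z * u z := by
  have hint : Integrable (fun z => conj (u' z) * u z + conj (u z) * u' z) (volume.restrict U) :=
    ((MemLp.conj hu').integrable_mul hu).add ((MemLp.conj hu).integrable_mul hu')
  have hunit : ∀ᵐ z ∂(volume.restrict U), conj (u z) * u z = 1 := by
    filter_upwards [h1] with z hz
    rw [Complex.conj_mul', hz]; simp
  have h0 : ∀ᵐ z ∂volume, z ∈ U → conj (u' z) * u z + conj (u z) * u' z = 0 := by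
    refine hU.ae_eq_zero_of_integral_contDiff_smul_eq_zero
      (IntegrableOn.locallyIntegrableOn hint) ?_
    intro φ hφ hc hs
    have hcc : HasCompactSupport fun z => (φ z : ℂ) :=
      hc.comp_left (g := Complex.ofReal) rfl
    have hss : tsupport (fun z => (φ z : ℂ)) ⊆ U :=
      (tsupport_comp_subset (g := Complex.ofReal) rfl φ).trans hs
    -- The product conj u · u is the constant 1, whose weak derivative is 0; the product rule then
    -- says Re(conj u · u') = 0.
    have h2 := h.conj.integral_fderiv_mul_mul hU (MemLp.conj hu) (MemLp.conj hu') h hu hu'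
      hφ.ofReal_comp hcc hss
    have h3 : ∫ z in U, fderiv ℝ (fun z => (φ z : ℂ)) z e * (conj (u z) * u z) = 0 := by
      rw [integral_congr_ae (g := fun z => fderiv ℝ (fun z => (φ z : ℂ)) z e)
        (by filter_upwards [hunit] with z hz; rw [hz, mul_one]),
        setIntegral_eq_integral_of_forall_compl_eq_zero,
        integral_fderiv_eq_zero_of_hasCompactSupport hφ.ofReal_comp hcc]
      intro z hz
      have : z ∉ tsupport (fderiv ℝ fun z => (φ z : ℂ)) :=
        fun h => hz (hss (tsupport_fderiv_subset ℝ h))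
      rw [image_eq_zero_of_notMem_tsupport this]; rfl
    rw [h3] at h2
    have h4 : ∫ z in U, (φ z : ℂ) * (conj (u' z) * u z + conj (u z) * u' z) = 0 := by
      simpa using h2.symm
    rw [setIntegral_eq_integral_of_forall_compl_eq_zero] at h4
    · simpa only [Complex.real_smul] using h4
    · intro z hz
      rw [image_eq_zero_of_notMem_tsupport fun h => hz (hs h)]; simp
  filter_upwards [(ae_restrict_iff' hU.measurableSet).2 h0, hunit] with z hz hz1
  have h5 : (conj (u z) * u' z).re = 0 := by
    have := congrArg Complex.re hz
    simp at this ⊢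
    linarith
  have h6 : conj (u z) * u' z = Complex.I * current u u' z := by
    apply Complex.ext <;> simp [current] at h5 ⊢
    exact h5
  rw [← h6]
  linear_combination (-u' z) * hz1

theorem MemLp.integrable_current {U : Set ℂ} {u u' : ℂ → ℂ} (hu : MemLp u 2 (volume.restrict U))
    (hu' : MemLp u' 2 (volume.restrict U)) : Integrable (current u u') (volume.restrict U) :=
  ((MemLp.conj hu).integrable_mul hu').im

/-- The phase gradient of a unimodular `H¹` map is weakly curl-free. -/
theorem IsH1.integral_current_curl {U : Set ℂ} (hU : IsOpen U) {u ux uy : ℂ → ℂ}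
    (h : IsH1 U u ux uy) (h1 : ∀ᵐ z ∂(volume.restrict U), ‖u z‖ = 1)
    {φ : ℂ → ℝ} (hφ : ContDiff ℝ ∞ φ) (hc : HasCompactSupport φ) (hs : tsupport φ ⊆ U) :
    ∫ z in U, (current u ux z * fderiv ℝ φ z Complex.I - current u uy z * fderiv ℝ φ z 1) = 0 := by
  have hcc : HasCompactSupport fun z => (φ z : ℂ) := hc.comp_left (g := Complex.ofReal) rfl
  have hss : tsupport (fun z => (φ z : ℂ)) ⊆ U :=
    (tsupport_comp_subset (g := Complex.ofReal) rfl φ).trans hs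
  have key := HasWeakDirDeriv.integral_mul_jacobian hU h.weak_x.conj h.weak_y.conj
    (MemLp.conj h.memLp) (MemLp.conj h.memLp_x) (MemLp.conj h.memLp_y) h.weak_x h.weak_y h.memLp
    h.memLp_x h.memLp_y hφ.ofReal_comp hcc hss
  have hx := h.weak_x.eq_current_mul hU h.memLp h.memLp_x h1
  have hy := h.weak_y.eq_current_mul hU h.memLp h.memLp_y h1
  -- Both partial derivatives are real multiples of i u, so the Jacobian of conj u and u vanishes
  -- almost everywhere.
  have r0 : ∫ z in U, (φ z : ℂ) * (conj (uy z) * ux z - conj (ux z) * uy z) = 0 := by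
    refine integral_eq_zero_of_ae ?_
    filter_upwards [hx, hy] with z hx hy
    rw [hx, hy]; simp; right; ring
  rw [r0, neg_zero] at key
  have e : ∫ z in U, conj (u z) * (ux z * fderiv ℝ (fun z => (φ z : ℂ)) z Complex.I -
      uy z * fderiv ℝ (fun z => (φ z : ℂ)) z 1) = ∫ z in U, Complex.I *
      ((current u ux z * fderiv ℝ φ z Complex.I - current u uy z * fderiv ℝ φ z 1 : ℝ) : ℂ) := by
    refine integral_congr_ae ?_
    filter_upwards [hx, hy, h1] with z hx hy h1
    have hunit : conj (u z) * u z = 1 := by rw [Complex.conj_mul', h1]; simp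
    rw [fderiv_ofReal_comp hφ, fderiv_ofReal_comp hφ]
    conv_lhs => rw [hx, hy]
    push_cast
    linear_combination (Complex.I * (current u ux z * fderiv ℝ φ z Complex.I -
      current u uy z * fderiv ℝ φ z 1)) * hunit
  rw [e, integral_const_mul, integral_complex_ofReal] at key
  simpa using key

/-! ### The angular current and radial test functions on annuli. -/

/-- For a map `u = exp (i Φ)` with partial derivatives `ux`, `uy`, this is the derivative of the
phase `Φ` with respect to the polar angle. -/
noncomputable def angularCurrent (u ux uy : ℂ → ℂ) (z : ℂ) : ℝ :=
  z.re * current u uy z - z.im * current u ux z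

theorem isOpen_openAnnulus (R₁ R₂ : ℝ) : IsOpen (openAnnulus R₁ R₂) :=
  (isOpen_lt continuous_const continuous_norm).inter (isOpen_lt continuous_norm continuous_const)

theorem openAnnulus_subset_ball (R₁ R₂ : ℝ) : openAnnulus R₁ R₂ ⊆ Metric.ball 0 R₂ :=
  fun z hz => by simpa using hz.2

theorem volume_openAnnulus_lt_top (R₁ R₂ : ℝ) : volume (openAnnulus R₁ R₂) < ⊤ :=
  (measure_mono (openAnnulus_subset_ball R₁ R₂)).trans_lt measure_ball_lt_top

instance (R₁ R₂ : ℝ) : IsFiniteMeasure (volume.restrict (openAnnulus R₁ R₂)) :=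
  isFiniteMeasure_restrict.2 (volume_openAnnulus_lt_top R₁ R₂).ne

/-- Radial functions are written as functions of |z|² rather than |z|, which keeps them smooth on
the whole plane. -/
theorem fderiv_comp_norm_sq {h : ℝ → ℝ} (hh : ContDiff ℝ ∞ h) (z e : ℂ) :
    fderiv ℝ (fun w : ℂ => h (‖w‖ ^ 2)) z e =
      deriv h (‖z‖ ^ 2) * (2 * (z.re * e.re + z.im * e.im)) := by
  have h1 : HasFDerivAt (fun w : ℂ => ‖w‖ ^ 2) (2 • innerSL ℝ z) z :=
    (hasStrictFDerivAt_norm_sq z).hasFDerivAt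
  have h2 := ((hh.differentiable (by simp)) (‖z‖ ^ 2)).hasDerivAt.comp_hasFDerivAt z h1
  rw [show (fun w : ℂ => h (‖w‖ ^ 2)) = h ∘ fun w : ℂ => ‖w‖ ^ 2 from rfl, h2.fderiv]
  simp [Complex.inner]
  ring_nf
  simp

theorem contDiff_comp_norm_sq {h : ℝ → ℝ} (hh : ContDiff ℝ ∞ h) :
    ContDiff ℝ ∞ fun w : ℂ => h (‖w‖ ^ 2) :=
  hh.comp (contDiff_norm_sq ℝ)

theorem tsupport_comp_norm_sq {h : ℝ → ℝ} {R₁ R₂ : ℝ} (h₂ : 0 ≤ R₂)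
    (hs : tsupport h ⊆ Set.Ioo (R₁ ^ 2) (R₂ ^ 2)) :
    tsupport (fun w : ℂ => h (‖w‖ ^ 2)) ⊆ openAnnulus R₁ R₂ := by
  have : tsupport (fun w : ℂ => h (‖w‖ ^ 2)) ⊆ (fun w : ℂ => ‖w‖ ^ 2) ⁻¹' tsupport h := by
    refine closure_minimal (fun w hw => subset_tsupport h hw)
      ((isClosed_tsupport h).preimage (by fun_prop))
  intro z hz
  have h3 := hs (this hz)
  exact ⟨lt_of_pow_lt_pow_left₀ 2 (norm_nonneg z) h3.1, lt_of_pow_lt_pow_left₀ 2 h₂ h3.2⟩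

theorem hasCompactSupport_of_tsupport_subset_openAnnulus {E : Type*} [Zero E] {φ : ℂ → E}
    {R₁ R₂ : ℝ} (hs : tsupport φ ⊆ openAnnulus R₁ R₂) : HasCompactSupport φ :=
  (isCompact_closedBall (0 : ℂ) R₂).of_isClosed_subset (isClosed_tsupport _)
    (hs.trans ((openAnnulus_subset_ball R₁ R₂).trans Metric.ball_subset_closedBall))

/-- A radial test function in the curl-free identity leaves only x ∂_yΦ - y ∂_xΦ = ∂_θΦ. This is the
distributional form of the fact that the circulation of ∇Φ is the same on all concentric circles. -/
theorem IsH1.integral_deriv_mul_angularCurrent {R₁ R₂ : ℝ} (h₂ : 0 ≤ R₂)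
    {u ux uy : ℂ → ℂ} (hu : IsH1 (openAnnulus R₁ R₂) u ux uy)
    (hu1 : ∀ᵐ z ∂(volume.restrict (openAnnulus R₁ R₂)), ‖u z‖ = 1)
    {h : ℝ → ℝ} (hh : ContDiff ℝ ∞ h) (hs : tsupport h ⊆ Set.Ioo (R₁ ^ 2) (R₂ ^ 2)) :
    ∫ z in openAnnulus R₁ R₂, deriv h (‖z‖ ^ 2) * angularCurrent u ux uy z = 0 := by
  have hs' := tsupport_comp_norm_sq h₂ hs
  have := hu.integral_current_curl (isOpen_openAnnulus R₁ R₂) hu1 (contDiff_comp_norm_sq hh)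
    (hasCompactSupport_of_tsupport_subset_openAnnulus hs') hs'
  have e : ∀ z : ℂ, current u ux z * fderiv ℝ (fun w : ℂ => h (‖w‖ ^ 2)) z Complex.I -
      current u uy z * fderiv ℝ (fun w : ℂ => h (‖w‖ ^ 2)) z 1 =
      (-2) * (deriv h (‖z‖ ^ 2) * angularCurrent u ux uy z) := by
    intro z
    rw [fderiv_comp_norm_sq hh, fderiv_comp_norm_sq hh, angularCurrent]
    simp; ring
  simp only [e, integral_const_mul] at this
  simpa using this

/-- On a circle, conj z² u² is |z|² e^{2i(Φ-θ)}, a periodic function whose θ-derivative is 2i(∂_θΦ -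
1) times itself, so this derivative integrates to zero. Weakly, the product rule for u · u is
applied with the rotation field x ∂_y - y ∂_x. -/
theorem IsH1.integral_sq_mul_angularCurrent {R₁ R₂ : ℝ} (h₂ : 0 ≤ R₂)
    {u ux uy : ℂ → ℂ} (hu : IsH1 (openAnnulus R₁ R₂) u ux uy)
    (hu1 : ∀ᵐ z ∂(volume.restrict (openAnnulus R₁ R₂)), ‖u z‖ = 1)
    {χ : ℝ → ℝ} (hh : ContDiff ℝ ∞ χ) (hs : tsupport χ ⊆ Set.Ioo (R₁ ^ 2) (R₂ ^ 2)) :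
    ∫ z in openAnnulus R₁ R₂, (χ (‖z‖ ^ 2) : ℂ) *
      (conj z ^ 2 * u z ^ 2 * (1 - angularCurrent u ux uy z)) = 0 := by
  set U := openAnnulus R₁ R₂
  have hU : IsOpen U := isOpen_openAnnulus R₁ R₂
  have hs' := tsupport_comp_norm_sq h₂ hs
  have hχ := (contDiff_comp_norm_sq hh).ofReal_comp
  have hcj : ContDiff ℝ ∞ fun z : ℂ => conj z := Complex.conjCLE.contDiff
  set m : ℂ → ℂ := fun z => (χ (‖z‖ ^ 2) : ℂ) * conj z ^ 2 with hm
  have hmd : ContDiff ℝ ∞ m := hχ.mul (hcj.pow 2)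
  have hms : tsupport m ⊆ U := by
    refine (tsupport_mul_subset_left).trans (subset_trans ?_ hs')
    exact tsupport_comp_subset (g := Complex.ofReal) rfl _
  have hre : ContDiff ℝ ∞ fun z : ℂ => (z.re : ℂ) :=
    Complex.ofRealCLM.contDiff.comp Complex.reCLM.contDiff
  have him : ContDiff ℝ ∞ fun z : ℂ => (z.im : ℂ) :=
    Complex.ofRealCLM.contDiff.comp Complex.imCLM.contDiff
  have hms1 : tsupport (fun z => (z.re : ℂ) * m z) ⊆ U := (tsupport_mul_subset_right).trans hms
  have hms2 : tsupport (fun z => (z.im : ℂ) * m z) ⊆ U := (tsupport_mul_subset_right).trans hms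
  have A := hu.weak_y.integral_fderiv_mul_mul hU hu.memLp hu.memLp_y hu.weak_y hu.memLp hu.memLp_y
    (hre.mul hmd) (hasCompactSupport_of_tsupport_subset_openAnnulus hms1) hms1
  have B := hu.weak_x.integral_fderiv_mul_mul hU hu.memLp hu.memLp_x hu.weak_x hu.memLp hu.memLp_x
    (him.mul hmd) (hasCompactSupport_of_tsupport_subset_openAnnulus hms2) hms2
  have hx := hu.weak_x.eq_current_mul hU hu.memLp hu.memLp_x hu1
  have hy := hu.weak_y.eq_current_mul hU hu.memLp hu.memLp_y hu1
  have dre : ∀ z, fderiv ℝ (fun z : ℂ => (z.re : ℂ)) z Complex.I = 0 := fun z => by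
    rw [show (fun z : ℂ => (z.re : ℂ)) = (Complex.ofRealCLM.comp Complex.reCLM) from rfl,
      ContinuousLinearMap.fderiv]; simp
  have dim : ∀ z, fderiv ℝ (fun z : ℂ => (z.im : ℂ)) z 1 = 0 := fun z => by
    rw [show (fun z : ℂ => (z.im : ℂ)) = (Complex.ofRealCLM.comp Complex.imCLM) from rfl,
      ContinuousLinearMap.fderiv]; simp
  simp only [fderiv_mul_apply hre hmd, fderiv_mul_apply him hmd, dre, dim, zero_mul, zero_add]
    at A B
  -- The rotation field kills the radial factor and multiplies conj z² by -2i.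
  have hrot : ∀ z, (z.re : ℂ) * fderiv ℝ m z Complex.I - z.im * fderiv ℝ m z 1 =
      -2 * Complex.I * m z := by
    intro z
    have hp : ContDiff ℝ ∞ fun z : ℂ => conj z ^ 2 := hcj.pow 2
    have hpd : ∀ e, fderiv ℝ (fun z : ℂ => conj z ^ 2) z e = 2 * conj z * conj e := by
      intro e
      have e1 : (fun z : ℂ => conj z ^ 2) = fun z : ℂ => conj z * conj z := by ext; ring
      rw [e1, fderiv_mul_apply hcj hcj]
      have : fderiv ℝ (fun z : ℂ => conj z) z e = conj e := by
        rw [show (fun z : ℂ => conj z) = Complex.conjCLE from rfl, ContinuousLinearEquiv.fderiv]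
        simp
      rw [this]; ring
    rw [hm, fderiv_mul_apply hχ hp, fderiv_mul_apply hχ hp, hpd, hpd,
      fderiv_ofReal_comp (contDiff_comp_norm_sq hh), fderiv_ofReal_comp (contDiff_comp_norm_sq hh),
      fderiv_comp_norm_sq hh, fderiv_comp_norm_sq hh]
    have hz : conj z = z.re - z.im * Complex.I := by
      apply Complex.ext <;> simp
    simp only [hz]
    simp
    linear_combination (-2 * (z.im : ℂ) * (χ (‖z‖ ^ 2) : ℂ) * (z.re - z.im * Complex.I)) *
      Complex.I_sq
  have hI : ∀ p f g : ℂ → ℂ, ContDiff ℝ ∞ p → tsupport p ⊆ U → MemLp f 2 (volume.restrict U) →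
      MemLp g 2 (volume.restrict U) →
      Integrable (fun z => p z * (f z * g z)) (volume.restrict U) := by
    intro p f g hp hps hf hg
    have := (MemLp.bdd_mul_left hf (hp.memLp_top_of_hasCompactSupport
      (hasCompactSupport_of_tsupport_subset_openAnnulus hps) _)).integrable_mul hg
    exact this.congr (Eventually.of_forall fun z => mul_assoc _ _ _)
  have hmd' : ∀ e, ContDiff ℝ ∞ fun z => fderiv ℝ m z e :=
    fun e => (hmd.fderiv_right (by simp)).clm_apply contDiff_const
  have hms' : ∀ e, tsupport (fun z => fderiv ℝ m z e) ⊆ U :=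
    fun e => (tsupport_fderiv_apply_subset ℝ e).trans hms
  have A1 := hI _ u u (hre.mul (hmd' Complex.I)) ((tsupport_mul_subset_right).trans (hms' _))
    hu.memLp hu.memLp
  have B1 := hI _ u u (him.mul (hmd' 1)) ((tsupport_mul_subset_right).trans (hms' _))
    hu.memLp hu.memLp
  have A2 := hI _ u uy (hre.mul hmd) hms1 hu.memLp hu.memLp_y
  have B2 := hI _ u ux (him.mul hmd) hms2 hu.memLp hu.memLp_x
  have M1 := hI _ u u hmd hms hu.memLp hu.memLp
  have L : ∫ z in U, -2 * Complex.I * (m z * (u z * u z)) =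
      (∫ z in U, z.re * fderiv ℝ m z Complex.I * (u z * u z)) -
        ∫ z in U, z.im * fderiv ℝ m z 1 * (u z * u z) := by
    rw [← integral_sub A1 B1]
    congr 1; ext z
    linear_combination (-(u z * u z)) * hrot z
  have hT : ∀ᵐ z ∂(volume.restrict U), z.re * m z * (u z * uy z) - z.im * m z * (u z * ux z) =
      Complex.I * (m z * (u z * u z) * angularCurrent u ux uy z) := by
    filter_upwards [hx, hy] with z hx hy
    conv_lhs => rw [hx, hy]
    simp only [angularCurrent]
    push_cast
    ring
  have R : ∫ z in U, Complex.I * (m z * (u z * u z) * angularCurrent u ux uy z) =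
      (∫ z in U, z.re * m z * (u z * uy z)) - ∫ z in U, z.im * m z * (u z * ux z) := by
    rw [← integral_sub A2 B2]
    exact integral_congr_ae (hT.mono fun z hz => hz.symm)
  have A3 : ∫ z in U, z.re * m z * (uy z * u z + u z * uy z) =
      2 * ∫ z in U, z.re * m z * (u z * uy z) := by
    rw [← integral_const_mul]; congr 1; ext z; ring
  have B3 : ∫ z in U, z.im * m z * (ux z * u z + u z * ux z) =
      2 * ∫ z in U, z.im * m z * (u z * ux z) := by
    rw [← integral_const_mul]; congr 1; ext z; ring
  rw [A3] at A
  rw [B3] at B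
  rw [integral_const_mul] at L R
  have M2 : Integrable (fun z => m z * (u z * u z) * angularCurrent u ux uy z)
      (volume.restrict U) := by
    have := ((A2.sub B2).congr hT).const_mul (-Complex.I)
    refine this.congr (Eventually.of_forall fun z => ?_)
    linear_combination (-(m z * (u z * u z) * angularCurrent u ux uy z)) * Complex.I_sq
  have fin : ∫ z in U, (m z * (u z * u z) - m z * (u z * u z) * angularCurrent u ux uy z) = 0 := by
    rw [integral_sub M1 M2]
    have : (2 * Complex.I) * ((∫ z in U, m z * (u z * u z)) -
        ∫ z in U, m z * (u z * u z) * angularCurrent u ux uy z) = 0 := by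
      linear_combination B - A - L - 2 * R
    simpa using this
  rw [← fin]
  congr 1; ext z
  simp only [hm]; ring

theorem ContDiff.mul_inv_of_tsupport {χ : ℝ → ℝ} (h : ContDiff ℝ ∞ χ)
    (hs : tsupport χ ⊆ Set.Ioi 0) : ContDiff ℝ ∞ fun t => χ t * t⁻¹ := by
  refine contDiff_iff_contDiffAt.2 fun t => ?_
  by_cases ht : t ∈ tsupport χ
  · exact h.contDiffAt.mul (contDiffAt_inv ℝ (ne_of_gt (hs ht)))
  · refine (contDiffAt_const (c := (0 : ℝ))).congr_of_eventuallyEq ?_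
    filter_upwards [(isClosed_tsupport χ).isOpen_compl.mem_nhds ht] with s hs'
    rw [image_eq_zero_of_notMem_tsupport hs', zero_mul]

theorem exists_smooth_cutoff (a b : ℝ) :
    ∃ θ : ℕ → ℝ → ℝ, (∀ n, ContDiff ℝ ∞ (θ n)) ∧ (∀ n, tsupport (θ n) ⊆ Set.Ioo a b) ∧
      (∀ n t, 0 ≤ θ n t ∧ θ n t ≤ 1) ∧
      ∀ t ∈ Set.Ioo a b, Tendsto (fun n => θ n t) atTop (𝓝 1) := by
  refine ⟨fun n t => Real.smoothTransition ((n + 1) * (t - a) - 1) *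
    Real.smoothTransition ((n + 1) * (b - t) - 1), fun n => ?_, fun n => ?_, fun n t => ⟨?_, ?_⟩, ?_⟩
  · exact (Real.smoothTransition.contDiff.comp (by fun_prop)).mul
      (Real.smoothTransition.contDiff.comp (by fun_prop))
  · have hn : (0 : ℝ) < n + 1 := by positivity
    have : tsupport (fun t => Real.smoothTransition ((n + 1) * (t - a) - 1) *
        Real.smoothTransition ((n + 1) * (b - t) - 1)) ⊆
        Set.Icc (a + 1 / (n + 1)) (b - 1 / (n + 1)) := by
      refine closure_minimal ?_ isClosed_Icc
      intro t ht
      rw [Function.mem_support] at ht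
      have h1 := left_ne_zero_of_mul ht
      have h2 := right_ne_zero_of_mul ht
      rw [ne_eq, Real.smoothTransition.zero_iff_nonpos, not_le] at h1 h2
      constructor
      · have : 1 / ((n : ℝ) + 1) ≤ t - a := by rw [div_le_iff₀ hn]; linarith
        linarith
      · have : 1 / ((n : ℝ) + 1) ≤ b - t := by rw [div_le_iff₀ hn]; linarith
        linarith
    have h1 : 0 < 1 / ((n : ℝ) + 1) := by positivity
    exact this.trans fun t ht => ⟨by linarith [ht.1], by linarith [ht.2]⟩
  · exact mul_nonneg (Real.smoothTransition.nonneg _) (Real.smoothTransition.nonneg _)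
  · exact mul_le_one₀ (Real.smoothTransition.le_one _) (Real.smoothTransition.nonneg _)
      (Real.smoothTransition.le_one _)
  · intro t ht
    have key : ∀ s : ℝ, 0 < s → ∀ᶠ n : ℕ in atTop,
        Real.smoothTransition ((n + 1) * s - 1) = 1 := by
      intro s hs
      filter_upwards [eventually_ge_atTop ⌈2 / s⌉₊] with n hn
      refine Real.smoothTransition.one_of_one_le ?_
      have h1 : 2 / s ≤ n := Nat.ceil_le.1 hn
      rw [div_le_iff₀ hs] at h1
      linarith
    refine tendsto_const_nhds.congr' ?_
    filter_upwards [key (t - a) (by linarith [ht.1]), key (b - t) (by linarith [ht.2])] with n h1 h2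
    rw [h1, h2, one_mul]

/-- A radial duality identity tested with smooth functions also holds for the weight `1/|z|²`. -/
theorem integral_inv_norm_sq_smul {E : Type*} [NormedAddCommGroup E] [NormedSpace ℝ E]
    [CompleteSpace E] {R₁ R₂ : ℝ} (h₁ : 0 < R₁) (h₂ : R₁ < R₂) {p : ℂ → E} {c : E}
    (hp : IntegrableOn p (openAnnulus R₁ R₂))
    (h : ∀ χ : ℝ → ℝ, ContDiff ℝ ∞ χ → tsupport χ ⊆ Set.Ioo (R₁ ^ 2) (R₂ ^ 2) →
      ∫ z in openAnnulus R₁ R₂, χ (‖z‖ ^ 2) • p z = (∫ t, χ t) • c) :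
    ∫ z in openAnnulus R₁ R₂, (‖z‖ ^ 2)⁻¹ • p z = (2 * Real.log (R₂ / R₁)) • c := by
  have ha : 0 < R₁ ^ 2 := by positivity
  have hab : R₁ ^ 2 < R₂ ^ 2 := by gcongr
  obtain ⟨θ, hθ, hθs, hθ1, hθt⟩ := exists_smooth_cutoff (R₁ ^ 2) (R₂ ^ 2)
  have hs : ∀ n, tsupport (fun t => θ n t * t⁻¹) ⊆ Set.Ioo (R₁ ^ 2) (R₂ ^ 2) :=
    fun n => (tsupport_mul_subset_left).trans (hθs n)
  have hsm : ∀ n, ContDiff ℝ ∞ fun t => θ n t * t⁻¹ := fun n =>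
    (hθ n).mul_inv_of_tsupport ((hθs n).trans fun t ht => ha.trans ht.1)
  have hmem : ∀ z ∈ openAnnulus R₁ R₂, ‖z‖ ^ 2 ∈ Set.Ioo (R₁ ^ 2) (R₂ ^ 2) := fun z hz =>
    ⟨by have := hz.1; gcongr, by have := hz.2; gcongr⟩
  have l1 : Tendsto (fun n => ∫ z in openAnnulus R₁ R₂, (θ n (‖z‖ ^ 2) * (‖z‖ ^ 2)⁻¹) • p z) atTop
      (𝓝 (∫ z in openAnnulus R₁ R₂, (‖z‖ ^ 2)⁻¹ • p z)) := by
    refine tendsto_integral_of_dominated_convergence (fun z => (R₁ ^ 2)⁻¹ * ‖p z‖)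
      (fun n => ?_) (hp.norm.const_mul _) (fun n => ?_) ?_
    · exact (((hsm n).continuous.comp (by fun_prop : Continuous fun z : ℂ => ‖z‖ ^ 2)
        ).aestronglyMeasurable).smul hp.1
    · filter_upwards [ae_restrict_mem (isOpen_openAnnulus R₁ R₂).measurableSet] with z hz
      have hz' := hmem z hz
      rw [norm_smul]
      gcongr
      rw [Real.norm_of_nonneg (mul_nonneg (hθ1 n _).1 (by positivity))]
      calc θ n (‖z‖ ^ 2) * (‖z‖ ^ 2)⁻¹ ≤ 1 * (‖z‖ ^ 2)⁻¹ := by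
            gcongr; exact (hθ1 n _).2
        _ ≤ (R₁ ^ 2)⁻¹ := by rw [one_mul]; exact inv_anti₀ ha hz'.1.le
    · filter_upwards [ae_restrict_mem (isOpen_openAnnulus R₁ R₂).measurableSet] with z hz
      have := ((hθt _ (hmem z hz)).mul_const ((‖z‖ ^ 2)⁻¹)).smul_const (p z)
      simpa using this
  have l2 : Tendsto (fun n => ∫ t, θ n t * t⁻¹) atTop
      (𝓝 (∫ t in Set.Ioo (R₁ ^ 2) (R₂ ^ 2), t⁻¹)) := by
    have e : ∀ n, ∫ t, θ n t * t⁻¹ = ∫ t in Set.Ioo (R₁ ^ 2) (R₂ ^ 2), θ n t * t⁻¹ := by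
      intro n
      rw [setIntegral_eq_integral_of_forall_compl_eq_zero]
      intro t ht
      exact image_eq_zero_of_notMem_tsupport (f := fun t => θ n t * t⁻¹) fun h => ht (hs n h)
    simp only [e]
    refine tendsto_integral_of_dominated_convergence (fun _ => (R₁ ^ 2)⁻¹)
      (fun n => (hsm n).continuous.aestronglyMeasurable)
      (integrable_const _) (fun n => ?_) ?_
    · filter_upwards [ae_restrict_mem measurableSet_Ioo] with t ht
      have ht0 : 0 < t := ha.trans ht.1
      rw [Real.norm_of_nonneg (mul_nonneg (hθ1 n _).1 (by positivity))]
      calc θ n t * t⁻¹ ≤ 1 * t⁻¹ := by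
            gcongr; exact (hθ1 n _).2
        _ ≤ (R₁ ^ 2)⁻¹ := by rw [one_mul]; exact inv_anti₀ ha ht.1.le
    · filter_upwards [ae_restrict_mem measurableSet_Ioo] with t ht
      simpa using (hθt _ ht).mul_const t⁻¹
  -- The variable is t = |z|², whence the factor 2 before the logarithm.
  have e3 : ∫ t in Set.Ioo (R₁ ^ 2) (R₂ ^ 2), t⁻¹ = 2 * Real.log (R₂ / R₁) := by
    rw [← integral_Ioc_eq_integral_Ioo, ← intervalIntegral.integral_of_le hab.le,
      integral_inv_of_pos ha (ha.trans hab), ← div_pow, Real.log_pow]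
    norm_num
  rw [e3] at l2
  have l3 := l2.smul_const c
  refine tendsto_nhds_unique l1 (l3.congr fun n => ?_)
  exact (h _ (hsm n) (hs n)).symm

theorem IsH1.integrable_angularCurrent {R₁ R₂ : ℝ} {u ux uy : ℂ → ℂ}
    (hu : IsH1 (openAnnulus R₁ R₂) u ux uy) :
    Integrable (angularCurrent u ux uy) (volume.restrict (openAnnulus R₁ R₂)) := by
  have hb : ∀ᵐ z : ℂ ∂(volume.restrict (openAnnulus R₁ R₂)), ‖z‖ ≤ R₂ := by
    filter_upwards [ae_restrict_mem (isOpen_openAnnulus R₁ R₂).measurableSet] with z hz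
    exact hz.2.le
  refine Integrable.sub ?_ ?_
  · refine (MemLp.integrable_current hu.memLp hu.memLp_y).bdd_mul (c := R₂)
      Complex.continuous_re.aestronglyMeasurable ?_
    filter_upwards [hb] with z hz using (Complex.abs_re_le_norm z).trans hz
  · refine (MemLp.integrable_current hu.memLp hu.memLp_x).bdd_mul (c := R₂)
      Complex.continuous_im.aestronglyMeasurable ?_
    filter_upwards [hb] with z hz using (Complex.abs_im_le_norm z).trans hz

theorem integrable_norm_rpow_smul {E : Type*} [NormedAddCommGroup E] [NormedSpace ℝ E]
    {R₁ R₂ : ℝ} (h₁ : 0 < R₁) {p : ℂ → E} (hp : IntegrableOn p (openAnnulus R₁ R₂)) :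
    IntegrableOn (fun z => (‖z‖ ^ 2)⁻¹ • p z) (openAnnulus R₁ R₂) := by
  refine Integrable.bdd_smul (C := (R₁ ^ 2)⁻¹) hp
    (by fun_prop : Measurable fun z : ℂ => (‖z‖ ^ 2)⁻¹).aestronglyMeasurable ?_
  filter_upwards [ae_restrict_mem (isOpen_openAnnulus R₁ R₂).measurableSet] with z hz
  rw [Real.norm_of_nonneg (by positivity)]
  have := hz.1
  gcongr

theorem IsH1.integrableOn_fourier_mode {R₁ R₂ : ℝ} {u ux uy : ℂ → ℂ}
    (hu : IsH1 (openAnnulus R₁ R₂) u ux uy)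
    (hu1 : ∀ᵐ z ∂(volume.restrict (openAnnulus R₁ R₂)), ‖u z‖ = 1) :
    IntegrableOn (fun z => conj z ^ 2 * u z ^ 2 * (1 - angularCurrent u ux uy z : ℂ))
      (openAnnulus R₁ R₂) := by
  have h3 : IntegrableOn (fun z => (1 - angularCurrent u ux uy z : ℂ)) (openAnnulus R₁ R₂) :=
    (integrable_const _).sub hu.integrable_angularCurrent.ofReal
  refine Integrable.bdd_mul (c := R₂ ^ 2) h3
    ((Complex.continuous_conj.pow 2).aestronglyMeasurable.mul (hu.memLp.1.pow 2)) ?_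
  filter_upwards [ae_restrict_mem (isOpen_openAnnulus R₁ R₂).measurableSet, hu1] with z hz hz1
  rw [norm_mul, norm_pow, norm_pow, hz1, RCLike.norm_conj, one_pow, mul_one]
  have := hz.2
  gcongr

/-- The second Fourier mode of `u²` is controlled by the deviation of the angular current
from that of `exp (-iθ)`. -/
theorem IsH1.integral_fourier_mode {R₁ R₂ : ℝ} (h₁ : 0 < R₁) (h₂ : R₁ < R₂)
    {u ux uy : ℂ → ℂ} (hu : IsH1 (openAnnulus R₁ R₂) u ux uy)
    (hu1 : ∀ᵐ z ∂(volume.restrict (openAnnulus R₁ R₂)), ‖u z‖ = 1) :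
    ∫ z in openAnnulus R₁ R₂, (‖z‖ ^ 2)⁻¹ • (‖z‖ ^ 2)⁻¹ •
      (conj z ^ 2 * u z ^ 2 * (1 - angularCurrent u ux uy z)) = 0 := by
  have key := integral_inv_norm_sq_smul (c := (0 : ℂ)) h₁ h₂ (integrable_norm_rpow_smul h₁
    (hu.integrableOn_fourier_mode hu1)) ?_
  · simpa using key
  · intro χ hχ hs
    rw [smul_zero, ← hu.integral_sq_mul_angularCurrent (h₁.trans h₂).le hu1
      (hχ.mul_inv_of_tsupport (hs.trans fun t ht => (by positivity : 0 < R₁ ^ 2).trans ht.1))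
      ((tsupport_mul_subset_left).trans hs)]
    congr 1; ext z
    simp only [Complex.real_smul]; push_cast; ring

/-- If the angular current satisfies a radial identity near the outer circle, then, being
weakly curl-free, it satisfies it everywhere. -/
theorem IsH1.integral_radial_mul_angularCurrent {R₁ R₂ R₃ : ℝ} (h₁ : 0 ≤ R₁) (h₂ : R₁ ≤ R₂)
    (h₃ : R₂ < R₃) {u ux uy : ℂ → ℂ} (hu : IsH1 (openAnnulus R₁ R₃) u ux uy)
    (hu1 : ∀ᵐ z ∂(volume.restrict (openAnnulus R₁ R₃)), ‖u z‖ = 1) {c : ℝ}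
    (hc : ∀ χ : ℝ → ℝ, ContDiff ℝ ∞ χ → tsupport χ ⊆ Set.Ioo (R₂ ^ 2) (R₃ ^ 2) →
      ∫ z in openAnnulus R₁ R₃, χ (‖z‖ ^ 2) • angularCurrent u ux uy z = (∫ t, χ t) • c)
    {χ : ℝ → ℝ} (hχ : ContDiff ℝ ∞ χ) (hs : tsupport χ ⊆ Set.Ioo (R₁ ^ 2) (R₃ ^ 2)) :
    ∫ z in openAnnulus R₁ R₃, χ (‖z‖ ^ 2) • angularCurrent u ux uy z = (∫ t, χ t) • c := by
  have hR2 : 0 ≤ R₂ := h₁.trans h₂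
  have hR : R₂ ^ 2 < R₃ ^ 2 := by gcongr
  have hR' : R₁ ^ 2 ≤ R₂ ^ 2 := by gcongr
  -- Let β be a bump of integral 1 living where the identity is known. Subtracting from χ its
  -- integral times β leaves a function of mean zero, hence the derivative of a compactly supported
  -- h, and the constancy of the circulation applies to h.
  let B : ContDiffBump ((R₂ ^ 2 + R₃ ^ 2) / 2 : ℝ) :=
    ⟨(R₃ ^ 2 - R₂ ^ 2) / 8, (R₃ ^ 2 - R₂ ^ 2) / 4, by linarith, by linarith⟩
  set β : ℝ → ℝ := B.normed volume with hβ
  have hβs : tsupport β ⊆ Set.Ioo (R₂ ^ 2) (R₃ ^ 2) := by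
    rw [hβ, B.tsupport_normed_eq, Real.closedBall_eq_Icc]
    intro t ht
    have h1 := ht.1
    have h2 := ht.2
    simp only [B] at h1 h2
    constructor <;> linarith
  have hβd : ContDiff ℝ ∞ β := B.contDiff_normed
  have hβc : HasCompactSupport β := B.hasCompactSupport_normed
  have hβi : ∫ t, β t = 1 := B.integral_normed
  have hχc : HasCompactSupport χ := (isCompact_Icc (a := R₁ ^ 2) (b := R₃ ^ 2)).of_isClosed_subset
    (isClosed_tsupport _) (hs.trans Set.Ioo_subset_Icc_self)
  set I := ∫ t, χ t with hI
  set k : ℝ → ℝ := fun t => χ t - I * β t with hk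
  have hkd : ContDiff ℝ ∞ k := hχ.sub (contDiff_const.mul hβd)
  have hks : tsupport k ⊆ tsupport χ ∪ tsupport β := by
    refine closure_minimal ?_ ((isClosed_tsupport _).union (isClosed_tsupport _))
    intro t ht
    by_contra hcon
    simp only [Set.mem_union, not_or] at hcon
    exact ht (by simp [hk, image_eq_zero_of_notMem_tsupport hcon.1,
      image_eq_zero_of_notMem_tsupport hcon.2])
  have hcomp : IsCompact (tsupport χ ∪ tsupport β) := hχc.isCompact.union hβc.isCompact
  have hsub : tsupport χ ∪ tsupport β ⊆ Set.Ioo (R₁ ^ 2) (R₃ ^ 2) :=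
    Set.union_subset hs (hβs.trans (Set.Ioo_subset_Ioo_left hR'))
  obtain ⟨a, b, ha, hb, hab⟩ : ∃ a b, R₁ ^ 2 < a ∧ b < R₃ ^ 2 ∧
      tsupport χ ∪ tsupport β ⊆ Set.Icc a b := by
    have hne : (tsupport χ ∪ tsupport β).Nonempty := by
      refine Set.Nonempty.inr ?_
      by_contra hcon
      rw [Set.not_nonempty_iff_eq_empty, tsupport_eq_empty_iff] at hcon
      simp [hcon] at hβi
    obtain ⟨a, ha, ha'⟩ := hcomp.exists_isLeast hne
    obtain ⟨b, hb, hb'⟩ := hcomp.exists_isGreatest hne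
    exact ⟨a, b, (hsub ha).1, (hsub hb).2, fun t ht => ⟨ha' ht, hb' ht⟩⟩
  have hk0 : ∀ t, t ∉ Set.Icc a b → k t = 0 := fun t ht =>
    image_eq_zero_of_notMem_tsupport fun h => ht (hab (hks h))
  have hki : ∫ t, k t = 0 := by
    rw [hk, integral_sub (hχ.continuous.integrable_of_hasCompactSupport hχc)
      ((hβd.continuous.integrable_of_hasCompactSupport hβc).const_mul _), integral_const_mul, hβi]
    simp [hI]
  set h : ℝ → ℝ := fun t => ∫ s in a..t, k s with hh
  have hder : ∀ t, HasDerivAt h (k t) t := fun t =>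
    intervalIntegral.integral_hasDerivAt_right (hkd.continuous.intervalIntegrable _ _)
      (hkd.continuous.stronglyMeasurableAtFilter _ _) hkd.continuous.continuousAt
  have hderiv : deriv h = k := funext fun t => (hder t).deriv
  have hhd : ContDiff ℝ ∞ h := contDiff_infty_iff_deriv.2
    ⟨fun t => (hder t).differentiableAt, by rw [hderiv]; exact hkd⟩
  have hhs : tsupport h ⊆ Set.Ioo (R₁ ^ 2) (R₃ ^ 2) := by
    refine (closure_minimal ?_ isClosed_Icc).trans
      (fun t (ht : t ∈ Set.Icc a b) => ⟨ha.trans_le ht.1, ht.2.trans_lt hb⟩)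
    intro t ht
    by_contra hcon
    refine ht ?_
    rcases lt_or_ge t a with h1 | h1
    · simp only [hh]
      rw [intervalIntegral.integral_symm, intervalIntegral.integral_of_le h1.le,
        integral_Ioc_eq_integral_Ioo, setIntegral_eq_zero_of_forall_eq_zero, neg_zero]
      intro s hs
      exact hk0 s fun h => absurd h.1 (not_le.2 hs.2)
    · have h2 : b < t := by
        by_contra h3
        exact hcon ⟨h1, not_lt.1 h3⟩
      simp only [hh]
      rw [intervalIntegral.integral_of_le h1, ← integral_Icc_eq_integral_Ioc,
        setIntegral_eq_integral_of_forall_compl_eq_zero, hki]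
      intro s hs
      exact hk0 s fun h => hs ⟨h.1, h.2.trans h2.le⟩
  have key := hu.integral_deriv_mul_angularCurrent (h₁.trans (h₂.trans h₃.le)) hu1 hhd hhs
  have hT := hu.integrable_angularCurrent
  have hint : ∀ f : ℝ → ℝ, ContDiff ℝ ∞ f → HasCompactSupport f → Integrable
      (fun z : ℂ => f (‖z‖ ^ 2) * angularCurrent u ux uy z)
      (volume.restrict (openAnnulus R₁ R₃)) := by
    intro f hf hfc
    obtain ⟨C, hC⟩ := hfc.exists_bound_of_continuous hf.continuous
    exact hT.bdd_mul (c := C) ((hf.continuous.comp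
      (by fun_prop : Continuous fun z : ℂ => ‖z‖ ^ 2)).aestronglyMeasurable)
      (Eventually.of_forall fun z => hC _)
  have hβ' := hc β hβd hβs
  simp only [hderiv, hk, sub_mul, mul_assoc] at key
  rw [integral_sub (hint χ hχ hχc) ((hint β hβd hβc).const_mul I), integral_const_mul] at key
  simp only [smul_eq_mul, hβi] at hβ' ⊢
  rw [hβ'] at key
  linarith

/-! ### Unimodular maps with traces: gluing and scaling. -/

/-- `u` is a unimodular `H¹` map on the annulus with traces `g₁`, `g₂`. -/
structure IsUnimodularH1 (R₁ R₂ : ℝ) (u ux uy : ℂ → ℂ) (g₁ g₂ : ℝ → ℂ) : Prop where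
  memLp : MemLp u 2 (volume.restrict (openAnnulus R₁ R₂))
  memLp_x : MemLp ux 2 (volume.restrict (openAnnulus R₁ R₂))
  memLp_y : MemLp uy 2 (volume.restrict (openAnnulus R₁ R₂))
  norm_eq_one : ∀ᵐ z ∂(volume.restrict (openAnnulus R₁ R₂)), ‖u z‖ = 1
  traces : HasTraces R₁ R₂ u ux uy g₁ g₂

/-- A test function supported in the open annulus vanishes on both circles, so Green's formula
already contains the definition of the weak derivatives. -/
theorem IsUnimodularH1.isH1 {R₁ R₂ : ℝ} (h₁ : 0 ≤ R₁) (h₂ : 0 ≤ R₂) {u ux uy : ℂ → ℂ}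
    {g₁ g₂ : ℝ → ℂ} (h : IsUnimodularH1 R₁ R₂ u ux uy g₁ g₂) :
    IsH1 (openAnnulus R₁ R₂) u ux uy := by
  have hc : ∀ φ : ℂ → ℝ, tsupport φ ⊆ openAnnulus R₁ R₂ → ∀ θ,
      φ (circleMap 0 R₁ θ) = 0 ∧ φ (circleMap 0 R₂ θ) = 0 := by
    intro φ hs θ
    constructor
    · refine image_eq_zero_of_notMem_tsupport fun hz => ?_
      have := (hs hz).1
      rw [norm_circleMap_zero, abs_of_nonneg h₁] at this
      exact lt_irrefl _ this
    · refine image_eq_zero_of_notMem_tsupport fun hz => ?_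
      have := (hs hz).2
      rw [norm_circleMap_zero, abs_of_nonneg h₂] at this
      exact lt_irrefl _ this
  refine ⟨h.memLp, h.memLp_x, h.memLp_y, ?_, ?_⟩
  · intro φ h1 h2 h3
    have := (h.traces φ h1 h2).1
    simpa [hc φ h3] using this
  · intro φ h1 h2 h3
    have := (h.traces φ h1 h2).2
    simpa [hc φ h3] using this

theorem IsCompetitor.exists_isUnimodularH1 {R₁ R₂ C : ℝ} {u ux uy : ℂ → ℂ}
    (h : IsCompetitor R₁ R₂ C u ux uy) : ∃ g₁ g₂, IsUnimodularH1 R₁ R₂ u ux uy g₁ g₂ ∧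
      IsBoundaryDatum C g₁ ∧ IsBoundaryDatum C g₂ := by
  obtain ⟨h1, h2, g₁, g₂, h3, h4, h5⟩ := h
  exact ⟨g₁, g₂, ⟨h1.memLp, h1.memLp_x, h1.memLp_y, h2, h3⟩, h4, h5⟩

theorem IsUnimodularH1.isCompetitor {R₁ R₂ C : ℝ} (h₁ : 0 ≤ R₁) (h₂ : 0 ≤ R₂) {u ux uy : ℂ → ℂ}
    {g₁ g₂ : ℝ → ℂ} (h : IsUnimodularH1 R₁ R₂ u ux uy g₁ g₂) (hg₁ : IsBoundaryDatum C g₁)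
    (hg₂ : IsBoundaryDatum C g₂) : IsCompetitor R₁ R₂ C u ux uy :=
  ⟨h.isH1 h₁ h₂, h.norm_eq_one, g₁, g₂, h.traces, hg₁, hg₂⟩

/-- The map that equals `u` inside the circle of radius `R` and `v` outside. -/
noncomputable def glue (R : ℝ) (u v : ℂ → ℂ) (z : ℂ) : ℂ := if ‖z‖ < R then u z else v z

theorem glue_of_mem_left {R₁ R₂ : ℝ} {u v : ℂ → ℂ} {z : ℂ} (hz : z ∈ openAnnulus R₁ R₂) :
    glue R₂ u v z = u z := if_pos hz.2

theorem glue_of_mem_right {R₂ R₃ : ℝ} {u v : ℂ → ℂ} {z : ℂ} (hz : z ∈ openAnnulus R₂ R₃) :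
    glue R₂ u v z = v z := if_neg (not_lt.2 hz.1.le)

theorem ae_norm_ne (R : ℝ) : ∀ᵐ z : ℂ, ‖z‖ ≠ R := by
  have : volume (Metric.sphere (0 : ℂ) R) = 0 := Measure.addHaar_sphere _ _ _
  refine measure_mono_null (fun z hz => ?_) this
  simpa using hz

theorem openAnnulus_union_ae {R₁ R₂ R₃ : ℝ} (h₁ : R₁ ≤ R₂) (h₂ : R₂ ≤ R₃) :
    (openAnnulus R₁ R₃ : Set ℂ) =ᵐ[volume] (openAnnulus R₁ R₂ ∪ openAnnulus R₂ R₃ : Set ℂ) := by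
  filter_upwards [ae_norm_ne R₂] with z hz
  refine propext ⟨fun h => ?_, fun h => ?_⟩
  · rcases lt_or_gt_of_ne hz with h' | h'
    · exact Or.inl ⟨h.1, h'⟩
    · exact Or.inr ⟨h', h.2⟩
  · rcases h with h | h
    · exact ⟨h.1, h.2.trans_le h₂⟩
    · exact ⟨h₁.trans_lt h.1, h.2⟩

theorem disjoint_openAnnulus (R₁ R₂ R₃ : ℝ) :
    Disjoint (openAnnulus R₁ R₂) (openAnnulus R₂ R₃) :=
  Set.disjoint_left.2 fun _ h h' => lt_asymm h.2 h'.1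

theorem measurableSet_openAnnulus (R₁ R₂ : ℝ) : MeasurableSet (openAnnulus R₁ R₂) :=
  (isOpen_openAnnulus R₁ R₂).measurableSet

theorem setIntegral_openAnnulus_add {E : Type*} [NormedAddCommGroup E] [NormedSpace ℝ E]
    {R₁ R₂ R₃ : ℝ} (h₁ : R₁ ≤ R₂) (h₂ : R₂ ≤ R₃) {f f₁ f₂ : ℂ → E}
    (e₁ : ∀ z ∈ openAnnulus R₁ R₂, f z = f₁ z) (e₂ : ∀ z ∈ openAnnulus R₂ R₃, f z = f₂ z)
    (i₁ : IntegrableOn f₁ (openAnnulus R₁ R₂)) (i₂ : IntegrableOn f₂ (openAnnulus R₂ R₃)) :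
    ∫ z in openAnnulus R₁ R₃, f z =
      (∫ z in openAnnulus R₁ R₂, f₁ z) + ∫ z in openAnnulus R₂ R₃, f₂ z := by
  rw [setIntegral_congr_set (openAnnulus_union_ae h₁ h₂),
    setIntegral_union (disjoint_openAnnulus _ _ _) (measurableSet_openAnnulus _ _)
      (i₁.congr_fun (fun z hz => (e₁ z hz).symm) (measurableSet_openAnnulus _ _))
      (i₂.congr_fun (fun z hz => (e₂ z hz).symm) (measurableSet_openAnnulus _ _)),
    setIntegral_congr_fun (measurableSet_openAnnulus _ _) e₁,
    setIntegral_congr_fun (measurableSet_openAnnulus _ _) e₂]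

theorem MemLp.glue {R₁ R₂ R₃ : ℝ} (h₁ : R₁ ≤ R₂) (h₂ : R₂ ≤ R₃) {u v : ℂ → ℂ}
    (hu : MemLp u 2 (volume.restrict (openAnnulus R₁ R₂)))
    (hv : MemLp v 2 (volume.restrict (openAnnulus R₂ R₃))) :
    MemLp (glue R₂ u v) 2 (volume.restrict (openAnnulus R₁ R₃)) := by
  rw [← memLp_indicator_iff_restrict (measurableSet_openAnnulus _ _)] at hu hv ⊢
  refine (hu.add hv).ae_eq ?_
  filter_upwards [openAnnulus_union_ae h₁ h₂] with z hz
  have hz' : z ∈ openAnnulus R₁ R₃ ↔ z ∈ openAnnulus R₁ R₂ ∪ openAnnulus R₂ R₃ := Eq.to_iff hz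
  by_cases h : z ∈ openAnnulus R₁ R₂
  · have h' := Set.disjoint_left.1 (disjoint_openAnnulus R₁ R₂ R₃) h
    simp [h, h', hz'.2 (Or.inl h), glue_of_mem_left h]
  · by_cases h' : z ∈ openAnnulus R₂ R₃
    · simp [h, h', hz'.2 (Or.inr h'), glue_of_mem_right h']
    · have : z ∉ openAnnulus R₁ R₃ := fun h3 => (hz'.1 h3).elim h h'
      simp [h, h', this]

theorem MemLp.integrable_smul_of_compact {U : Set ℂ} {f : ℂ → ℂ}
    (hf : MemLp f 2 (volume.restrict U)) {φ : ℂ → ℝ}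
    (hφ : Continuous φ) (hc : HasCompactSupport φ) :
    IntegrableOn (fun z => φ z • f z) U := by
  have := MemLp.integrable_of_compact hf (φ := fun z => (φ z : ℂ)) (by fun_prop)
    (hc.comp_left (g := Complex.ofReal) rfl)
  simpa [Complex.real_smul, IntegrableOn] using this

/-- Green's formulas on the two annuli add up, and the terms on the common circle cancel because
both maps have the trace g₂ there. -/
theorem IsUnimodularH1.glue {R₁ R₂ R₃ : ℝ} (h₁ : R₁ ≤ R₂) (h₂ : R₂ ≤ R₃)
    {u ux uy v vx vy : ℂ → ℂ} {g₁ g₂ g₃ : ℝ → ℂ}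
    (hu : IsUnimodularH1 R₁ R₂ u ux uy g₁ g₂) (hv : IsUnimodularH1 R₂ R₃ v vx vy g₂ g₃) :
    IsUnimodularH1 R₁ R₃ (glue R₂ u v) (glue R₂ ux vx) (glue R₂ uy vy) g₁ g₃ := by
  have key : ∀ (φ : ℂ → ℝ), Continuous φ → HasCompactSupport φ → ∀ f g : ℂ → ℂ,
      MemLp f 2 (volume.restrict (openAnnulus R₁ R₂)) →
      MemLp g 2 (volume.restrict (openAnnulus R₂ R₃)) →
      ∫ z in openAnnulus R₁ R₃, φ z • _root_.glue R₂ f g z =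
        (∫ z in openAnnulus R₁ R₂, φ z • f z) + ∫ z in openAnnulus R₂ R₃, φ z • g z := by
    intro φ hφ hc f g hf hg
    exact setIntegral_openAnnulus_add h₁ h₂ (fun z hz => by rw [glue_of_mem_left hz])
      (fun z hz => by rw [glue_of_mem_right hz]) (MemLp.integrable_smul_of_compact hf hφ hc)
      (MemLp.integrable_smul_of_compact hg hφ hc)
  refine ⟨MemLp.glue h₁ h₂ hu.memLp hv.memLp, MemLp.glue h₁ h₂ hu.memLp_x hv.memLp_x,
    MemLp.glue h₁ h₂ hu.memLp_y hv.memLp_y, ?_, ?_⟩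
  · rw [ae_restrict_iff' (measurableSet_openAnnulus _ _)]
    filter_upwards [(ae_restrict_iff' (measurableSet_openAnnulus _ _)).1 hu.norm_eq_one,
      (ae_restrict_iff' (measurableSet_openAnnulus _ _)).1 hv.norm_eq_one,
      ae_norm_ne R₂] with z hzu hzv hne hz
    rcases lt_or_gt_of_ne hne with h' | h'
    · have h3 : z ∈ openAnnulus R₁ R₂ := ⟨hz.1, h'⟩
      rw [glue_of_mem_left h3, hzu h3]
    · have h3 : z ∈ openAnnulus R₂ R₃ := ⟨h', hz.2⟩
      rw [glue_of_mem_right h3, hzv h3]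
  · intro φ hφ hc
    have hφ' : ∀ e, Continuous fun z => fderiv ℝ φ z e := fun e =>
      (hφ.continuous_fderiv (by simp)).clm_apply continuous_const
    have a := hu.traces φ hφ hc
    have b := hv.traces φ hφ hc
    constructor
    · rw [key _ (hφ' 1) (hc.fderiv_apply ℝ 1) _ _ hu.memLp hv.memLp,
        key _ hφ.continuous hc _ _ hu.memLp_x hv.memLp_x, a.1, b.1]
      ring
    · rw [key _ (hφ' Complex.I) (hc.fderiv_apply ℝ Complex.I) _ _ hu.memLp hv.memLp,
        key _ hφ.continuous hc _ _ hu.memLp_y hv.memLp_y, a.2, b.2]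
      ring

theorem MemLp.integrable_div_sq {U : Set ℂ} {f g : ℂ → ℂ} (hf : MemLp f 2 (volume.restrict U))
    (hg : MemLp g 2 (volume.restrict U)) :
    IntegrableOn (fun z => ((f z).re + (g z).im) ^ 2) U :=
  (hf.re.add hg.im).integrable_sq

theorem MemLp.integrable_curl_sq {U : Set ℂ} {f g : ℂ → ℂ} (hf : MemLp f 2 (volume.restrict U))
    (hg : MemLp g 2 (volume.restrict U)) :
    IntegrableOn (fun z => ((f z).im - (g z).re) ^ 2) U :=
  (hf.im.sub hg.re).integrable_sq

theorem anisoEnergy_glue {R₁ R₂ R₃ : ℝ} (h₁ : R₁ ≤ R₂) (h₂ : R₂ ≤ R₃) (K₁ K₃ : ℝ)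
    {u ux uy v vx vy : ℂ → ℂ} {g₁ g₂ g₂' g₃ : ℝ → ℂ}
    (hu : IsUnimodularH1 R₁ R₂ u ux uy g₁ g₂) (hv : IsUnimodularH1 R₂ R₃ v vx vy g₂' g₃) :
    anisoEnergy K₁ K₃ (openAnnulus R₁ R₃) (glue R₂ ux vx) (glue R₂ uy vy) =
      anisoEnergy K₁ K₃ (openAnnulus R₁ R₂) ux uy + anisoEnergy K₁ K₃ (openAnnulus R₂ R₃) vx vy := by
  unfold anisoEnergy
  rw [setIntegral_openAnnulus_add h₁ h₂ (fun z hz => by rw [glue_of_mem_left hz,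
      glue_of_mem_left hz]) (fun z hz => by rw [glue_of_mem_right hz, glue_of_mem_right hz])
      (MemLp.integrable_div_sq hu.memLp_x hu.memLp_y)
      (MemLp.integrable_div_sq hv.memLp_x hv.memLp_y),
    setIntegral_openAnnulus_add h₁ h₂ (fun z hz => by rw [glue_of_mem_left hz,
      glue_of_mem_left hz]) (fun z hz => by rw [glue_of_mem_right hz, glue_of_mem_right hz])
      (MemLp.integrable_curl_sq hu.memLp_x hu.memLp_y)
      (MemLp.integrable_curl_sq hv.memLp_x hv.memLp_y)]
  ring

theorem smul_openAnnulus {t : ℝ} (ht : 0 < t) (R₁ R₂ : ℝ) :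
    t • openAnnulus R₁ R₂ = openAnnulus (t * R₁) (t * R₂) := by
  ext z
  rw [Set.mem_smul_set_iff_inv_smul_mem₀ ht.ne']
  simp only [openAnnulus, Set.mem_ofPred_eq, norm_smul, norm_inv, Real.norm_of_nonneg ht.le]
  rw [← div_eq_inv_mul, lt_div_iff₀ ht, div_lt_iff₀ ht, mul_comm R₁, mul_comm R₂]

theorem setIntegral_openAnnulus_scale {E : Type*} [NormedAddCommGroup E] [NormedSpace ℝ E]
    {t : ℝ} (ht : 0 < t) (R₁ R₂ : ℝ) (f : ℂ → E) :
    ∫ z in openAnnulus (t * R₁) (t * R₂), f z =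
      t ^ 2 • ∫ z in openAnnulus R₁ R₂, f (t • z) := by
  rw [Measure.setIntegral_comp_smul_of_pos _ _ _ ht, smul_openAnnulus ht, Complex.finrank_real_complex,
    smul_smul, mul_inv_cancel₀ (by positivity), one_smul]

theorem MemLp.scale {t : ℝ} (ht : 0 < t) {R₁ R₂ : ℝ} {f : ℂ → ℂ}
    (hf : MemLp f 2 (volume.restrict (openAnnulus R₁ R₂))) :
    MemLp (fun z => f (t⁻¹ • z)) 2 (volume.restrict (openAnnulus (t * R₁) (t * R₂))) := by
  rw [← memLp_indicator_iff_restrict (measurableSet_openAnnulus _ _)] at hf ⊢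
  have e : (openAnnulus (t * R₁) (t * R₂)).indicator (fun z => f (t⁻¹ • z)) =
      fun z => (openAnnulus R₁ R₂).indicator f (t⁻¹ • z) := by
    ext z
    rw [← smul_openAnnulus ht]
    by_cases h : z ∈ t • openAnnulus R₁ R₂
    · rw [Set.indicator_of_mem h,
        Set.indicator_of_mem ((Set.mem_smul_set_iff_inv_smul_mem₀ ht.ne' _ _).1 h) f]
    · rw [Set.indicator_of_notMem h, Set.indicator_of_notMem
        fun h' => h ((Set.mem_smul_set_iff_inv_smul_mem₀ ht.ne' _ _).2 h')]
  rw [e]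
  have hm : MemLp ((openAnnulus R₁ R₂).indicator f) 2
      (Measure.map (fun z : ℂ => t⁻¹ • z) volume) := by
    rw [Measure.map_addHaar_smul volume (inv_ne_zero ht.ne')]
    exact hf.smul_measure ENNReal.ofReal_ne_top
  exact hm.comp_of_map (by fun_prop)

theorem circleMap_zero_real_mul (t R θ : ℝ) : circleMap 0 (t * R) θ = t • circleMap 0 R θ := by
  simp [circleMap, mul_assoc]

/-- Green's formula for the dilated map tested with φ is the original one tested with φ(t ·); the
traces do not change as functions of the angle. -/
theorem IsUnimodularH1.scale {R₁ R₂ t : ℝ} (ht : 0 < t) {u ux uy : ℂ → ℂ} {g₁ g₂ : ℝ → ℂ}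
    (h : IsUnimodularH1 R₁ R₂ u ux uy g₁ g₂) :
    IsUnimodularH1 (t * R₁) (t * R₂) (fun z => u (t⁻¹ • z)) (fun z => t⁻¹ • ux (t⁻¹ • z))
      (fun z => t⁻¹ • uy (t⁻¹ • z)) g₁ g₂ := by
  refine ⟨MemLp.scale ht h.memLp, (MemLp.scale ht h.memLp_x).const_smul t⁻¹,
    (MemLp.scale ht h.memLp_y).const_smul t⁻¹, ?_, ?_⟩
  · rw [ae_restrict_iff' (measurableSet_openAnnulus _ _)]
    have h1 := (ae_restrict_iff' (measurableSet_openAnnulus _ _)).1 h.norm_eq_one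
    have hq : Measure.QuasiMeasurePreserving (fun z : ℂ => t⁻¹ • z) volume volume := by
      refine ⟨by fun_prop, ?_⟩
      rw [Measure.map_addHaar_smul volume (inv_ne_zero ht.ne')]
      exact Measure.smul_absolutelyContinuous
    filter_upwards [hq.ae h1] with z hz hzm
    rw [← smul_openAnnulus ht] at hzm
    exact hz ((Set.mem_smul_set_iff_inv_smul_mem₀ ht.ne' _ _).1 hzm)
  · intro φ hφ hc
    set ψ : ℂ → ℝ := fun z => φ (t • z) with hψ
    have hψd : ContDiff ℝ ∞ ψ := hφ.comp (contDiff_const_smul t)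
    have hψc : HasCompactSupport ψ :=
      hc.comp_homeomorph (Homeomorph.smulOfNeZero t ht.ne')
    have hder : ∀ z e, fderiv ℝ ψ z e = t * fderiv ℝ φ (t • z) e := by
      intro z e
      have := ((hφ.differentiable (by simp)) (t • z)).hasFDerivAt.comp z
        ((hasFDerivAt_id z).const_smul t)
      rw [show ψ = φ ∘ (fun z => t • z) from rfl, HasFDerivAt.fderiv this]
      simp
    have tr := h.traces ψ hψd hψc
    have e1 : ∀ e, ∫ z in openAnnulus R₁ R₂, (fderiv ℝ ψ z e) • u z =
        t • ∫ z in openAnnulus R₁ R₂, fderiv ℝ φ (t • z) e • u z := by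
      intro e
      rw [← integral_smul]
      congr 1; ext z; rw [hder, smul_smul]
    have e2 : ∀ (R : ℝ) (c : ℝ → ℝ) (g : ℝ → ℂ),
        ∫ θ in (0 : ℝ)..(2 * Real.pi), (t * R * φ (circleMap 0 (t * R) θ) * c θ) • g θ =
          t • ∫ θ in (0 : ℝ)..(2 * Real.pi), (R * ψ (circleMap 0 R θ) * c θ) • g θ := by
      intro R c g
      rw [← intervalIntegral.integral_smul]
      congr 1; ext θ
      rw [smul_smul, circleMap_zero_real_mul]
      congr 1; simp only [hψ]; ring
    have e3 : ∀ f : ℂ → ℂ, ∫ z in openAnnulus R₁ R₂, φ (t • z) • t⁻¹ • f (t⁻¹ • t • z) =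
        t⁻¹ • ∫ z in openAnnulus R₁ R₂, ψ z • f z := by
      intro f
      rw [← integral_smul]
      congr 1; ext z
      rw [inv_smul_smul₀ ht.ne', smul_comm]
    constructor
    · have tr1 := tr.1
      rw [e1] at tr1
      rw [setIntegral_openAnnulus_scale ht, setIntegral_openAnnulus_scale ht, e2, e2, e3]
      simp only [inv_smul_smul₀ ht.ne']
      rw [pow_two, mul_smul, mul_smul, tr1, smul_inv_smul₀ ht.ne']
      module
    · have tr1 := tr.2
      rw [e1] at tr1
      rw [setIntegral_openAnnulus_scale ht, setIntegral_openAnnulus_scale ht, e2, e2, e3]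
      simp only [inv_smul_smul₀ ht.ne']
      rw [pow_two, mul_smul, mul_smul, tr1, smul_inv_smul₀ ht.ne']
      module

theorem anisoEnergy_scale {t : ℝ} (ht : 0 < t) (K₁ K₃ R₁ R₂ : ℝ) (ux uy : ℂ → ℂ) :
    anisoEnergy K₁ K₃ (openAnnulus (t * R₁) (t * R₂)) (fun z => t⁻¹ • ux (t⁻¹ • z))
      (fun z => t⁻¹ • uy (t⁻¹ • z)) = anisoEnergy K₁ K₃ (openAnnulus R₁ R₂) ux uy := by
  unfold anisoEnergy
  rw [setIntegral_openAnnulus_scale ht, setIntegral_openAnnulus_scale ht, ← integral_smul,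
    ← integral_smul]
  congr 3
  · ext z
    simp only [inv_smul_smul₀ ht.ne']
    simp
    field_simp
  · ext z
    simp only [inv_smul_smul₀ ht.ne']
    simp
    field_simp

theorem competitorEnergies_subset_scale {δ C t : ℝ} (ht : 0 < t) {R₁ R₂ : ℝ} (h₁ : 0 ≤ R₁)
    (h₂ : 0 ≤ R₂) :
    competitorEnergies δ R₁ R₂ C ⊆ competitorEnergies δ (t * R₁) (t * R₂) C := by
  rintro E ⟨u, ux, uy, hu, rfl⟩
  obtain ⟨g₁, g₂, h, hg₁, hg₂⟩ := hu.exists_isUnimodularH1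
  exact ⟨_, _, _, (h.scale ht).isCompetitor (by positivity) (by positivity) hg₁ hg₂,
    (anisoEnergy_scale ht _ _ _ _ _ _).symm⟩

theorem minEnergy_scale {δ C t : ℝ} (ht : 0 < t) {R₁ R₂ : ℝ} (h₁ : 0 ≤ R₁) (h₂ : 0 ≤ R₂) :
    minEnergy δ (t * R₁) (t * R₂) C = minEnergy δ R₁ R₂ C := by
  unfold minEnergy
  congr 1
  refine subset_antisymm ?_ (competitorEnergies_subset_scale ht h₁ h₂)
  have := competitorEnergies_subset_scale (δ := δ) (C := C) (inv_pos.2 ht)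
    (mul_nonneg ht.le h₁) (mul_nonneg ht.le h₂)
  rwa [inv_mul_cancel_left₀ ht.ne', inv_mul_cancel_left₀ ht.ne'] at this

/-! ### Polar coordinates and maps given by a phase. -/

theorem setIntegral_openAnnulus_polar {E : Type*} [NormedAddCommGroup E] [NormedSpace ℝ E]
    {R₁ : ℝ} (h₁ : 0 ≤ R₁) (R₂ : ℝ) (f : ℂ → E) :
    ∫ z in openAnnulus R₁ R₂, f z =
      ∫ p in Set.Ioo R₁ R₂ ×ˢ Set.Ioo (-Real.pi) Real.pi,
        p.1 • f (p.1 * Complex.exp (p.2 * Complex.I)) := by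
  rw [← integral_indicator (measurableSet_openAnnulus _ _), ← Complex.integral_comp_polarCoord_symm]
  have hQ : MeasurableSet (Set.Ioo R₁ R₂ ×ˢ Set.Ioo (-Real.pi) Real.pi) :=
    measurableSet_Ioo.prod measurableSet_Ioo
  have hT : MeasurableSet (Set.Ioi (0 : ℝ) ×ˢ Set.Ioo (-Real.pi) Real.pi) :=
    measurableSet_Ioi.prod measurableSet_Ioo
  rw [← integral_indicator hQ, ← integral_indicator (by exact hT)]
  congr 1; ext p
  have hs : Complex.polarCoord.symm p = p.1 * Complex.exp (p.2 * Complex.I) := by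
    rw [Complex.polarCoord_symm_apply, Complex.exp_mul_I]
    push_cast; ring
  by_cases hp : p ∈ Set.Ioi (0 : ℝ) ×ˢ Set.Ioo (-Real.pi) Real.pi
  · have hn : ‖Complex.polarCoord.symm p‖ = p.1 := by
      rw [Complex.norm_polarCoord_symm, abs_of_pos hp.1]
    rw [Set.indicator_of_mem (by exact hp)]
    by_cases hp' : p ∈ Set.Ioo R₁ R₂ ×ˢ Set.Ioo (-Real.pi) Real.pi
    · rw [Set.indicator_of_mem hp', Set.indicator_of_mem, hs]
      exact ⟨by rw [hn]; exact hp'.1.1, by rw [hn]; exact hp'.1.2⟩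
    · rw [Set.indicator_of_notMem hp', Set.indicator_of_notMem, smul_zero]
      rintro ⟨h3, h4⟩
      rw [hn] at h3 h4
      exact hp' ⟨⟨h3, h4⟩, hp.2⟩
  · rw [Set.indicator_of_notMem (by exact hp), Set.indicator_of_notMem]
    intro hp'
    exact hp ⟨h₁.trans_lt hp'.1.1, hp'.2⟩

theorem norm_polar {r : ℝ} (hr : 0 < r) (θ : ℝ) : ‖(r : ℂ) * Complex.exp (θ * Complex.I)‖ = r := by
  rw [norm_mul, Complex.norm_exp_ofReal_mul_I, Complex.norm_real, Real.norm_of_nonneg hr.le, mul_one]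

theorem arg_polar {r θ : ℝ} (hr : 0 < r) (hθ : θ ∈ Set.Ioo (-Real.pi) Real.pi) :
    Complex.arg ((r : ℂ) * Complex.exp (θ * Complex.I)) = θ := by
  rw [Complex.exp_mul_I]
  exact Complex.arg_mul_cos_add_sin_mul_I hr ⟨hθ.1, hθ.2.le⟩

theorem setIntegral_openAnnulus_mul {R₁ : ℝ} (h₁ : 0 ≤ R₁) (R₂ : ℝ) (f h : ℝ → ℝ) :
    ∫ z in openAnnulus R₁ R₂, f ‖z‖ * h (Complex.arg z) =
      (∫ r in Set.Ioo R₁ R₂, r * f r) * ∫ θ in Set.Ioo (-Real.pi) Real.pi, h θ := by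
  rw [setIntegral_openAnnulus_polar h₁, ← setIntegral_prod_mul, ← Measure.volume_eq_prod]
  refine setIntegral_congr_fun (measurableSet_Ioo.prod measurableSet_Ioo) fun p hp => ?_
  have hr : 0 < p.1 := h₁.trans_lt hp.1.1
  simp only [norm_polar hr, arg_polar hr hp.2, smul_eq_mul, mul_assoc]

/-- `Φ(r, θ)` is a phase in polar coordinates with partial derivatives `Φr`, `Φθ`, decreasing by
`2π` in one counterclockwise turn; it is smooth in `r` and Lipschitz in `θ`. -/
structure IsPolarPhase (R₁ R₂ : ℝ) (Φ Φr Φθ : ℝ → ℝ → ℝ) : Prop where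
  measurable : Measurable fun p : ℝ × ℝ => Φ p.1 p.2
  measurable_r : Measurable fun p : ℝ × ℝ => Φr p.1 p.2
  measurable_θ : Measurable fun p : ℝ × ℝ => Φθ p.1 p.2
  bound_r : ∃ B, ∀ r ∈ Set.Icc R₁ R₂, ∀ θ ∈ Set.Icc (-Real.pi) Real.pi, |Φr r θ| ≤ B
  bound_θ : ∃ B, ∀ r ∈ Set.Icc R₁ R₂, ∀ θ ∈ Set.Icc (-Real.pi) Real.pi, |Φθ r θ| ≤ B
  hasDerivAt_r : ∀ θ, ∀ r ∈ Set.Icc R₁ R₂, HasDerivAt (fun s => Φ s θ) (Φr r θ) r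
  continuousOn_r : ∀ θ, ContinuousOn (fun r => Φr r θ) (Set.Icc R₁ R₂)
  lipschitz : ∀ r ∈ Set.Icc R₁ R₂, ∃ K, LipschitzWith K (Φ r)
  hasDerivAt_θ : ∀ r ∈ Set.Icc R₁ R₂, ∀ᵐ θ, HasDerivAt (Φ r) (Φθ r θ) θ
  periodic : ∀ r θ, Φ r (θ + 2 * Real.pi) = Φ r θ - 2 * Real.pi

/-- The unimodular map with the given phase in polar coordinates. -/
noncomputable def polarMap (Φ : ℝ → ℝ → ℝ) (z : ℂ) : ℂ :=
  Complex.exp (Φ ‖z‖ (Complex.arg z) * Complex.I)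

/-- The derivative of a function of the polar coordinates in the direction making the angle with
cosine `c θ` and sine `s θ` with the radial one. -/
noncomputable def polarGrad (c s : ℝ → ℝ) (Φr Φθ : ℝ → ℝ → ℝ) (z : ℂ) : ℝ :=
  c (Complex.arg z) * Φr ‖z‖ (Complex.arg z) + s (Complex.arg z) * (Φθ ‖z‖ (Complex.arg z) / ‖z‖)

noncomputable def polarDeriv (c s : ℝ → ℝ) (Φ Φr Φθ : ℝ → ℝ → ℝ) (z : ℂ) : ℂ :=
  Complex.I * polarGrad c s Φr Φθ z * polarMap Φ z

/-- The integrand is almost everywhere the derivative of q e^{iΨ}, which is absolutely continuous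
and takes equal values at both ends, as Ψ drops by a full turn. -/
theorem integral_deriv_mul_exp_eq_zero {q Ψ Ψ' : ℝ → ℝ} {K : NNReal} (hq : ContDiff ℝ 1 q)
    (hΨ : LipschitzWith K Ψ) (hd : ∀ᵐ θ, HasDerivAt Ψ (Ψ' θ) θ) {a b : ℝ}
    (hqab : q b = q a) (hΨab : Ψ b = Ψ a - 2 * Real.pi) :
    ∫ θ in a..b, (((deriv q θ : ℝ) : ℂ) + Complex.I * ((q θ * Ψ' θ : ℝ) : ℂ)) *
      Complex.exp (Ψ θ * Complex.I) = 0 := by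
  have ac : ∀ g : ℝ → ℝ, LipschitzWith 1 g →
      AbsolutelyContinuousOnInterval (fun θ => q θ * g (Ψ θ)) a b := by
    intro g hg
    exact (ContDiffOn.absolutelyContinuousOnInterval hq.contDiffOn).fun_mul
      (((hg.comp hΨ).lipschitzOnWith (s := Set.uIcc a b)).absolutelyContinuousOnInterval)
  have ac1 := ac Real.cos Real.lipschitzWith_cos
  have ac2 := ac Real.sin Real.lipschitzWith_sin
  have i1 := ac1.integral_deriv_eq_sub
  have i2 := ac2.integral_deriv_eq_sub
  rw [hqab, hΨab, Real.cos_sub_two_pi, sub_self] at i1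
  rw [hqab, hΨab, Real.sin_sub_two_pi, sub_self] at i2
  have e : ∀ᵐ θ, (((deriv q θ : ℝ) : ℂ) + Complex.I * ((q θ * Ψ' θ : ℝ) : ℂ)) *
      Complex.exp (Ψ θ * Complex.I) = ((deriv (fun θ => q θ * Real.cos (Ψ θ)) θ : ℝ) : ℂ) +
        ((deriv (fun θ => q θ * Real.sin (Ψ θ)) θ : ℝ) : ℂ) * Complex.I := by
    filter_upwards [hd] with θ hθ
    have hq' := ((hq.differentiable (by simp)) θ).hasDerivAt
    rw [(hq'.fun_mul hθ.cos).deriv, (hq'.fun_mul hθ.sin).deriv, Complex.exp_mul_I]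
    push_cast
    linear_combination (q θ * Ψ' θ * Complex.sin (Ψ θ) : ℂ) * Complex.I_sq
  rw [intervalIntegral.integral_congr_ae (e.mono fun θ h _ => h), intervalIntegral.integral_add,
    intervalIntegral.integral_mul_const, intervalIntegral.integral_ofReal,
    intervalIntegral.integral_ofReal, i1, i2]
  · simp
  · exact ⟨ac1.intervalIntegrable_deriv.1.ofReal, ac1.intervalIntegrable_deriv.2.ofReal⟩
  · exact IntervalIntegrable.mul_const (f := fun θ => ((deriv (fun θ => q θ * Real.sin (Ψ θ)) θ : ℝ) : ℂ))
      ⟨ac2.intervalIntegrable_deriv.1.ofReal, ac2.intervalIntegrable_deriv.2.ofReal⟩ _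

/-- Along a ray this is the fundamental theorem of calculus for r φ e^{iΨ}; the factor r is the
polar Jacobian. -/
theorem integral_radial_deriv {φ : ℂ → ℝ} (hφ : ContDiff ℝ ∞ φ) {Ψ Ψ' : ℝ → ℝ} {a b : ℝ}
    (hab : a ≤ b) (hd : ∀ r ∈ Set.Icc a b, HasDerivAt Ψ (Ψ' r) r)
    (hc : ContinuousOn Ψ' (Set.Icc a b)) (θ : ℝ) :
    ∫ r in a..b, (((φ (r * Complex.exp (θ * Complex.I)) +
        r * fderiv ℝ φ (r * Complex.exp (θ * Complex.I)) (Complex.exp (θ * Complex.I)) : ℝ) : ℂ) +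
        Complex.I * ((r * φ (r * Complex.exp (θ * Complex.I)) * Ψ' r : ℝ) : ℂ)) *
        Complex.exp (Ψ r * Complex.I) =
      ((b * φ (b * Complex.exp (θ * Complex.I)) : ℝ) : ℂ) * Complex.exp (Ψ b * Complex.I) -
      ((a * φ (a * Complex.exp (θ * Complex.I)) : ℝ) : ℂ) * Complex.exp (Ψ a * Complex.I) := by
  set η := Complex.exp (θ * Complex.I)
  have hΨ : ContinuousOn Ψ (Set.Icc a b) := fun r hr => (hd r hr).continuousAt.continuousWithinAt
  have hline : ∀ r : ℝ, HasDerivAt (fun r : ℝ => φ (r * η)) (fderiv ℝ φ (r * η) η) r := by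
    intro r
    have h1 : HasDerivAt (fun r : ℝ => (r : ℂ) * η) (1 * η) r :=
      (Complex.ofRealCLM.hasDerivAt (x := r)).mul_const η
    rw [one_mul] at h1
    exact ((hφ.differentiable (by simp)) (r * η)).hasFDerivAt.comp_hasDerivAt r h1
  have hcont : Continuous fun r : ℝ => fderiv ℝ φ (r * η) η :=
    ((hφ.continuous_fderiv (by simp)).comp (by fun_prop)).clm_apply continuous_const
  have hφc : Continuous fun r : ℝ => φ (r * η) := hφ.continuous.comp (by fun_prop)
  refine intervalIntegral.integral_eq_sub_of_hasDerivAt (f := fun r : ℝ =>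
    ((r * φ (r * η) : ℝ) : ℂ) * Complex.exp (Ψ r * Complex.I)) (fun r hr => ?_) ?_
  · rw [Set.uIcc_of_le hab] at hr
    have h1 : HasDerivAt (fun r : ℝ => r * φ (r * η)) (1 * φ (r * η) + r * fderiv ℝ φ (r * η) η) r :=
      (hasDerivAt_id r).mul (hline r)
    have h2 : HasDerivAt (fun r : ℝ => Complex.exp (Ψ r * Complex.I))
        (Complex.exp (Ψ r * Complex.I) * (Ψ' r * Complex.I)) r :=
      ((hd r hr).ofReal_comp.mul_const Complex.I).cexp
    refine (h1.ofReal_comp.fun_mul h2).congr_deriv ?_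
    push_cast; ring
  · refine ContinuousOn.intervalIntegrable ?_
    rw [Set.uIcc_of_le hab]
    have c1 : ContinuousOn (fun r => Complex.exp (Ψ r * Complex.I)) (Set.Icc a b) := by fun_prop
    have c2 : ContinuousOn (fun r : ℝ => ((r * φ (r * η) * Ψ' r : ℝ) : ℂ)) (Set.Icc a b) :=
      Complex.continuous_ofReal.comp_continuousOn ((continuous_id.mul hφc).continuousOn.mul hc)
    have c3 : Continuous fun r : ℝ => ((φ (r * η) + r * fderiv ℝ φ (r * η) η : ℝ) : ℂ) :=
      Complex.continuous_ofReal.comp (hφc.add (continuous_id.mul hcont))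
    exact (c3.continuousOn.add (continuousOn_const.mul c2)).mul c1

/-- A fixed direction e is c(θ) e_r + s(θ) e_θ with s' = -c, so r ∂_e F = ∂_r(r c F) + ∂_θ(s F). The
angular term integrates to zero by periodicity and the radial one gives the two boundary circles. -/
theorem IsPolarPhase.integral_green {R₁ R₂ : ℝ} (h₁ : 0 < R₁) (h₂ : R₁ ≤ R₂)
    {Φ Φr Φθ : ℝ → ℝ → ℝ} (h : IsPolarPhase R₁ R₂ Φ Φr Φθ) {c s : ℝ → ℝ} {e : ℂ}
    (hc : Continuous c) (hs : ∀ θ, HasDerivAt s (-c θ) θ) (hper : s Real.pi = s (-Real.pi))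
    (he : ∀ θ : ℝ, e = (c θ + s θ * Complex.I) * Complex.exp (θ * Complex.I))
    {φ : ℂ → ℝ} (hφ : ContDiff ℝ ∞ φ) :
    ∫ z in openAnnulus R₁ R₂, ((fderiv ℝ φ z e : ℝ) • polarMap Φ z +
        φ z • polarDeriv c s Φ Φr Φθ z) =
      (∫ θ in (-Real.pi)..Real.pi, (R₂ * φ (circleMap 0 R₂ θ) * c θ) •
        Complex.exp (Φ R₂ θ * Complex.I)) -
      ∫ θ in (-Real.pi)..Real.pi, (R₁ * φ (circleMap 0 R₁ θ) * c θ) •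
        Complex.exp (Φ R₁ θ * Complex.I) := by
  set Q : Set (ℝ × ℝ) := Set.Ioo R₁ R₂ ×ˢ Set.Ioo (-Real.pi) Real.pi with hQdef
  have hQ : MeasurableSet Q := measurableSet_Ioo.prod measurableSet_Ioo
  have hpi := Real.pi_pos
  set η : ℝ × ℝ → ℂ := fun p => Complex.exp (p.2 * Complex.I) with hη
  have hηc : Continuous η := by fun_prop
  set E : ℝ × ℝ → ℂ := fun p => Complex.exp (Φ p.1 p.2 * Complex.I) with hE
  have hEm : Measurable E := by
    have := h.measurable
    fun_prop
  have hI : ∀ P : ℝ × ℝ → ℝ, Continuous P → ∀ f : ℝ × ℝ → ℝ, Measurable f →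
      (∃ B, ∀ p ∈ Q, |f p| ≤ B) → IntegrableOn (fun p => ((P p * f p : ℝ) : ℂ) * E p) Q := by
    intro P hP f hf ⟨B, hB⟩
    obtain ⟨C, hC⟩ := ((isCompact_Icc (a := R₁) (b := R₂)).prod
      (isCompact_Icc (a := -Real.pi) (b := Real.pi))).exists_bound_of_continuousOn hP.continuousOn
    refine Measure.integrableOn_of_bounded (M := C * B) ?_ ?_ ?_
    · rw [hQdef, Measure.volume_eq_prod, Measure.prod_prod]
      simp [ENNReal.mul_eq_top]
    · exact (((Complex.measurable_ofReal.comp (hP.measurable.mul hf))).mul hEm).aestronglyMeasurable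
    · filter_upwards [ae_restrict_mem hQ] with p hp
      have h3 := hC p ⟨Set.Ioo_subset_Icc_self hp.1, Set.Ioo_subset_Icc_self hp.2⟩
      rw [norm_mul, Complex.norm_exp_ofReal_mul_I, mul_one, Complex.norm_real, norm_mul]
      exact mul_le_mul h3 (hB p hp) (norm_nonneg _) ((norm_nonneg _).trans h3)
  have hsc : Continuous s := continuous_iff_continuousAt.2 fun θ => (hs θ).continuousAt
  have hφc : Continuous fun p : ℝ × ℝ => φ (p.1 * η p) := hφ.continuous.comp (by fun_prop)
  have hfd : ∀ w : ℝ × ℝ → ℂ, Continuous w →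
      Continuous fun p : ℝ × ℝ => fderiv ℝ φ (p.1 * η p) (w p) := fun w hw =>
    ((hφ.continuous_fderiv (by simp)).comp (by fun_prop)).clm_apply hw
  set D₁ : ℝ × ℝ → ℂ := fun p => (c p.2 : ℂ) * ((((φ (p.1 * η p) +
        p.1 * fderiv ℝ φ (p.1 * η p) (η p) : ℝ) : ℂ) +
        Complex.I * ((p.1 * φ (p.1 * η p) * Φr p.1 p.2 : ℝ) : ℂ)) * E p) with hD₁
  set D₂ : ℝ × ℝ → ℂ := fun p => (((-c p.2 * φ (p.1 * η p) +
        s p.2 * fderiv ℝ φ (p.1 * η p) (p.1 * (Complex.I * η p)) : ℝ) : ℂ) +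
        Complex.I * ((s p.2 * φ (p.1 * η p) * Φθ p.1 p.2 : ℝ) : ℂ)) * E p with hD₂
  have hB1 : ∃ B, ∀ p ∈ Q, |(fun _ : ℝ × ℝ => (1 : ℝ)) p| ≤ B := ⟨1, fun p _ => by simp⟩
  have hBr : ∃ B, ∀ p ∈ Q, |(fun p : ℝ × ℝ => Φr p.1 p.2) p| ≤ B := by
    obtain ⟨B, hB⟩ := h.bound_r
    exact ⟨B, fun p hp => hB _ (Set.Ioo_subset_Icc_self hp.1) _ (Set.Ioo_subset_Icc_self hp.2)⟩
  have hBθ : ∃ B, ∀ p ∈ Q, |(fun p : ℝ × ℝ => Φθ p.1 p.2) p| ≤ B := by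
    obtain ⟨B, hB⟩ := h.bound_θ
    exact ⟨B, fun p hp => hB _ (Set.Ioo_subset_Icc_self hp.1) _ (Set.Ioo_subset_Icc_self hp.2)⟩
  have iD₁ : IntegrableOn D₁ Q := by
    refine ((hI (fun p => c p.2 * (φ (p.1 * η p) + p.1 * fderiv ℝ φ (p.1 * η p) (η p)))
      (by have := hfd η hηc; fun_prop) _ measurable_const hB1).add
      ((hI (fun p => c p.2 * (p.1 * φ (p.1 * η p))) (by fun_prop) _ h.measurable_r hBr).const_mul
        Complex.I)).congr (Eventually.of_forall fun p => ?_)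
    simp only [hD₁, Pi.add_apply]
    push_cast; ring
  have iD₂ : IntegrableOn D₂ Q := by
    refine ((hI (fun p => -c p.2 * φ (p.1 * η p) +
        s p.2 * fderiv ℝ φ (p.1 * η p) (p.1 * (Complex.I * η p)))
      (by have := hfd (fun p => p.1 * (Complex.I * η p)) (by fun_prop); fun_prop)
        _ measurable_const hB1).add
      ((hI (fun p => s p.2 * φ (p.1 * η p)) (by fun_prop) _ h.measurable_θ hBθ).const_mul
        Complex.I)).congr (Eventually.of_forall fun p => ?_)
    simp only [hD₂, Pi.add_apply]
    push_cast; ring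
  have split : ∫ z in openAnnulus R₁ R₂, ((fderiv ℝ φ z e : ℝ) • polarMap Φ z +
      φ z • polarDeriv c s Φ Φr Φθ z) = (∫ p in Q, D₁ p) + ∫ p in Q, D₂ p := by
    rw [setIntegral_openAnnulus_polar h₁.le, ← integral_add iD₁ iD₂]
    refine setIntegral_congr_fun hQ fun p hp => ?_
    have hr : 0 < p.1 := h₁.trans hp.1.1
    have hf : fderiv ℝ φ (p.1 * η p) e = c p.2 * fderiv ℝ φ (p.1 * η p) (η p) +
        s p.2 * fderiv ℝ φ (p.1 * η p) (Complex.I * η p) := by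
      have : e = c p.2 • η p + s p.2 • (Complex.I * η p) := by
        rw [he p.2]; simp only [hη, Complex.real_smul]; ring
      conv_lhs => rw [this]
      rw [map_add, map_smul, map_smul, smul_eq_mul, smul_eq_mul]
    have hf2 : fderiv ℝ φ (p.1 * η p) (p.1 * (Complex.I * η p)) =
        p.1 * fderiv ℝ φ (p.1 * η p) (Complex.I * η p) := by
      rw [← Complex.real_smul (x := p.1) (z := Complex.I * η p), map_smul, smul_eq_mul]
    simp only [polarDeriv, polarGrad, polarMap, norm_polar hr, arg_polar hr hp.2, hD₁, hD₂]
    simp only [hη] at hf hf2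
    simp only [hη, hf, hf2, Complex.real_smul, hE]
    have hr' : (p.1 : ℂ) ≠ 0 := by exact_mod_cast hr.ne'
    push_cast
    field_simp
    ring
  rw [split]
  have hQr : (volume : Measure (ℝ × ℝ)).restrict Q =
      (volume.restrict (Set.Ioo R₁ R₂)).prod (volume.restrict (Set.Ioo (-Real.pi) Real.pi)) := by
    rw [Measure.prod_restrict, ← Measure.volume_eq_prod]
  have J₂ : ∫ p in Q, D₂ p = 0 := by
    rw [IntegrableOn, hQr] at iD₂
    rw [hQr, integral_prod _ iD₂]
    refine setIntegral_eq_zero_of_forall_eq_zero fun r hr => ?_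
    have hr' := Set.Ioo_subset_Icc_self hr
    obtain ⟨K, hK⟩ := h.lipschitz r hr'
    have hqd : ∀ θ : ℝ, HasDerivAt (fun θ : ℝ => s θ * φ (r * Complex.exp (θ * Complex.I)))
        (-c θ * φ (r * Complex.exp (θ * Complex.I)) + s θ *
          fderiv ℝ φ (r * Complex.exp (θ * Complex.I))
            (r * (Complex.I * Complex.exp (θ * Complex.I)))) θ := by
      intro θ
      have h1 : HasDerivAt (fun θ : ℝ => (r : ℂ) * Complex.exp (θ * Complex.I))
          (r * (Complex.exp (θ * Complex.I) * (1 * Complex.I))) θ :=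
        (((Complex.ofRealCLM.hasDerivAt (x := θ)).mul_const Complex.I).cexp).const_mul (r : ℂ)
      rw [one_mul, mul_comm (Complex.exp _)] at h1
      exact (hs θ).mul (((hφ.differentiable (by simp)) _).hasFDerivAt.comp_hasDerivAt θ h1)
    have hq : ContDiff ℝ 1 fun θ : ℝ => s θ * φ (r * Complex.exp (θ * Complex.I)) := by
      rw [contDiff_one_iff_deriv]
      refine ⟨fun θ => (hqd θ).differentiableAt, ?_⟩
      rw [funext fun θ => (hqd θ).deriv]
      have h5 := (hfd (fun p => p.1 * (Complex.I * η p)) (by fun_prop)).comp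
        (by fun_prop : Continuous fun θ : ℝ => (r, θ))
      have h6 := hφc.comp (by fun_prop : Continuous fun θ : ℝ => (r, θ))
      exact (hc.neg.mul h6).add (hsc.mul h5)
    have key := integral_deriv_mul_exp_eq_zero hq hK (h.hasDerivAt_θ r hr')
      (a := -Real.pi) (b := Real.pi) (by
        rw [hper]; congr 2
        rw [show ((Real.pi : ℝ) : ℂ) * Complex.I = ((-Real.pi : ℝ) : ℂ) * Complex.I +
          2 * Real.pi * Complex.I by push_cast; ring, Complex.exp_add, Complex.exp_two_pi_mul_I,
          mul_one]) (by
        rw [← h.periodic r (-Real.pi)]; congr 1; ring)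
    rw [intervalIntegral.integral_of_le (by linarith), integral_Ioc_eq_integral_Ioo] at key
    rw [← key]
    congr 1; ext θ
    simp only [hD₂, hE, hη, (hqd θ).deriv]
  have J₁ : ∫ p in Q, D₁ p = ∫ θ in (-Real.pi)..Real.pi, ((c θ : ℂ) *
      (((R₂ * φ (R₂ * Complex.exp (θ * Complex.I)) : ℝ) : ℂ) * Complex.exp (Φ R₂ θ * Complex.I) -
      ((R₁ * φ (R₁ * Complex.exp (θ * Complex.I)) : ℝ) : ℂ) *
        Complex.exp (Φ R₁ θ * Complex.I))) := by
    rw [IntegrableOn, hQr] at iD₁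
    rw [hQr, integral_prod_symm _ iD₁, intervalIntegral.integral_of_le (by linarith),
      integral_Ioc_eq_integral_Ioo]
    congr 1; ext θ
    rw [← integral_radial_deriv hφ h₂ (h.hasDerivAt_r θ) (h.continuousOn_r θ) θ,
      intervalIntegral.integral_of_le h₂, integral_Ioc_eq_integral_Ioo, ← integral_const_mul]
  have hcirc : ∀ R θ : ℝ, circleMap 0 R θ = R * Complex.exp (θ * Complex.I) := by
    intro R θ; simp [circleMap]
  have hint : ∀ R ∈ Set.Icc R₁ R₂, IntervalIntegrable (fun θ : ℝ => (R * φ (circleMap 0 R θ) * c θ) •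
      Complex.exp (Φ R θ * Complex.I)) volume (-Real.pi) Real.pi := by
    intro R hR
    obtain ⟨K, hK⟩ := h.lipschitz R hR
    have h5 := hK.continuous
    have h6 : Continuous fun θ : ℝ => φ (circleMap 0 R θ) := hφ.continuous.comp (by fun_prop)
    exact Continuous.intervalIntegrable (by fun_prop) _ _
  rw [J₂, J₁, add_zero, ← intervalIntegral.integral_sub (hint R₂ ⟨h₂, le_rfl⟩) (hint R₁ ⟨le_rfl, h₂⟩)]
  congr 1; ext θ
  rw [hcirc, hcirc, Complex.real_smul, Complex.real_smul]
  push_cast; ring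

theorem measurable_polarMap {Φ : ℝ → ℝ → ℝ} (h : Measurable fun p : ℝ × ℝ => Φ p.1 p.2) :
    Measurable (polarMap Φ) := by
  have := h.comp (measurable_norm.prodMk Complex.measurable_arg)
  exact Complex.measurable_exp.comp ((Complex.measurable_ofReal.comp this).mul_const _)

theorem norm_polarMap (Φ : ℝ → ℝ → ℝ) (z : ℂ) : ‖polarMap Φ z‖ = 1 :=
  Complex.norm_exp_ofReal_mul_I _

theorem arg_mem_Icc (z : ℂ) : Complex.arg z ∈ Set.Icc (-Real.pi) Real.pi :=
  ⟨(Complex.neg_pi_lt_arg z).le, Complex.arg_le_pi z⟩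

theorem IsPolarPhase.memLp_polarMap {R₁ R₂ : ℝ} {Φ Φr Φθ : ℝ → ℝ → ℝ}
    (h : IsPolarPhase R₁ R₂ Φ Φr Φθ) :
    MemLp (polarMap Φ) 2 (volume.restrict (openAnnulus R₁ R₂)) :=
  MemLp.of_bound (measurable_polarMap h.measurable).aestronglyMeasurable 1
    (Eventually.of_forall fun z => (norm_polarMap Φ z).le)

theorem IsPolarPhase.measurable_polarGrad {R₁ R₂ : ℝ} {Φ Φr Φθ : ℝ → ℝ → ℝ}
    (h : IsPolarPhase R₁ R₂ Φ Φr Φθ) {c s : ℝ → ℝ} (hc : Continuous c) (hs : Continuous s) :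
    Measurable (polarGrad c s Φr Φθ) := by
  have m1 := h.measurable_r.comp (measurable_norm.prodMk Complex.measurable_arg)
  have m2 := h.measurable_θ.comp (measurable_norm.prodMk Complex.measurable_arg)
  exact ((hc.measurable.comp Complex.measurable_arg).mul m1).add
    ((hs.measurable.comp Complex.measurable_arg).mul (m2.div measurable_norm))

theorem IsPolarPhase.memLp_polarDeriv {R₁ R₂ : ℝ} (h₁ : 0 < R₁) {Φ Φr Φθ : ℝ → ℝ → ℝ}
    (h : IsPolarPhase R₁ R₂ Φ Φr Φθ) {c s : ℝ → ℝ} (hc : Continuous c) (hs : Continuous s)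
    (hc1 : ∀ θ, |c θ| ≤ 1) (hs1 : ∀ θ, |s θ| ≤ 1) :
    MemLp (polarDeriv c s Φ Φr Φθ) 2 (volume.restrict (openAnnulus R₁ R₂)) := by
  obtain ⟨B, hB⟩ := h.bound_r
  obtain ⟨B', hB'⟩ := h.bound_θ
  refine MemLp.of_bound (((measurable_const.mul (Complex.measurable_ofReal.comp
    (h.measurable_polarGrad hc hs))).mul (measurable_polarMap h.measurable)).aestronglyMeasurable)
    (B + B' / R₁) ?_
  filter_upwards [ae_restrict_mem (measurableSet_openAnnulus R₁ R₂)] with z hz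
  have hr : ‖z‖ ∈ Set.Icc R₁ R₂ := ⟨hz.1.le, hz.2.le⟩
  have b1 := hB _ hr _ (arg_mem_Icc z)
  have b2 := hB' _ hr _ (arg_mem_Icc z)
  rw [polarDeriv, norm_mul, norm_mul, Complex.norm_I, norm_polarMap, one_mul, mul_one,
    Complex.norm_real, polarGrad]
  refine (norm_add_le _ _).trans (add_le_add ?_ ?_)
  · rw [norm_mul]
    calc _ ≤ 1 * |Φr ‖z‖ (Complex.arg z)| := by gcongr; exacts [hc1 _, le_rfl]
      _ ≤ B := by rw [one_mul]; exact b1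
  · rw [norm_mul, norm_div, norm_norm]
    calc _ ≤ 1 * (B' / R₁) := by
          gcongr
          · exact hs1 _
          · exact (abs_nonneg _).trans b2
          · exact b2
          · exact hz.1.le
      _ = B' / R₁ := one_mul _

theorem exp_phase_periodic {φ : ℝ → ℝ} (h : ∀ θ, φ (θ + 2 * Real.pi) = φ θ - 2 * Real.pi) :
    Function.Periodic (fun θ : ℝ => Complex.exp (φ θ * Complex.I)) (2 * Real.pi) := by
  intro θ
  simp only [h]
  push_cast
  rw [sub_mul, Complex.exp_sub, Complex.exp_two_pi_mul_I, div_one]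

theorem IsPolarPhase.isUnimodularH1 {R₁ R₂ : ℝ} (h₁ : 0 < R₁) (h₂ : R₁ ≤ R₂)
    {Φ Φr Φθ : ℝ → ℝ → ℝ} (h : IsPolarPhase R₁ R₂ Φ Φr Φθ) :
    IsUnimodularH1 R₁ R₂ (polarMap Φ) (polarDeriv Real.cos (fun θ => -Real.sin θ) Φ Φr Φθ)
      (polarDeriv Real.sin Real.cos Φ Φr Φθ) (fun θ => Complex.exp (Φ R₁ θ * Complex.I))
      (fun θ => Complex.exp (Φ R₂ θ * Complex.I)) := by
  have mx := h.memLp_polarDeriv h₁ Real.continuous_cos Real.continuous_sin.neg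
    Real.abs_cos_le_one (fun θ => by
      rw [Pi.neg_apply, abs_neg]; exact Real.abs_sin_le_one θ)
  have my := h.memLp_polarDeriv h₁ Real.continuous_sin Real.continuous_cos
    Real.abs_sin_le_one Real.abs_cos_le_one
  refine ⟨h.memLp_polarMap, mx, my, Eventually.of_forall (norm_polarMap Φ), fun φ hφ hcs => ?_⟩
  -- Traces are integrated over [0, 2π], polar coordinates use (-π, π); periodicity reconciles the
  -- two.
  have shift : ∀ (R : ℝ) (c : ℝ → ℝ), Function.Periodic c (2 * Real.pi) →
      ∫ θ in (0 : ℝ)..(2 * Real.pi), (R * φ (circleMap 0 R θ) * c θ) •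
          Complex.exp (Φ R θ * Complex.I) =
        ∫ θ in (-Real.pi)..Real.pi, (R * φ (circleMap 0 R θ) * c θ) •
          Complex.exp (Φ R θ * Complex.I) := by
    intro R c hc
    have hp : Function.Periodic (fun θ => (R * φ (circleMap 0 R θ) * c θ) •
          Complex.exp (Φ R θ * Complex.I)) (2 * Real.pi) := by
      intro θ
      have := exp_phase_periodic (h.periodic R) θ
      simp only at this
      simp only [hc θ, this, periodic_circleMap 0 R θ]
    have := hp.intervalIntegral_add_eq 0 (-Real.pi)
    rwa [zero_add, show -Real.pi + 2 * Real.pi = Real.pi by ring] at this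
  have fin : ∀ (e : ℂ) (c s : ℝ → ℝ), Continuous c → (∀ θ, HasDerivAt s (-c θ) θ) →
      s Real.pi = s (-Real.pi) →
      (∀ θ : ℝ, e = (c θ + s θ * Complex.I) * Complex.exp (θ * Complex.I)) →
      Function.Periodic c (2 * Real.pi) →
      MemLp (polarDeriv c s Φ Φr Φθ) 2 (volume.restrict (openAnnulus R₁ R₂)) →
      ∫ z in openAnnulus R₁ R₂, (fderiv ℝ φ z e : ℝ) • polarMap Φ z =
      -(∫ z in openAnnulus R₁ R₂, φ z • polarDeriv c s Φ Φr Φθ z)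
        + (∫ θ in (0 : ℝ)..(2 * Real.pi), (R₂ * φ (circleMap 0 R₂ θ) * c θ) •
          Complex.exp (Φ R₂ θ * Complex.I))
        - ∫ θ in (0 : ℝ)..(2 * Real.pi), (R₁ * φ (circleMap 0 R₁ θ) * c θ) •
          Complex.exp (Φ R₁ θ * Complex.I) := by
    intro e c s hc hs hper he hcp hm
    have key := h.integral_green h₁ h₂ hc hs hper he hφ
    rw [integral_add (MemLp.integrable_smul_of_compact h.memLp_polarMap
        ((hφ.continuous_fderiv (by simp)).clm_apply continuous_const) (hcs.fderiv_apply ℝ e))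
      (MemLp.integrable_smul_of_compact hm hφ.continuous hcs)] at key
    rw [shift _ _ hcp, shift _ _ hcp]
    linear_combination key
  constructor
  · refine fin 1 Real.cos (fun θ => -Real.sin θ) Real.continuous_cos
      (fun θ => (Real.hasDerivAt_sin θ).neg) (by simp) (fun θ => ?_) Real.cos_periodic mx
    rw [Complex.exp_mul_I]
    push_cast
    linear_combination Complex.sin θ ^ 2 * Complex.I_sq - Complex.sin_sq_add_cos_sq (θ : ℂ)
  · refine fin Complex.I Real.sin Real.cos Real.continuous_sin
      Real.hasDerivAt_cos (by simp) (fun θ => ?_) Real.sin_periodic my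
    rw [Complex.exp_mul_I]
    push_cast
    linear_combination (-Complex.cos θ * Complex.sin θ) * Complex.I_sq -
      Complex.I * Complex.sin_sq_add_cos_sq (θ : ℂ)

/-! ### The energy of a map in terms of its phase gradient. -/

theorem setIntegral_Ioo_inv {R₁ R₂ : ℝ} (h₁ : 0 < R₁) (h₂ : R₁ ≤ R₂) :
    ∫ r in Set.Ioo R₁ R₂, r⁻¹ = Real.log (R₂ / R₁) := by
  rw [← integral_Ioc_eq_integral_Ioo, ← intervalIntegral.integral_of_le h₂,
    integral_inv_of_pos h₁ (h₁.trans_le h₂)]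

theorem setIntegral_angular_div_norm_sq {R₁ R₂ : ℝ} (h₁ : 0 < R₁) (h₂ : R₁ ≤ R₂) (h : ℝ → ℝ) :
    ∫ z in openAnnulus R₁ R₂, h (Complex.arg z) / ‖z‖ ^ 2 =
      Real.log (R₂ / R₁) * ∫ θ in Set.Ioo (-Real.pi) Real.pi, h θ := by
  rw [← setIntegral_Ioo_inv h₁ h₂]
  have e : ∫ r in Set.Ioo R₁ R₂, r⁻¹ = ∫ r in Set.Ioo R₁ R₂, r * (r ^ 2)⁻¹ :=
    setIntegral_congr_fun measurableSet_Ioo fun r hr => by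
      have : r ≠ 0 := (h₁.trans hr.1).ne'
      field_simp
  rw [e, ← setIntegral_openAnnulus_mul h₁.le R₂ (fun r => (r ^ 2)⁻¹) h]
  congr 1; ext z; rw [div_eq_inv_mul]

theorem setIntegral_inv_norm_sq {R₁ R₂ : ℝ} (h₁ : 0 < R₁) (h₂ : R₁ ≤ R₂) :
    ∫ z in openAnnulus R₁ R₂, (‖z‖ ^ 2)⁻¹ = 2 * Real.pi * Real.log (R₂ / R₁) := by
  have := setIntegral_angular_div_norm_sq h₁ h₂ (fun _ => 1)
  rw [setIntegral_congr_fun (g := fun z : ℂ => 1 / ‖z‖ ^ 2) (measurableSet_openAnnulus _ _)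
    fun z _ => (one_div _).symm, this]
  simp [Real.pi_pos.le]
  ring

theorem integrableOn_inv_norm_sq {R₁ : ℝ} (h₁ : 0 < R₁) (R₂ : ℝ) :
    IntegrableOn (fun z : ℂ => (‖z‖ ^ 2)⁻¹) (openAnnulus R₁ R₂) := by
  have := integrable_norm_rpow_smul (R₂ := R₂) h₁ (p := fun _ : ℂ => (1 : ℝ)) (integrable_const _)
  simpa using this

/-- For derivatives i a u and i b u, with (a, b) the phase gradient, the divergence and the curl are
the components of (a, b) in an orthonormal frame attached to u when |u| = 1; their squares then add
up to a² + b². -/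
theorem div_sq_of_current (a b : ℝ) (u : ℂ) :
    ((Complex.I * a * u).re + (Complex.I * b * u).im) ^ 2 = (b * u.re - a * u.im) ^ 2 := by
  simp; ring

theorem curl_sq_of_current (a b : ℝ) (u : ℂ) :
    ((Complex.I * a * u).im - (Complex.I * b * u).re) ^ 2 = (a * u.re + b * u.im) ^ 2 := by
  simp

theorem polarGrad_sq_add_sq {Φr Φθ : ℝ → ℝ → ℝ} {z : ℂ} :
    polarGrad Real.cos (fun θ => -Real.sin θ) Φr Φθ z ^ 2 + polarGrad Real.sin Real.cos Φr Φθ z ^ 2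
      = Φr ‖z‖ (Complex.arg z) ^ 2 + (Φθ ‖z‖ (Complex.arg z) / ‖z‖) ^ 2 := by
  simp only [polarGrad]
  linear_combination (Φr ‖z‖ (Complex.arg z) ^ 2 + (Φθ ‖z‖ (Complex.arg z) / ‖z‖) ^ 2) *
    Real.sin_sq_add_cos_sq (Complex.arg z)

theorem IsPolarPhase.anisoEnergy_le {R₁ R₂ δ B : ℝ} (h₁ : 0 < R₁) (h₂ : R₁ ≤ R₂) (hδ₀ : 0 ≤ δ)
    (hδ₁ : δ < 1) {Φ Φr Φθ : ℝ → ℝ → ℝ} (h : IsPolarPhase R₁ R₂ Φ Φr Φθ)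
    (hB : ∀ r ∈ Set.Ioo R₁ R₂, ∀ θ ∈ Set.Icc (-Real.pi) Real.pi,
      (r * Φr r θ) ^ 2 + Φθ r θ ^ 2 ≤ B) :
    anisoEnergy (1 + δ) (1 - δ) (openAnnulus R₁ R₂)
      (polarDeriv Real.cos (fun θ => -Real.sin θ) Φ Φr Φθ)
      (polarDeriv Real.sin Real.cos Φ Φr Φθ) ≤ B * (2 * Real.pi * Real.log (R₂ / R₁)) := by
  have hU := h.isUnimodularH1 h₁ h₂
  have i1 := MemLp.integrable_div_sq hU.memLp_x hU.memLp_y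
  have i2 := MemLp.integrable_curl_sq hU.memLp_x hU.memLp_y
  unfold anisoEnergy
  rw [← setIntegral_inv_norm_sq h₁ h₂, ← integral_const_mul, ← integral_const_mul,
    ← integral_const_mul, ← integral_add (i1.const_mul _) (i2.const_mul _)]
  refine setIntegral_mono_on ((i1.const_mul _).add (i2.const_mul _))
    ((integrableOn_inv_norm_sq h₁ R₂).const_mul B) (measurableSet_openAnnulus _ _) fun z hz => ?_
  have hz0 : 0 < ‖z‖ := h₁.trans hz.1
  have hb := hB _ ⟨hz.1, hz.2⟩ _ (arg_mem_Icc z)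
  simp only [polarDeriv]
  rw [div_sq_of_current, curl_sq_of_current]
  have hp := polarGrad_sq_add_sq (Φr := Φr) (Φθ := Φθ) (z := z)
  have hu : (polarMap Φ z).re ^ 2 + (polarMap Φ z).im ^ 2 = 1 := by
    have := norm_polarMap Φ z
    rw [← Complex.sq_norm_sub_sq_re]; rw [this]; ring
  set a := polarGrad Real.cos (fun θ => -Real.sin θ) Φr Φθ z
  set b := polarGrad Real.sin Real.cos Φr Φθ z
  set v := (polarMap Φ z).re
  set w := (polarMap Φ z).im
  have key : (b * v - a * w) ^ 2 + (a * v + b * w) ^ 2 = a ^ 2 + b ^ 2 := by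
    linear_combination (a ^ 2 + b ^ 2) * hu
  have hb' : a ^ 2 + b ^ 2 ≤ B * (‖z‖ ^ 2)⁻¹ := by
    rw [hp, ← div_eq_mul_inv, le_div_iff₀ (by positivity)]
    refine le_trans (le_of_eq ?_) hb
    field_simp
  -- Both weights (1 ± δ)/2 are at most 1, so the density is at most a² + b². This crude bound
  -- serves only for transition annuli.
  nlinarith [sq_nonneg (b * v - a * w), sq_nonneg (a * v + b * w)]

/-! ### Lipschitz phases of degree -1. -/

/-- An arc of length at most 1 is at most twice its chord. By continuity the increments of the phase
are locally that small, so its slopes at each point are at most 2C, and a comparison of right slopes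
turns this into a global bound. -/
theorem HasCircleDegree.lipschitz_phase {C : ℝ} (hC : 0 < C) {g : ℝ → ℂ} {φ : ℝ → ℝ}
    (hφ : Continuous φ) (hg : ∀ θ, g θ = Complex.exp (φ θ * Complex.I))
    (hL : ∀ θ θ' : ℝ, ‖g θ - g θ'‖ ≤ C * |θ - θ'|) : LipschitzWith (Real.toNNReal (2 * C)) φ := by
  have hexp : ∀ s : ℝ, |s| ≤ 1 → |s| ≤ 2 * ‖Complex.exp (s * Complex.I) - 1‖ := by
    intro s hs
    rw [mul_comm (s : ℂ), Complex.norm_exp_I_mul_ofReal_sub_one, norm_mul, Real.norm_two]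
    have h1 := Real.mul_abs_le_abs_sin (x := s / 2) (by
      rw [abs_div, abs_two]; linarith [Real.pi_gt_three])
    rw [abs_div, abs_two] at h1
    rw [Real.norm_eq_abs]
    have h2 : (1 : ℝ) / 2 ≤ 2 / Real.pi := by
      rw [div_le_div_iff₀ (by norm_num) Real.pi_pos]; linarith [Real.pi_le_four]
    nlinarith [abs_nonneg s]
  have hloc : ∀ x, ∀ᶠ z in 𝓝 x, |φ z - φ x| ≤ 2 * C * |z - x| := by
    intro x
    have : ∀ᶠ z in 𝓝 x, |φ z - φ x| < 1 := by
      have h1 : Tendsto (fun z => |φ z - φ x|) (𝓝 x) (𝓝 |φ x - φ x|) :=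
        ((hφ.tendsto x).sub_const _).abs
      rw [sub_self, abs_zero] at h1
      exact h1.eventually_lt_const one_pos
    filter_upwards [this] with z hz
    have h2 := hexp _ hz.le
    have h3 : ‖Complex.exp ((φ z - φ x : ℝ) * Complex.I) - 1‖ = ‖g z - g x‖ := by
      rw [hg, hg]
      have : Complex.exp (φ z * Complex.I) - Complex.exp (φ x * Complex.I) =
          Complex.exp (φ x * Complex.I) * (Complex.exp ((φ z - φ x : ℝ) * Complex.I) - 1) := by
        rw [mul_sub, ← Complex.exp_add]; push_cast; ring_nf
      rw [this, norm_mul, Complex.norm_exp_ofReal_mul_I, one_mul]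
    rw [h3] at h2
    linarith [hL z x]
  have hmain : ∀ a b, a ≤ b → |φ b - φ a| ≤ 2 * C * (b - a) := by
    intro a b hab
    refine image_le_of_liminf_slope_right_le_deriv_boundary (f := fun x => |φ x - φ a|)
      (B := fun x => 2 * C * (x - a)) (B' := fun _ => 2 * C) (a := a) (b := b) (by fun_prop)
      (by simp) (by fun_prop) (fun x _ => ?_) (fun x _ r hr => ?_) ⟨hab, le_rfl⟩
    · simpa using (((hasDerivAt_id x).sub_const a).const_mul (2 * C)).hasDerivWithinAt
    · refine Eventually.frequently ?_
      filter_upwards [nhdsWithin_le_nhds (hloc x), self_mem_nhdsWithin] with z hz hxz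
      have hxz' : 0 < z - x := sub_pos.2 hxz
      rw [abs_of_pos hxz'] at hz
      rw [slope_def_field, div_lt_iff₀ hxz']
      have h4 : |φ z - φ a| - |φ x - φ a| ≤ |φ z - φ x| := by
        have := abs_sub_abs_le_abs_sub (φ z - φ a) (φ x - φ a)
        rwa [sub_sub_sub_cancel_right] at this
      nlinarith
  refine LipschitzWith.of_dist_le_mul fun a b => ?_
  rw [Real.coe_toNNReal _ (by positivity), Real.dist_eq, Real.dist_eq]
  rcases le_total a b with h | h
  · rw [abs_sub_comm, abs_sub_comm a, abs_of_nonneg (sub_nonneg.2 h)]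
    exact hmain a b h
  · rw [abs_of_nonneg (sub_nonneg.2 h)]
    exact hmain b a h

/-- `φ` is a Lipschitz phase of degree `-1`. -/
structure IsDescendingPhase (K : NNReal) (φ : ℝ → ℝ) : Prop where
  lipschitz : LipschitzWith K φ
  periodic : ∀ θ, φ (θ + 2 * Real.pi) = φ θ - 2 * Real.pi

theorem IsBoundaryDatum.exists_phase {C : ℝ} (hC : 1 ≤ C) {g : ℝ → ℂ} (h : IsBoundaryDatum C g) :
    ∃ φ, IsDescendingPhase (Real.toNNReal (2 * C)) φ ∧
      g = fun θ => Complex.exp (φ θ * Complex.I) := by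
  obtain ⟨hL, φ, hφ, hg, hp⟩ := h
  refine ⟨φ, ⟨HasCircleDegree.lipschitz_phase (by linarith) hφ hg hL, fun θ => ?_⟩, funext hg⟩
  rw [hp]; push_cast; ring

theorem IsDescendingPhase.isBoundaryDatum {K : NNReal} {φ : ℝ → ℝ} (h : IsDescendingPhase K φ)
    {C : ℝ} (hC : K ≤ C) : IsBoundaryDatum C fun θ => Complex.exp (φ θ * Complex.I) := by
  refine ⟨fun θ θ' => ?_, φ, h.lipschitz.continuous, fun _ => rfl, fun θ => ?_⟩
  · have h1 : Complex.exp (φ θ * Complex.I) - Complex.exp (φ θ' * Complex.I) =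
        Complex.exp (φ θ' * Complex.I) * (Complex.exp (Complex.I * (φ θ - φ θ' : ℝ)) - 1) := by
      rw [mul_sub, ← Complex.exp_add]; push_cast; ring_nf
    have h2 := h.lipschitz.dist_le_mul θ θ'
    rw [h1, norm_mul, Complex.norm_exp_ofReal_mul_I, one_mul]
    refine (Real.norm_exp_I_mul_ofReal_sub_one_le).trans (le_trans ?_
      (mul_le_mul_of_nonneg_right hC (abs_nonneg _)))
    simpa [Real.dist_eq] using h2
  · rw [h.periodic]; push_cast; ring

theorem isDescendingPhase_neg : IsDescendingPhase 1 fun θ => -θ :=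
  ⟨LipschitzWith.id.neg, fun θ => by ring⟩

theorem IsDescendingPhase.abs_deriv_le {K : NNReal} {φ : ℝ → ℝ} (h : IsDescendingPhase K φ)
    (θ : ℝ) : |deriv φ θ| ≤ K := norm_deriv_le_of_lipschitz h.lipschitz

theorem IsDescendingPhase.ae_hasDerivAt {K : NNReal} {φ : ℝ → ℝ} (h : IsDescendingPhase K φ) :
    ∀ᵐ θ, HasDerivAt φ (deriv φ θ) θ :=
  h.lipschitz.ae_differentiableAt.mono fun _ hθ => hθ.hasDerivAt

theorem IsDescendingPhase.isPolarPhase {K : NNReal} {φ : ℝ → ℝ} (h : IsDescendingPhase K φ)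
    (R₁ R₂ : ℝ) : IsPolarPhase R₁ R₂ (fun _ θ => φ θ) (fun _ _ => 0) (fun _ θ => deriv φ θ) where
  measurable := h.lipschitz.continuous.measurable.comp measurable_snd
  measurable_r := measurable_const
  measurable_θ := (measurable_deriv φ).comp measurable_snd
  bound_r := ⟨0, fun _ _ _ _ => by simp⟩
  bound_θ := ⟨K, fun _ _ θ _ => h.abs_deriv_le θ⟩
  hasDerivAt_r := fun θ r _ => hasDerivAt_const r (φ θ)
  continuousOn_r := fun _ => continuousOn_const
  lipschitz := fun _ _ => ⟨K, h.lipschitz⟩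
  hasDerivAt_θ := fun _ _ => h.ae_hasDerivAt
  periodic := fun _ => h.periodic

/-! ### Interpolating and homogeneous maps. -/

/-- The phase interpolating between `φ₁` on the inner and `φ₂` on the outer circle, linearly in
the logarithm of the radius. -/
noncomputable def interpPhase (R₁ R₂ : ℝ) (φ₁ φ₂ : ℝ → ℝ) (r θ : ℝ) : ℝ :=
  φ₁ θ + Real.log (r / R₁) / Real.log (R₂ / R₁) * (φ₂ θ - φ₁ θ)

/-- The angular derivative is a convex combination of those of the two boundary phases, which is why
the bound `K` holds at every radius. -/
theorem interp_isPolarPhase {K : NNReal} {φ₁ φ₂ : ℝ → ℝ} (hφ₁ : IsDescendingPhase K φ₁)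
    (hφ₂ : IsDescendingPhase K φ₂) {R₁ R₂ : ℝ} (h₁ : 0 < R₁) (h₂ : R₁ < R₂) :
    IsPolarPhase R₁ R₂ (interpPhase R₁ R₂ φ₁ φ₂)
      (fun r θ => r⁻¹ / Real.log (R₂ / R₁) * (φ₂ θ - φ₁ θ))
      (fun r θ => deriv φ₁ θ +
        Real.log (r / R₁) / Real.log (R₂ / R₁) * (deriv φ₂ θ - deriv φ₁ θ)) ∧
    ∀ r ∈ Set.Icc R₁ R₂, ∀ θ, |deriv φ₁ θ +
        Real.log (r / R₁) / Real.log (R₂ / R₁) * (deriv φ₂ θ - deriv φ₁ θ)| ≤ K := by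
  have hℓ : 0 < Real.log (R₂ / R₁) := Real.log_pos ((one_lt_div h₁).2 h₂)
  have hσ : ∀ r ∈ Set.Icc R₁ R₂, 0 ≤ Real.log (r / R₁) / Real.log (R₂ / R₁) ∧
      Real.log (r / R₁) / Real.log (R₂ / R₁) ≤ 1 := by
    intro r hr
    have h3 : 1 ≤ r / R₁ := (one_le_div h₁).2 hr.1
    refine ⟨div_nonneg (Real.log_nonneg h3) hℓ.le, (div_le_one hℓ).2 ?_⟩
    exact Real.log_le_log (by linarith) (div_le_div_of_nonneg_right hr.2 h₁.le)
  have c1 := hφ₁.lipschitz.continuous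
  have c2 := hφ₂.lipschitz.continuous
  have bθ : ∀ r ∈ Set.Icc R₁ R₂, ∀ θ, |deriv φ₁ θ +
        Real.log (r / R₁) / Real.log (R₂ / R₁) * (deriv φ₂ θ - deriv φ₁ θ)| ≤ K := by
    intro r hr θ
    obtain ⟨s0, s1⟩ := hσ r hr
    have d1 := abs_le.1 (hφ₁.abs_deriv_le θ)
    have d2 := abs_le.1 (hφ₂.abs_deriv_le θ)
    rw [abs_le]
    constructor <;> nlinarith
  refine ⟨⟨?_, ?_, ?_, ?_, ⟨K, fun r hr θ _ => bθ r hr θ⟩, ?_, ?_, ?_, ?_, ?_⟩, bθ⟩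
  · have m1 := c1.measurable
    have m2 := c2.measurable
    unfold interpPhase
    fun_prop
  · have m1 := c1.measurable
    have m2 := c2.measurable
    fun_prop
  · have m1 := measurable_deriv φ₁
    have m2 := measurable_deriv φ₂
    fun_prop
  · obtain ⟨B, hB⟩ := (isCompact_Icc (a := -Real.pi) (b := Real.pi)).exists_bound_of_continuousOn
      (c2.sub c1).continuousOn
    refine ⟨R₁⁻¹ / Real.log (R₂ / R₁) * B, fun r hr θ hθ => ?_⟩
    have hr0 : 0 < r := h₁.trans_le hr.1
    rw [abs_mul, abs_of_nonneg (by positivity)]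
    have := hB θ hθ
    have hr1 := hr.1
    rw [Real.norm_eq_abs] at this
    simp only [Pi.sub_apply] at this
    gcongr
  · intro θ r hr
    have hr0 : 0 < r := h₁.trans_le hr.1
    have hd : HasDerivAt (fun s => Real.log (s / R₁)) (r⁻¹) r := by
      have := ((hasDerivAt_id r).div_const R₁).log (by positivity : id r / R₁ ≠ 0)
      refine this.congr_deriv ?_
      simp only [id]; field_simp
    exact ((hd.div_const _).mul_const _).const_add _
  · intro θ
    have : ContinuousOn (fun r : ℝ => r⁻¹) (Set.Icc R₁ R₂) :=
      continuousOn_inv₀.mono fun r hr => (h₁.trans_le hr.1).ne'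
    fun_prop
  · intro r hr
    obtain ⟨s0, s1⟩ := hσ r hr
    have e : interpPhase R₁ R₂ φ₁ φ₂ r = fun θ => φ₁ θ +
      (Real.log (r / R₁) / Real.log (R₂ / R₁)) • (φ₂ θ - φ₁ θ) := rfl
    have := hφ₁.lipschitz.add
      ((lipschitzWith_smul (Real.log (r / R₁) / Real.log (R₂ / R₁))).comp
        (hφ₂.lipschitz.sub hφ₁.lipschitz))
    rw [e]
    exact ⟨_, this⟩
  · intro r hr
    filter_upwards [hφ₁.ae_hasDerivAt, hφ₂.ae_hasDerivAt] with θ t1 t2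
    exact t1.add ((t2.sub t1).const_mul _)
  · intro r θ
    simp only [interpPhase, hφ₁.periodic, hφ₂.periodic]
    ring

/-- Two Lipschitz data of degree `-1` on the boundary of an annulus are joined by a map whose
energy is controlled by the logarithm of the ratio of the radii. -/
theorem exists_interpolation {K : NNReal} {φ₁ φ₂ : ℝ → ℝ} (hφ₁ : IsDescendingPhase K φ₁)
    (hφ₂ : IsDescendingPhase K φ₂) {δ R₁ R₂ : ℝ} (hδ₀ : 0 ≤ δ) (hδ₁ : δ < 1) (h₁ : 0 < R₁)
    (h₂ : R₁ < R₂) :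
    ∃ u ux uy, IsUnimodularH1 R₁ R₂ u ux uy (fun θ => Complex.exp (φ₁ θ * Complex.I))
        (fun θ => Complex.exp (φ₂ θ * Complex.I)) ∧
      anisoEnergy (1 + δ) (1 - δ) (openAnnulus R₁ R₂) ux uy ≤
        2 * Real.pi * ((2 * Real.pi + 2 * K * Real.pi) ^ 2 / Real.log (R₂ / R₁) +
          K ^ 2 * Real.log (R₂ / R₁)) := by
  have hℓ : 0 < Real.log (R₂ / R₁) := Real.log_pos ((one_lt_div h₁).2 h₂)
  have hpi := Real.pi_pos
  -- Phases are only determined modulo 2π: shifting φ₂ by the nearest multiple bounds the gap at θ =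
  -- 0, and the Lipschitz bound then controls it on the whole turn, by a constant depending only on
  -- `K`.
  set k : ℤ := round ((φ₁ 0 - φ₂ 0) / (2 * Real.pi)) with hk
  set ψ : ℝ → ℝ := fun θ => φ₂ θ + k * (2 * Real.pi) with hψdef
  have hψ : IsDescendingPhase K ψ := by
    refine ⟨?_, fun θ => ?_⟩
    · refine LipschitzWith.of_dist_le_mul fun a b => ?_
      simp only [hψdef, dist_add_right]
      exact hφ₂.lipschitz.dist_le_mul a b
    · simp only [hψdef, hφ₂.periodic]; ring
  have hexp : (fun θ => Complex.exp (φ₂ θ * Complex.I)) = fun θ => Complex.exp (ψ θ * Complex.I) := by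
    ext θ
    simp only [hψdef]
    push_cast
    rw [add_mul, Complex.exp_add, mul_assoc (k : ℂ), Complex.exp_int_mul_two_pi_mul_I, mul_one]
  have h0 : |φ₁ 0 - ψ 0| ≤ 2 * Real.pi := by
    have h3 := abs_sub_round ((φ₁ 0 - φ₂ 0) / (2 * Real.pi))
    have h4 : φ₁ 0 - ψ 0 = ((φ₁ 0 - φ₂ 0) / (2 * Real.pi) - k) * (2 * Real.pi) := by
      simp only [hψdef]; field_simp; ring
    rw [h4, abs_mul, abs_of_pos (by positivity : 0 < 2 * Real.pi)]
    nlinarith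
  have hM : ∀ θ ∈ Set.Icc (-Real.pi) Real.pi, |ψ θ - φ₁ θ| ≤ 2 * Real.pi + 2 * K * Real.pi := by
    intro θ hθ
    have l1 := hφ₁.lipschitz.dist_le_mul θ 0
    have l2 := hψ.lipschitz.dist_le_mul θ 0
    have hθ' : |θ| ≤ Real.pi := abs_le.2 hθ
    simp only [Real.dist_eq, sub_zero] at l1 l2
    have hK : K * |θ| ≤ K * Real.pi := by gcongr
    rw [abs_le] at *
    constructor <;> linarith
  obtain ⟨hP, hB⟩ := interp_isPolarPhase hφ₁ hψ h₁ h₂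
  have e1 : interpPhase R₁ R₂ φ₁ ψ R₁ = φ₁ := by
    ext θ; simp [interpPhase, div_self h₁.ne']
  have e2 : interpPhase R₁ R₂ φ₁ ψ R₂ = ψ := by
    ext θ; simp [interpPhase, div_self hℓ.ne']
  have hU := hP.isUnimodularH1 h₁ h₂.le
  rw [e1, e2, ← hexp] at hU
  refine ⟨_, _, _, hU, ?_⟩
  refine (hP.anisoEnergy_le (B := ((2 * Real.pi + 2 * K * Real.pi) / Real.log (R₂ / R₁)) ^ 2 +
    K ^ 2) h₁ h₂.le hδ₀ hδ₁ fun r hr θ hθ => ?_).trans (le_of_eq ?_)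
  · have hr0 : 0 < r := h₁.trans hr.1
    have e3 : r * (r⁻¹ / Real.log (R₂ / R₁) * (ψ θ - φ₁ θ)) =
        (ψ θ - φ₁ θ) / Real.log (R₂ / R₁) := by field_simp
    rw [e3]
    refine add_le_add ?_ ?_
    · rw [← sq_abs, abs_div, abs_of_pos hℓ]
      have := hM θ hθ
      gcongr
    · rw [← sq_abs]
      have := hB r ⟨hr.1.le, hr.2.le⟩ θ
      gcongr
  · field_simp

/-- The `0`-homogeneous map with a given phase, and its energy. -/
theorem exists_homogeneous {K : NNReal} {φ : ℝ → ℝ} (hφ : IsDescendingPhase K φ) {R₁ R₂ : ℝ}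
    (h₁ : 0 < R₁) (h₂ : R₁ ≤ R₂) (K₁ K₃ : ℝ) :
    ∃ u ux uy, IsUnimodularH1 R₁ R₂ u ux uy (fun θ => Complex.exp (φ θ * Complex.I))
        (fun θ => Complex.exp (φ θ * Complex.I)) ∧
      anisoEnergy K₁ K₃ (openAnnulus R₁ R₂) ux uy = Real.log (R₂ / R₁) *
        (K₁ / 2 * (∫ θ in Set.Ioo (-Real.pi) Real.pi, (deriv φ θ * Real.cos (φ θ - θ)) ^ 2) +
          K₃ / 2 * ∫ θ in Set.Ioo (-Real.pi) Real.pi, (deriv φ θ * Real.sin (φ θ - θ)) ^ 2) ∧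
      ∀ z, z ≠ 0 → angularCurrent u ux uy z = deriv φ (Complex.arg z) := by
  refine ⟨_, _, _, (hφ.isPolarPhase R₁ R₂).isUnimodularH1 h₁ h₂, ?_, ?_⟩
  · have hu : ∀ z, (polarMap (fun _ θ => φ θ) z).re = Real.cos (φ (Complex.arg z)) ∧
        (polarMap (fun _ θ => φ θ) z).im = Real.sin (φ (Complex.arg z)) := fun z => by
      simp [polarMap, Complex.exp_ofReal_mul_I_re, Complex.exp_ofReal_mul_I_im]
    unfold anisoEnergy
    rw [mul_add, mul_left_comm, mul_left_comm (Real.log _), ← setIntegral_angular_div_norm_sq h₁ h₂,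
      ← setIntegral_angular_div_norm_sq h₁ h₂]
    congr 3
    · ext z
      simp only [polarDeriv]
      rw [div_sq_of_current, (hu z).1, (hu z).2, Real.cos_sub]
      simp only [polarGrad]
      ring
    · ext z
      simp only [polarDeriv]
      rw [curl_sq_of_current, (hu z).1, (hu z).2, Real.sin_sub]
      simp only [polarGrad]
      ring
  · intro z hz
    have hc : ∀ c s, current (polarMap fun _ θ => φ θ) (polarDeriv c s (fun _ θ => φ θ)
        (fun _ _ => 0) fun _ θ => deriv φ θ) z =
        polarGrad c s (fun _ _ => 0) (fun _ θ => deriv φ θ) z := by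
      intro c s
      have h1 : conj (polarMap (fun _ θ => φ θ) z) * polarMap (fun _ θ => φ θ) z = 1 := by
        rw [Complex.conj_mul', norm_polarMap]; simp
      rw [current, polarDeriv, mul_left_comm, h1]
      simp
    have hn : ‖z‖ ≠ 0 := norm_ne_zero_iff.2 hz
    have hx : z.re = ‖z‖ * Real.cos (Complex.arg z) := (Complex.norm_mul_cos_arg z).symm
    have hy : z.im = ‖z‖ * Real.sin (Complex.arg z) := (Complex.norm_mul_sin_arg z).symm
    rw [angularCurrent, hc, hc, hx, hy]
    simp only [polarGrad]
    field_simp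
    linear_combination (deriv φ (Complex.arg z)) * Real.sin_sq_add_cos_sq (Complex.arg z)

/-! ### The circulation seen from the degree of the trace. -/

theorem IsDescendingPhase.integral_deriv {K : NNReal} {φ : ℝ → ℝ} (h : IsDescendingPhase K φ) :
    ∫ θ in Set.Ioo (-Real.pi) Real.pi, deriv φ θ = -(2 * Real.pi) := by
  have hpi := Real.pi_pos
  rw [← integral_Ioc_eq_integral_Ioo, ← intervalIntegral.integral_of_le (by linarith),
    (h.lipschitz.lipschitzOnWith (s := Set.uIcc _ _)).absolutelyContinuousOnInterval.integral_deriv_eq_sub]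
  have := h.periodic (-Real.pi)
  rw [show -Real.pi + 2 * Real.pi = Real.pi by ring] at this
  linarith

theorem integral_mul_comp_sq {R₁ R₂ : ℝ} (h₂ : R₁ ≤ R₂) {χ : ℝ → ℝ}
    (hχ : Continuous χ) (hs : tsupport χ ⊆ Set.Ioo (R₁ ^ 2) (R₂ ^ 2)) :
    ∫ r in Set.Ioo R₁ R₂, r * χ (r ^ 2) = (∫ t, χ t) / 2 := by
  rw [← integral_Ioc_eq_integral_Ioo, ← intervalIntegral.integral_of_le h₂]
  have key := intervalIntegral.integral_comp_mul_deriv (a := R₁) (b := R₂)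
    (f := fun x : ℝ => x ^ 2) (f' := fun x => 2 * x) (g := χ)
    (fun x _ => by simpa using hasDerivAt_pow 2 x) (by fun_prop) hχ
  rw [intervalIntegral.integral_eq_integral_of_support_subset
    ((subset_tsupport χ).trans (hs.trans Set.Ioo_subset_Ioc_self))] at key
  rw [← key, ← intervalIntegral.integral_div]
  refine intervalIntegral.integral_congr fun r _ => ?_
  simp only [Function.comp]
  ring

theorem angularCurrent_glue_of_mem_left {R₁ R₂ : ℝ} {u ux uy v vx vy : ℂ → ℂ} {z : ℂ}
    (hz : z ∈ openAnnulus R₁ R₂) :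
    angularCurrent (glue R₂ u v) (glue R₂ ux vx) (glue R₂ uy vy) z = angularCurrent u ux uy z := by
  simp only [angularCurrent, current, glue_of_mem_left hz]

theorem angularCurrent_glue_of_mem_right {R₂ R₃ : ℝ} {u ux uy v vx vy : ℂ → ℂ} {z : ℂ}
    (hz : z ∈ openAnnulus R₂ R₃) :
    angularCurrent (glue R₂ u v) (glue R₂ ux vx) (glue R₂ uy vy) z = angularCurrent v vx vy z := by
  simp only [angularCurrent, current, glue_of_mem_right hz]

theorem setIntegral_radial_smul_eq {R₁ R₂ S₁ S₂ : ℝ}     (h₁ : R₁ ≤ S₁) (h₂ : S₂ ≤ R₂) {χ : ℝ → ℝ} (hs : tsupport χ ⊆ Set.Ioo (S₁ ^ 2) (S₂ ^ 2))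
    (hS₂ : 0 ≤ S₂) (p : ℂ → ℝ) :
    ∫ z in openAnnulus R₁ R₂, χ (‖z‖ ^ 2) • p z = ∫ z in openAnnulus S₁ S₂, χ (‖z‖ ^ 2) • p z := by
  refine setIntegral_eq_of_subset_of_forall_sdiff_eq_zero (measurableSet_openAnnulus _ _)
    (fun z hz => ⟨h₁.trans_lt hz.1, hz.2.trans_le h₂⟩) fun z hz => ?_
  rw [image_eq_zero_of_notMem_tsupport (f := χ) (fun h => hz.2 ?_), zero_smul]
  obtain ⟨a, b⟩ := hs h
  exact ⟨lt_of_pow_lt_pow_left₀ 2 (norm_nonneg z) a, lt_of_pow_lt_pow_left₀ 2 hS₂ b⟩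

/-- The degree of a unimodular map on the outer circle is seen by its angular current. -/
theorem IsUnimodularH1.integral_angularCurrent {R₁ R₂ : ℝ} (h₁ : 0 < R₁) (h₂ : R₁ < R₂)
    {u ux uy : ℂ → ℂ} {g : ℝ → ℂ} {K : NNReal} {φ : ℝ → ℝ} (hφ : IsDescendingPhase K φ)
    (hu : IsUnimodularH1 R₁ R₂ u ux uy g fun θ => Complex.exp (φ θ * Complex.I)) :
    ∫ z in openAnnulus R₁ R₂, (‖z‖ ^ 2)⁻¹ • angularCurrent u ux uy z =
      -(2 * Real.pi * Real.log (R₂ / R₁)) := by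
  have h0 : 0 < R₂ := h₁.trans h₂
  have h₃ : R₂ < 2 * R₂ := by linarith
  obtain ⟨v, vx, vy, hv, -, hc⟩ := exists_homogeneous hφ h0 h₃.le 0 0
  have hg := hu.glue h₂.le h₃.le hv
  -- On the glued outer annulus the map is homogeneous and its angular current is φ'(arg z), of
  -- integral -2π over a turn; the substitution t = r² halves this to -π. Constancy of the
  -- circulation carries the value into the original annulus.
  have houter : ∀ χ : ℝ → ℝ, ContDiff ℝ ∞ χ → tsupport χ ⊆ Set.Ioo (R₂ ^ 2) ((2 * R₂) ^ 2) →
      ∫ z in openAnnulus R₁ (2 * R₂), χ (‖z‖ ^ 2) •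
        angularCurrent (_root_.glue R₂ u v) (_root_.glue R₂ ux vx) (_root_.glue R₂ uy vy) z =
        (∫ t, χ t) • (-Real.pi) := by
    intro χ hχ hs
    rw [setIntegral_radial_smul_eq h₂.le le_rfl hs (by positivity),
      setIntegral_congr_fun (g := fun z => χ (‖z‖ ^ 2) * deriv φ (Complex.arg z))
        (measurableSet_openAnnulus _ _) fun z hz => ?_,
      setIntegral_openAnnulus_mul h0.le _ (fun r => χ (r ^ 2)) (deriv φ), hφ.integral_deriv,
      integral_mul_comp_sq h₃.le hχ.continuous hs]
    · rw [smul_eq_mul]; ring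
    · have hz0 : z ≠ 0 := norm_pos_iff.1 (h0.trans hz.1)
      simp only [angularCurrent_glue_of_mem_right hz, hc z hz0, smul_eq_mul]
  rw [integral_inv_norm_sq_smul h₁ h₂ (c := -Real.pi)
    (hu.isH1 h₁.le h0.le).integrable_angularCurrent]
  · rw [smul_eq_mul]; ring
  · intro χ hχ hs
    have hs' : tsupport χ ⊆ Set.Ioo (R₁ ^ 2) ((2 * R₂) ^ 2) :=
      hs.trans (Set.Ioo_subset_Ioo_right (by gcongr))
    rw [← (hg.isH1 h₁.le (by positivity)).integral_radial_mul_angularCurrent h₁.le h₂.le h₃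
      hg.norm_eq_one houter hχ hs',
      setIntegral_radial_smul_eq le_rfl h₃.le hs h0.le]
    refine setIntegral_congr_fun (measurableSet_openAnnulus _ _) fun z hz => ?_
    simp only [angularCurrent_glue_of_mem_left hz]

/-! ### The lower bound of the energy. -/

/-- Pointwise lower bound of the energy density by quantities with known integrals, multiplied
by `‖z‖ ^ 4`, in terms of the components of the phase gradient and of the field. -/
theorem energy_density_lower_aux {δ n P T κ η D : ℝ} (hδ₀ : 0 ≤ δ) (hδ₁ : δ < 1) (hn : 0 ≤ n)
    (hκ : κ ^ 2 + η ^ 2 = n) (hD : n * D = T * κ - P * η) :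
    -(1 - δ) * (n * T) + (3 / 64 * (δ * (1 - δ)) - (1 - δ) / 2) * n +
      δ * (1 - δ) / 32 * ((1 - T) * (κ ^ 2 - η ^ 2)) ≤
    (1 - δ) / 2 * (n * (P ^ 2 + T ^ 2)) + δ * (n * D) ^ 2 := by
  set Q := P ^ 2 + (T + 1) ^ 2 with hQ
  -- This is (x + y)² ≥ x²/2 - y² with x = -κ, the value of n D at T = -1, P = 0; the error y is
  -- bounded by Cauchy–Schwarz.
  have h1 : κ ^ 2 / 2 - n * Q ≤ (n * D) ^ 2 := by
    have e : n * D = -κ + ((T + 1) * κ - P * η) := by rw [hD]; ring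
    rw [e, ← hκ, hQ]
    nlinarith [sq_nonneg (κ - 2 * ((T + 1) * κ - P * η)), sq_nonneg ((T + 1) * η + P * κ)]
  -- Since |κ² - η²| ≤ n and |1 + T| ≤ ((1 + T)² + 1)/2.
  have h2 : -(n * ((1 + T) ^ 2 + 1) / 2) ≤ (κ ^ 2 - η ^ 2) * (1 + T) := by
    rw [← hκ]
    nlinarith [mul_nonneg (sq_nonneg κ) (sq_nonneg (1 + T + 1)),
      mul_nonneg (sq_nonneg η) (sq_nonneg (1 + T - 1))]
  -- Only the fraction (1 - δ)/4 of the divergence term is used, so that the resulting multiple of n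
  -- Q is absorbed by (1 - δ)/2 · n Q.
  have hs : 0 ≤ δ * (1 - δ) / 4 := by nlinarith
  have hs' : δ * (1 - δ) / 4 ≤ (1 - δ) / 4 := by nlinarith
  have h3 : δ * (1 - δ) / 4 * (n * D) ^ 2 ≤ δ * (n * D) ^ 2 := by
    have := sq_nonneg (n * D)
    nlinarith [mul_nonneg hδ₀ this]
  have h4 := mul_le_mul_of_nonneg_left h1 hs
  have h5 := mul_le_mul_of_nonneg_left h2 hs
  have hT : n * (1 + T) ^ 2 ≤ n * Q := by
    refine mul_le_mul_of_nonneg_left ?_ hn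
    rw [hQ]; nlinarith [sq_nonneg P]
  have hnQ : 0 ≤ n * (1 + T) ^ 2 := mul_nonneg hn (sq_nonneg _)
  have h6 := mul_le_mul_of_nonneg_left hT hs
  have h7 : δ * (1 - δ) / 4 * (n * Q) * (17 / 16) ≤ (1 - δ) / 2 * (n * Q) := by
    have := mul_le_mul_of_nonneg_right hs' (hnQ.trans hT)
    nlinarith [mul_nonneg hs (hnQ.trans hT)]
  have e : (1 - δ) / 2 * (n * (P ^ 2 + T ^ 2)) =
      (1 - δ) / 2 * (n * Q) - (1 - δ) / 2 * (n * (2 * T + 1)) := by rw [hQ]; ring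
  rw [e]
  -- Splitting κ² - η² as half the sum of its products with 1 - T and 1 + T gives κ²/2 ≥ 3n/16 + (1
  -- - T)(κ² - η²)/8 - n(1 + T)²/16. Times δ(1 - δ)/4 this produces 3/64 and 1/32, and the last term
  -- raises the factor of n Q to 17/16.
  have hκ' : κ ^ 2 = (n + (κ ^ 2 - η ^ 2)) / 2 := by linarith
  nlinarith

/-- With κ and η the real and imaginary parts of conj z · u, and P, T the radial and angular
components of |z|∇Φ, the quantity κ² - η² is the real part of conj z² u². Hence all terms on the
left have known integrals: a circulation, a power of |z| and a Fourier mode. -/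
theorem energy_density_lower {δ a b : ℝ} {u z : ℂ} (hδ₀ : 0 ≤ δ) (hδ₁ : δ < 1) (hu : ‖u‖ = 1)
    (hz : z ≠ 0) :
    -(1 - δ) * ((‖z‖ ^ 2)⁻¹ * (z.re * b - z.im * a)) +
        (3 / 64 * (δ * (1 - δ)) - (1 - δ) / 2) * (‖z‖ ^ 2)⁻¹ +
        δ * (1 - δ) / 32 * ((‖z‖ ^ 2)⁻¹ * ((‖z‖ ^ 2)⁻¹ *
          (conj z ^ 2 * u ^ 2 * (1 - (z.re * b - z.im * a : ℝ))).re)) ≤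
      (1 + δ) / 2 * (b * u.re - a * u.im) ^ 2 + (1 - δ) / 2 * (a * u.re + b * u.im) ^ 2 := by
  have hn : 0 < ‖z‖ ^ 2 := by positivity
  have hn' : ‖z‖ ^ 2 = z.re ^ 2 + z.im ^ 2 := by
    rw [← Complex.normSq_eq_norm_sq, Complex.normSq_apply]; ring
  have hu' : u.re ^ 2 + u.im ^ 2 = 1 := by
    have := Complex.normSq_eq_norm_sq u
    rw [Complex.normSq_apply, hu] at this
    linarith
  set n := ‖z‖ ^ 2 with hndef
  have key := energy_density_lower_aux (n := n) (P := z.re * a + z.im * b)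
    (T := z.re * b - z.im * a) (κ := u.re * z.re + u.im * z.im) (η := u.im * z.re - u.re * z.im)
    (D := b * u.re - a * u.im) hδ₀ hδ₁ hn.le
    (by rw [hn']; linear_combination (z.re ^ 2 + z.im ^ 2) * hu') (by rw [hn']; ring)
  have e1 : (z.re * a + z.im * b) ^ 2 + (z.re * b - z.im * a) ^ 2 =
      n * ((b * u.re - a * u.im) ^ 2 + (a * u.re + b * u.im) ^ 2) := by
    rw [hn']; linear_combination -(z.re ^ 2 + z.im ^ 2) * (a ^ 2 + b ^ 2) * hu'
  have e2 : (conj z ^ 2 * u ^ 2 * (1 - (z.re * b - z.im * a : ℝ))).re =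
      (1 - (z.re * b - z.im * a)) *
        ((u.re * z.re + u.im * z.im) ^ 2 - (u.im * z.re - u.re * z.im) ^ 2) := by
    have : (1 - ((z.re * b - z.im * a : ℝ) : ℂ)) = ((1 - (z.re * b - z.im * a) : ℝ) : ℂ) := by
      push_cast; ring
    rw [this, Complex.re_mul_ofReal]
    simp only [pow_two, Complex.mul_re, Complex.mul_im, Complex.conj_re, Complex.conj_im]
    ring
  rw [e1] at key
  rw [e2]
  refine le_of_mul_le_mul_left (a := n ^ 2) ?_ (by positivity)
  refine (Eq.trans_le ?_ key).trans_eq ?_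
  · field_simp
  · ring

/-- The lower bound of the energy, with a gain when `δ > 0`. -/
theorem IsUnimodularH1.anisoEnergy_ge {R₁ R₂ δ : ℝ} (hδ₀ : 0 ≤ δ) (hδ₁ : δ < 1) (h₁ : 0 < R₁)
    (h₂ : R₁ < R₂) {u ux uy : ℂ → ℂ} {g : ℝ → ℂ} {K : NNReal} {φ : ℝ → ℝ}
    (hφ : IsDescendingPhase K φ)
    (hu : IsUnimodularH1 R₁ R₂ u ux uy g fun θ => Complex.exp (φ θ * Complex.I)) :
    ((1 - δ) * Real.pi + 3 / 32 * (δ * (1 - δ)) * Real.pi) * Real.log (R₂ / R₁) ≤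
      anisoEnergy (1 + δ) (1 - δ) (openAnnulus R₁ R₂) ux uy := by
  have h0 : 0 < R₂ := h₁.trans h₂
  have hH := hu.isH1 h₁.le h0.le
  have hU := isOpen_openAnnulus R₁ R₂
  have hx := hH.weak_x.eq_current_mul hU hH.memLp hH.memLp_x hu.norm_eq_one
  have hy := hH.weak_y.eq_current_mul hU hH.memLp hH.memLp_y hu.norm_eq_one
  have iT := integrable_norm_rpow_smul h₁ hH.integrable_angularCurrent
  have i1 := integrableOn_inv_norm_sq h₁ R₂
  have hintF := hH.integrableOn_fourier_mode hu.norm_eq_one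
  have iF := integrable_norm_rpow_smul h₁ (integrable_norm_rpow_smul h₁ hintF)
  have iF' : IntegrableOn (fun z => ((‖z‖ ^ 2)⁻¹ • (‖z‖ ^ 2)⁻¹ •
      (conj z ^ 2 * u z ^ 2 * (1 - angularCurrent u ux uy z : ℂ))).re) (openAnnulus R₁ R₂) := iF.re
  have eT := hu.integral_angularCurrent h₁ h₂ hφ
  have e1 := setIntegral_inv_norm_sq h₁ h₂.le
  have eF : ∫ z in openAnnulus R₁ R₂, ((‖z‖ ^ 2)⁻¹ • (‖z‖ ^ 2)⁻¹ •
      (conj z ^ 2 * u z ^ 2 * (1 - angularCurrent u ux uy z : ℂ))).re = 0 := by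
    have := integral_re iF
    have e := hH.integral_fourier_mode h₁ h₂ hu.norm_eq_one
    rw [e] at this
    simpa using this
  have hle : ∫ z in openAnnulus R₁ R₂,
      (-(1 - δ) * ((‖z‖ ^ 2)⁻¹ • angularCurrent u ux uy z) +
        (3 / 64 * (δ * (1 - δ)) - (1 - δ) / 2) * (‖z‖ ^ 2)⁻¹ +
        δ * (1 - δ) / 32 * ((‖z‖ ^ 2)⁻¹ • (‖z‖ ^ 2)⁻¹ •
      (conj z ^ 2 * u z ^ 2 * (1 - angularCurrent u ux uy z : ℂ))).re) ≤
      ∫ z in openAnnulus R₁ R₂, ((1 + δ) / 2 * ((ux z).re + (uy z).im) ^ 2 +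
        (1 - δ) / 2 * ((ux z).im - (uy z).re) ^ 2) := by
    refine integral_mono_ae (((iT.const_mul _).add (i1.const_mul _)).add (iF.re.const_mul _))
      (((MemLp.integrable_div_sq hu.memLp_x hu.memLp_y).const_mul _).add
        ((MemLp.integrable_curl_sq hu.memLp_x hu.memLp_y).const_mul _)) ?_
    filter_upwards [hx, hy, hu.norm_eq_one, ae_restrict_mem (measurableSet_openAnnulus _ _)]
      with z hx hy hz1 hz
    have hz0 : z ≠ 0 := norm_pos_iff.1 (h₁.trans hz.1)
    rw [hx, hy, div_sq_of_current, curl_sq_of_current]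
    have := energy_density_lower (a := current u ux z) (b := current u uy z) hδ₀ hδ₁ hz1 hz0
    rw [Complex.smul_re, Complex.smul_re, smul_eq_mul, smul_eq_mul, smul_eq_mul]
    exact this
  have hlin : ∀ f₁ f₂ f₃ : ℂ → ℝ, ∀ c₁ c₂ c₃ : ℝ, IntegrableOn f₁ (openAnnulus R₁ R₂) →
      IntegrableOn f₂ (openAnnulus R₁ R₂) → IntegrableOn f₃ (openAnnulus R₁ R₂) →
      ∫ z in openAnnulus R₁ R₂, (c₁ * f₁ z + c₂ * f₂ z + c₃ * f₃ z) =
        c₁ * (∫ z in openAnnulus R₁ R₂, f₁ z) + c₂ * (∫ z in openAnnulus R₁ R₂, f₂ z) +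
          c₃ * ∫ z in openAnnulus R₁ R₂, f₃ z := by
    intro f₁ f₂ f₃ c₁ c₂ c₃ i₁ i₂ i₃
    rw [integral_add (f := fun z => c₁ * f₁ z + c₂ * f₂ z)
      ((i₁.const_mul _).add (i₂.const_mul _)) (i₃.const_mul _),
      integral_add (i₁.const_mul _) (i₂.const_mul _), integral_const_mul, integral_const_mul,
      integral_const_mul]
  -- Per unit of ln(R₂/R₁) the circulation contributes 2(1 - δ)π and the middle term -(1 - δ)π +
  -- (3/32)δ(1 - δ)π; the Fourier mode contributes nothing.
  rw [hlin _ _ _ _ _ _ iT i1 iF', eT, e1, eF,integral_add ((MemLp.integrable_div_sq hu.memLp_x hu.memLp_y).const_mul _)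
        ((MemLp.integrable_curl_sq hu.memLp_x hu.memLp_y).const_mul _), integral_const_mul,
    integral_const_mul] at hle
  unfold anisoEnergy
  refine le_trans (le_of_eq ?_) hle
  ring

/-! ### A competitor of energy below π ln(R₂/R₁). -/

/-- Second-order expansion of the cosine with a uniform remainder. -/
theorem cos_sub_le {x y : ℝ} (hy : |y| ≤ 1) :
    |Real.cos (x - y) - (Real.cos x + y * Real.sin x)| ≤ y ^ 2 := by
  have e : Real.cos (x - y) - (Real.cos x + y * Real.sin x) =
      Real.cos x * (Real.cos y - 1) + Real.sin x * (Real.sin y - y) := by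
    rw [Real.cos_sub]; ring
  have hy2 : |y| ^ 2 = y ^ 2 := sq_abs y
  have h0 := abs_nonneg y
  have h1 : |Real.cos y - 1| ≤ y ^ 2 / 2 := by
    rw [abs_sub_comm, abs_of_nonneg (by linarith [Real.cos_le_one y])]
    linarith [Real.one_sub_sq_div_two_le_cos (x := y)]
  have h2 : |Real.sin y - y| ≤ y ^ 2 / 2 := by
    have := Real.sin_bound hy
    have h3 : |Real.sin y - y| ≤ |Real.sin y - (y - y ^ 3 / 6)| + |y| ^ 3 / 6 := by
      have h4 : Real.sin y - y = (Real.sin y - (y - y ^ 3 / 6)) + -(y ^ 3 / 6) := by ring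
      rw [h4]
      refine (abs_add_le _ _).trans (le_of_eq ?_)
      rw [abs_neg, abs_div, abs_pow, abs_of_pos (by norm_num : (0 : ℝ) < 6)]
    have h5 : |y| ^ 3 ≤ |y| ^ 2 := pow_le_pow_of_le_one h0 hy (by norm_num)
    have h6 : |y| ^ 5 ≤ |y| ^ 2 := pow_le_pow_of_le_one h0 hy (by norm_num)
    nlinarith
  rw [e]
  refine (abs_add_le _ _).trans ?_
  rw [abs_mul, abs_mul]
  have h3 := mul_le_mul (Real.abs_cos_le_one x) h1 (abs_nonneg _) zero_le_one
  have h4 := mul_le_mul (Real.abs_sin_le_one x) h2 (abs_nonneg _) zero_le_one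
  linarith

/-- The phase `-θ`, perturbed by a fourth harmonic. -/
noncomputable def wavyPhase (ε θ : ℝ) : ℝ := -θ + ε * Real.sin (4 * θ)

theorem hasDerivAt_wavyPhase (ε θ : ℝ) :
    HasDerivAt (wavyPhase ε) (-1 + 4 * ε * Real.cos (4 * θ)) θ := by
  have h := (hasDerivAt_id θ).neg.add ((((hasDerivAt_id θ).const_mul 4).sin).const_mul ε)
  refine h.congr_deriv ?_
  simp only [id]; ring

theorem isDescendingPhase_wavyPhase {ε : ℝ} (hε : 0 ≤ ε) :
    IsDescendingPhase (1 + 4 * ε).toNNReal (wavyPhase ε) := by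
  refine ⟨lipschitzWith_of_nnnorm_deriv_le
    (fun θ => (hasDerivAt_wavyPhase ε θ).differentiableAt) fun θ => ?_, fun θ => ?_⟩
  · rw [(hasDerivAt_wavyPhase ε θ).deriv, ← NNReal.coe_le_coe, coe_nnnorm, Real.norm_eq_abs,
      Real.coe_toNNReal _ (by positivity)]
    have h1 := Real.cos_le_one (4 * θ)
    have h2 := Real.neg_one_le_cos (4 * θ)
    rw [abs_le]
    constructor <;> nlinarith
  · have : 4 * (θ + 2 * Real.pi) = 4 * θ + (4 : ℕ) * (2 * Real.pi) := by push_cast; ring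
    rw [wavyPhase, wavyPhase, this, Real.sin_add_nat_mul_two_pi]; ring

/-- Here c and s stand for cos 4θ and sin 4θ, and e for the error in the expansion of the cosine.
The second-order remainders are at most 32ε², 24ε² and 4ε², so 102 leaves room. -/
theorem wavyPhase_density_aux {δ ε c s e : ℝ} (hδ₀ : 0 ≤ δ) (hδ₁ : δ < 1) (hε₀ : 0 ≤ ε)
    (hε₁ : ε ≤ 1 / 4) (hcs : s ^ 2 + c ^ 2 = 1) (he : |e| ≤ 4 * ε ^ 2)
    (hw : |c + 2 * ε * s ^ 2 + e| ≤ 1) :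
    (-1 + 4 * ε * c) ^ 2 * (1 + δ * (c + 2 * ε * s ^ 2 + e)) ≤
      1 - 8 * ε * c + δ * c + 2 * δ * ε * s ^ 2 - 8 * ε * δ * c ^ 2 + 102 * ε ^ 2 := by
  have hs2 : s ^ 2 ≤ 1 := by linarith [sq_nonneg c]
  have hc2 : c ^ 2 ≤ 1 := by linarith [sq_nonneg s]
  have hc1 : |c| ≤ 1 := abs_le_one_iff_mul_self_le_one.2 (by linarith [sq c])
  have hε2 := sq_nonneg ε
  have hεε : ε ^ 2 ≤ ε / 4 := by nlinarith
  have h0 : |2 * ε * s ^ 2 + e| ≤ 3 * ε := by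
    refine (abs_add_le _ _).trans ?_
    rw [abs_of_nonneg (by positivity : 0 ≤ 2 * ε * s ^ 2)]
    have := mul_le_mul_of_nonneg_left hs2 (by positivity : 0 ≤ 2 * ε)
    linarith
  have hce : |c * (2 * ε * s ^ 2 + e)| ≤ 3 * ε := by
    rw [abs_mul]
    have := mul_le_mul hc1 h0 (abs_nonneg _) zero_le_one
    linarith
  have hδw : δ * (c + 2 * ε * s ^ 2 + e) ≤ 1 := by
    have := mul_le_mul_of_nonneg_left (abs_le.1 hw).2 hδ₀
    linarith
  have h1 : 16 * ε ^ 2 * c ^ 2 * (1 + δ * (c + 2 * ε * s ^ 2 + e)) ≤ 16 * ε ^ 2 * 1 * 2 := by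
    have h3 : 16 * ε ^ 2 * c ^ 2 ≤ 16 * ε ^ 2 * 1 := by gcongr
    have h4 := mul_le_mul_of_nonneg_left (abs_le.1 hw).1 hδ₀
    exact mul_le_mul h3 (by linarith) (by linarith) (by positivity)
  have h2 : 8 * ε * δ * -(c * (2 * ε * s ^ 2 + e)) ≤ 24 * ε ^ 2 := by
    have h3 := mul_le_mul_of_nonneg_left (neg_le.1 (abs_le.1 hce).1)
      (by positivity : 0 ≤ 8 * ε * δ)
    have h4 := mul_le_mul_of_nonneg_right hδ₁.le hε2
    linarith
  have h3 : δ * e ≤ 4 * ε ^ 2 := by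
    have h4 := mul_le_mul_of_nonneg_left ((le_abs_self e).trans he) hδ₀
    have h5 := mul_le_mul_of_nonneg_right hδ₁.le hε2
    linarith
  have key : (-1 + 4 * ε * c) ^ 2 * (1 + δ * (c + 2 * ε * s ^ 2 + e)) =
      1 - 8 * ε * c + δ * c + 2 * δ * ε * s ^ 2 - 8 * ε * δ * c ^ 2 + δ * e +
      8 * ε * δ * -(c * (2 * ε * s ^ 2 + e)) +
      16 * ε ^ 2 * c ^ 2 * (1 + δ * (c + 2 * ε * s ^ 2 + e)) := by ring
  rw [key]
  linarith

/-- The density is φ'² (1 + δ cos 2(φ - θ))/2, and at φ = -θ the cosine is cos 4θ; this is the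
harmonic to correlate with. The term -8ε cos 4θ of φ'² against δ cos 4θ has mean -4δε, while the
change 2ε sin² 4θ of the cosine costs δε, leaving -3δε. -/
theorem wavyPhase_density_le {δ ε : ℝ} (hδ₀ : 0 ≤ δ) (hδ₁ : δ < 1) (hε₀ : 0 ≤ ε)
    (hε₁ : ε ≤ 1 / 4) (θ : ℝ) :
    (1 + δ) / 2 * ((-1 + 4 * ε * Real.cos (4 * θ)) * Real.cos (wavyPhase ε θ - θ)) ^ 2 +
        (1 - δ) / 2 * ((-1 + 4 * ε * Real.cos (4 * θ)) * Real.sin (wavyPhase ε θ - θ)) ^ 2 ≤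
      (1 - 3 * δ * ε + 102 * ε ^ 2) / 2 + (δ - 8 * ε) / 2 * Real.cos (4 * θ) -
        5 * δ * ε / 2 * Real.cos (8 * θ) := by
  have hcs := Real.sin_sq_add_cos_sq (4 * θ)
  have hs1 := Real.abs_sin_le_one (4 * θ)
  have h8 : Real.cos (8 * θ) = 2 * Real.cos (4 * θ) ^ 2 - 1 := by
    rw [show 8 * θ = 2 * (4 * θ) by ring, Real.cos_two_mul]
  have hB : |2 * ε * Real.sin (4 * θ)| ≤ 2 * ε := by
    rw [abs_mul, abs_of_nonneg (by positivity)]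
    exact mul_le_of_le_one_right (by positivity) hs1
  have hw : Real.cos (2 * (wavyPhase ε θ - θ)) =
      Real.cos (4 * θ - 2 * ε * Real.sin (4 * θ)) := by
    rw [← Real.cos_neg, wavyPhase]
    congr 1
    ring
  have he := cos_sub_le (x := 4 * θ) (hB.trans (by linarith))
  have he' : (2 * ε * Real.sin (4 * θ)) ^ 2 ≤ 4 * ε ^ 2 := by
    rw [← sq_abs]
    exact (pow_le_pow_left₀ (abs_nonneg _) hB 2).trans_eq (by ring)
  have hw1 := Real.abs_cos_le_one (2 * (wavyPhase ε θ - θ))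
  have hcos : Real.cos (wavyPhase ε θ - θ) ^ 2 = (1 + Real.cos (2 * (wavyPhase ε θ - θ))) / 2 := by
    rw [Real.cos_two_mul]; ring
  have hsin : Real.sin (wavyPhase ε θ - θ) ^ 2 = (1 - Real.cos (2 * (wavyPhase ε θ - θ))) / 2 := by
    rw [Real.sin_sq, hcos]; ring
  rw [mul_pow, mul_pow, hcos, hsin, h8]
  rw [← hw] at he
  generalize Real.cos (2 * (wavyPhase ε θ - θ)) = w at *
  generalize Real.cos (4 * θ) = c at *
  generalize Real.sin (4 * θ) = s at *
  obtain ⟨e, rfl⟩ : ∃ e, w = c + 2 * ε * s ^ 2 + e := ⟨w - (c + 2 * ε * s ^ 2), by ring⟩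
  have key := wavyPhase_density_aux (e := e) hδ₀ hδ₁ hε₀ hε₁ hcs
    (by rw [show c + 2 * ε * s ^ 2 + e - (c + 2 * ε * s * s) = e by ring] at he
        exact he.trans he') hw1
  have hs3 : s ^ 2 = 1 - c ^ 2 := by linarith
  have hlin : ∀ x w : ℝ, (1 + δ) / 2 * (x * ((1 + w) / 2)) + (1 - δ) / 2 * (x * ((1 - w) / 2)) =
      x * (1 + δ * w) / 2 := fun x w => by ring
  rw [hlin]
  have : 2 * δ * ε * s ^ 2 = 2 * δ * ε * (1 - c ^ 2) := by rw [hs3]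
  linarith

theorem integral_cos_nat_mul {n : ℕ} (hn : n ≠ 0) :
    ∫ θ in (-Real.pi)..Real.pi, Real.cos (n * θ) = 0 := by
  have hn' : (n : ℝ) ≠ 0 := by exact_mod_cast hn
  rw [intervalIntegral.integral_comp_mul_left (fun x => Real.cos x) hn', integral_cos, mul_neg,
    Real.sin_neg, Real.sin_nat_mul_pi]
  simp

/-- An explicit competitor with low energy. -/
theorem exists_wavy_competitor {δ ε R₁ R₂ : ℝ} (hδ₀ : 0 ≤ δ) (hδ₁ : δ < 1) (hε₀ : 0 ≤ ε)
    (hε₁ : ε ≤ 1 / 4) (h₁ : 0 < R₁) (h₂ : R₁ ≤ R₂) :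
    ∃ u ux uy, IsCompetitor R₁ R₂ (1 + 4 * ε) u ux uy ∧
      anisoEnergy (1 + δ) (1 - δ) (openAnnulus R₁ R₂) ux uy ≤
        Real.pi * (1 - 3 * δ * ε + 102 * ε ^ 2) * Real.log (R₂ / R₁) := by
  have hφ := isDescendingPhase_wavyPhase hε₀
  obtain ⟨u, ux, uy, hu, hE, -⟩ := exists_homogeneous hφ h₁ h₂ (1 + δ) (1 - δ)
  have hb := hφ.isBoundaryDatum (C := 1 + 4 * ε)
    (Real.coe_toNNReal _ (by positivity)).le
  refine ⟨u, ux, uy, hu.isCompetitor h₁.le (h₁.le.trans h₂) hb hb, ?_⟩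
  have hℓ : 0 ≤ Real.log (R₂ / R₁) := Real.log_nonneg ((one_le_div h₁).2 h₂)
  rw [hE, mul_comm]
  refine mul_le_mul_of_nonneg_right ?_ hℓ
  have hpi : -Real.pi ≤ Real.pi := by linarith [Real.pi_pos]
  have hd : deriv (wavyPhase ε) = fun θ => -1 + 4 * ε * Real.cos (4 * θ) :=
    funext fun θ => (hasDerivAt_wavyPhase ε θ).deriv
  have hcont : Continuous (wavyPhase ε) := hφ.lipschitz.continuous
  simp only [hd, ← integral_Ioc_eq_integral_Ioo, ← intervalIntegral.integral_of_le hpi]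
  rw [← intervalIntegral.integral_const_mul, ← intervalIntegral.integral_const_mul,
    ← intervalIntegral.integral_add (Continuous.intervalIntegrable (by fun_prop) _ _)
      (Continuous.intervalIntegrable (by fun_prop) _ _)]
  refine (intervalIntegral.integral_mono_on hpi (Continuous.intervalIntegrable (by fun_prop) _ _)
    (Continuous.intervalIntegrable (by fun_prop) _ _)
    fun θ _ => wavyPhase_density_le hδ₀ hδ₁ hε₀ hε₁ θ).trans_eq ?_
  have i4 := integral_cos_nat_mul (n := 4) (by norm_num)
  have i8 := integral_cos_nat_mul (n := 8) (by norm_num)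
  push_cast at i4 i8
  rw [intervalIntegral.integral_sub (Continuous.intervalIntegrable (by fun_prop) _ _)
      (Continuous.intervalIntegrable (by fun_prop) _ _),
    intervalIntegral.integral_add (Continuous.intervalIntegrable (by fun_prop) _ _)
      (Continuous.intervalIntegrable (by fun_prop) _ _),
    intervalIntegral.integral_const_mul, intervalIntegral.integral_const_mul, i4, i8,
    intervalIntegral.integral_const, smul_eq_mul]
  ring

/-! ### Elementary properties and bounds of the minimal energy. -/

theorem anisoEnergy_nonneg {δ : ℝ} (hδ₀ : 0 ≤ δ) (hδ₁ : δ < 1) (U : Set ℂ) (ux uy : ℂ → ℂ) :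
    0 ≤ anisoEnergy (1 + δ) (1 - δ) U ux uy :=
  add_nonneg (mul_nonneg (by linarith) (integral_nonneg fun _ => sq_nonneg _))
    (mul_nonneg (by linarith) (integral_nonneg fun _ => sq_nonneg _))

theorem bddBelow_competitorEnergies {δ : ℝ} (hδ₀ : 0 ≤ δ) (hδ₁ : δ < 1) (R₁ R₂ C : ℝ) :
    BddBelow (competitorEnergies δ R₁ R₂ C) := by
  refine ⟨0, ?_⟩
  rintro _ ⟨u, ux, uy, -, rfl⟩
  exact anisoEnergy_nonneg hδ₀ hδ₁ _ _ _

theorem minEnergy_le {δ R₁ R₂ C : ℝ} (hδ₀ : 0 ≤ δ) (hδ₁ : δ < 1) {u ux uy : ℂ → ℂ}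
    (h : IsCompetitor R₁ R₂ C u ux uy) :
    minEnergy δ R₁ R₂ C ≤ anisoEnergy (1 + δ) (1 - δ) (openAnnulus R₁ R₂) ux uy :=
  csInf_le (bddBelow_competitorEnergies hδ₀ hδ₁ _ _ _) ⟨u, ux, uy, h, rfl⟩

theorem IsBoundaryDatum.mono {C C' : ℝ} (h : C ≤ C') {g : ℝ → ℂ} (hg : IsBoundaryDatum C g) :
    IsBoundaryDatum C' g :=
  ⟨fun θ θ' => (hg.1 θ θ').trans (mul_le_mul_of_nonneg_right h (abs_nonneg _)), hg.2⟩

theorem IsCompetitor.mono {R₁ R₂ C C' : ℝ} (h : C ≤ C') {u ux uy : ℂ → ℂ}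
    (hu : IsCompetitor R₁ R₂ C u ux uy) : IsCompetitor R₁ R₂ C' u ux uy := by
  obtain ⟨h1, h2, g₁, g₂, h3, h4, h5⟩ := hu
  exact ⟨h1, h2, g₁, g₂, h3, h4.mono h, h5.mono h⟩

theorem competitorEnergies_nonempty {δ R₁ R₂ C : ℝ} (hδ₀ : 0 ≤ δ) (hδ₁ : δ < 1) (hC : 1 ≤ C)
    (h₁ : 0 < R₁) (h₂ : R₁ ≤ R₂) : (competitorEnergies δ R₁ R₂ C).Nonempty := by
  obtain ⟨u, ux, uy, hu, -⟩ := exists_wavy_competitor hδ₀ hδ₁ le_rfl (by norm_num) h₁ h₂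
  exact ⟨_, u, ux, uy, hu.mono (by linarith), rfl⟩

theorem le_minEnergy {δ R₁ R₂ C m : ℝ} (hδ₀ : 0 ≤ δ) (hδ₁ : δ < 1) (hC : 1 ≤ C)
    (h₁ : 0 < R₁) (h₂ : R₁ ≤ R₂) (h : ∀ u ux uy, IsCompetitor R₁ R₂ C u ux uy →
      m ≤ anisoEnergy (1 + δ) (1 - δ) (openAnnulus R₁ R₂) ux uy) : m ≤ minEnergy δ R₁ R₂ C := by
  refine le_csInf (competitorEnergies_nonempty hδ₀ hδ₁ hC h₁ h₂) ?_
  rintro _ ⟨u, ux, uy, hu, rfl⟩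
  exact h u ux uy hu

theorem minEnergy_nonneg {δ : ℝ} (hδ₀ : 0 ≤ δ) (hδ₁ : δ < 1) (R₁ R₂ C : ℝ) :
    0 ≤ minEnergy δ R₁ R₂ C := by
  refine Real.sInf_nonneg ?_
  rintro _ ⟨u, ux, uy, -, rfl⟩
  exact anisoEnergy_nonneg hδ₀ hδ₁ _ _ _

theorem minEnergy_le_wavy {δ ε R₁ R₂ C : ℝ} (hδ₀ : 0 ≤ δ) (hδ₁ : δ < 1) (hε₀ : 0 ≤ ε)
    (hε₁ : ε ≤ 1 / 4) (hC : 1 + 4 * ε ≤ C) (h₁ : 0 < R₁) (h₂ : R₁ ≤ R₂) :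
    minEnergy δ R₁ R₂ C ≤
      Real.pi * (1 - 3 * δ * ε + 102 * ε ^ 2) * Real.log (R₂ / R₁) := by
  obtain ⟨u, ux, uy, hu, hE⟩ := exists_wavy_competitor hδ₀ hδ₁ hε₀ hε₁ h₁ h₂
  exact (minEnergy_le hδ₀ hδ₁ (hu.mono hC)).trans hE

theorem minEnergy_ge {δ R₁ R₂ C : ℝ} (hδ₀ : 0 ≤ δ) (hδ₁ : δ < 1) (hC : 1 ≤ C) (h₁ : 0 < R₁)
    (h₂ : R₁ ≤ R₂) :
    ((1 - δ) * Real.pi + 3 / 32 * (δ * (1 - δ)) * Real.pi) * Real.log (R₂ / R₁) ≤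
      minEnergy δ R₁ R₂ C := by
  rcases h₂.eq_or_lt with rfl | h
  · rw [div_self h₁.ne', Real.log_one, mul_zero]
    exact minEnergy_nonneg hδ₀ hδ₁ _ _ _
  · refine le_minEnergy hδ₀ hδ₁ hC h₁ h₂ fun u ux uy hu => ?_
    obtain ⟨g₁, g₂, hu', -, hg⟩ := hu.exists_isUnimodularH1
    obtain ⟨φ, hφ, rfl⟩ := hg.exists_phase hC
    exact hu'.anisoEnergy_ge hδ₀ hδ₁ h₁ h hφ

/-! ### Joining annuli and changing the boundary bound. -/

/-- Maps on two concentric annuli extend to the annulus between them, at a controlled cost. -/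
theorem IsUnimodularH1.exists_join {δ R₁ R₂ R₃ R₄ : ℝ} (hδ₀ : 0 ≤ δ) (hδ₁ : δ < 1)
    (h₁ : 0 < R₁) (h₂ : R₁ ≤ R₂) (h₃ : R₂ < R₃) (h₄ : R₃ ≤ R₄) {K : NNReal} {φ₁ φ₂ : ℝ → ℝ}
    (hφ₁ : IsDescendingPhase K φ₁) (hφ₂ : IsDescendingPhase K φ₂)
    {u ux uy v vx vy : ℂ → ℂ} {g₁ g₂ : ℝ → ℂ}
    (hu : IsUnimodularH1 R₁ R₂ u ux uy g₁ fun θ => Complex.exp (φ₁ θ * Complex.I))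
    (hv : IsUnimodularH1 R₃ R₄ v vx vy (fun θ => Complex.exp (φ₂ θ * Complex.I)) g₂) :
    ∃ w wx wy, IsUnimodularH1 R₁ R₄ w wx wy g₁ g₂ ∧
      anisoEnergy (1 + δ) (1 - δ) (openAnnulus R₁ R₄) wx wy ≤
        anisoEnergy (1 + δ) (1 - δ) (openAnnulus R₁ R₂) ux uy +
        anisoEnergy (1 + δ) (1 - δ) (openAnnulus R₃ R₄) vx vy +
        2 * Real.pi * ((2 * Real.pi + 2 * K * Real.pi) ^ 2 / Real.log (R₃ / R₂) +
          K ^ 2 * Real.log (R₃ / R₂)) := by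
  obtain ⟨m, mx, my, hm, hE⟩ := exists_interpolation hφ₁ hφ₂ hδ₀ hδ₁ (h₁.trans_le h₂) h₃
  have h13 : R₁ ≤ R₃ := h₂.trans h₃.le
  have hum := hu.glue h₂ h₃.le hm
  refine ⟨_, _, _, hum.glue h13 h₄ hv, ?_⟩
  rw [anisoEnergy_glue h13 h₄ _ _ hum hv, anisoEnergy_glue h₂ h₃.le _ _ hu hm]
  linarith

theorem IsDescendingPhase.mono {K K' : NNReal} {φ : ℝ → ℝ} (h : IsDescendingPhase K φ)
    (hK : K ≤ K') : IsDescendingPhase K' φ := ⟨h.lipschitz.weaken hK, h.periodic⟩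

/-- The two competitors vary independently, and the infimum is taken in each. The traces facing the
gap have 2C-Lipschitz phases and are interpolated; the outermost traces are untouched, so the bound
C survives. -/
theorem minEnergy_almost_subadditive {δ C R₁ R₂ R₃ R₄ : ℝ} (hδ₀ : 0 ≤ δ) (hδ₁ : δ < 1)
    (hC : 1 ≤ C) (h₁ : 0 < R₁) (h₂ : R₁ ≤ R₂) (h₃ : R₂ < R₃) (h₄ : R₃ ≤ R₄) :
    minEnergy δ R₁ R₄ C ≤ minEnergy δ R₁ R₂ C + minEnergy δ R₃ R₄ C +
      2 * Real.pi * ((2 * Real.pi + 2 * (2 * C) * Real.pi) ^ 2 / Real.log (R₃ / R₂) +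
        (2 * C) ^ 2 * Real.log (R₃ / R₂)) := by
  have h0 : 0 < R₃ := (h₁.trans_le h₂).trans h₃
  have hK : ((2 * C).toNNReal : ℝ) = 2 * C := Real.coe_toNNReal _ (by linarith)
  set B := 2 * Real.pi * ((2 * Real.pi + 2 * (2 * C) * Real.pi) ^ 2 / Real.log (R₃ / R₂) +
        (2 * C) ^ 2 * Real.log (R₃ / R₂)) with hB
  have key : ∀ u ux uy, IsCompetitor R₁ R₂ C u ux uy → ∀ v vx vy, IsCompetitor R₃ R₄ C v vx vy →
      minEnergy δ R₁ R₄ C ≤ anisoEnergy (1 + δ) (1 - δ) (openAnnulus R₁ R₂) ux uy +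
        anisoEnergy (1 + δ) (1 - δ) (openAnnulus R₃ R₄) vx vy + B := by
    intro u ux uy hu v vx vy hv
    obtain ⟨g₁, g₂, hu, hg₁, hg₂⟩ := hu.exists_isUnimodularH1
    obtain ⟨g₃, g₄, hv, hg₃, hg₄⟩ := hv.exists_isUnimodularH1
    obtain ⟨φ₂, hφ₂, rfl⟩ := hg₂.exists_phase hC
    obtain ⟨φ₃, hφ₃, rfl⟩ := hg₃.exists_phase hC
    obtain ⟨w, wx, wy, hw, hE⟩ := hu.exists_join hδ₀ hδ₁ h₁ h₂ h₃ h₄ hφ₂ hφ₃ hv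
    rw [hK, ← hB] at hE
    exact (minEnergy_le hδ₀ hδ₁ (hw.isCompetitor h₁.le (h0.le.trans h₄) hg₁ hg₄)).trans hE
  have h5 : minEnergy δ R₁ R₄ C - minEnergy δ R₃ R₄ C - B ≤ minEnergy δ R₁ R₂ C := by
    refine le_minEnergy hδ₀ hδ₁ hC h₁ h₂ fun u ux uy hu => ?_
    have : minEnergy δ R₁ R₄ C - anisoEnergy (1 + δ) (1 - δ) (openAnnulus R₁ R₂) ux uy - B ≤
        minEnergy δ R₃ R₄ C := by
      refine le_minEnergy hδ₀ hδ₁ hC h0 h₄ fun v vx vy hv => ?_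
      linarith [key u ux uy hu v vx vy hv]
    linarith
  linarith

/-- A competitor for any bound on the boundary derivatives yields, on an enlarged annulus, a
competitor for any other bound. -/
theorem minEnergy_enlarge {δ C C' R₁ R₂ t : ℝ} (hδ₀ : 0 ≤ δ) (hδ₁ : δ < 1)
    (hC : 1 ≤ C) (hC' : 1 ≤ C') (h₁ : 0 < R₁) (h₂ : R₁ ≤ R₂) (ht : 1 < t) :
    minEnergy δ R₁ (t ^ 2 * R₂) C' ≤ minEnergy δ R₁ R₂ C +
      4 * Real.pi * ((2 * Real.pi + 2 * (2 * C) * Real.pi) ^ 2 / Real.log t +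
        (2 * C) ^ 2 * Real.log t) := by
  have ht0 : 0 < t := by linarith
  have hK : ((2 * C).toNNReal : ℝ) = 2 * C := Real.coe_toNNReal _ (by linarith)
  have h0 : 0 < R₂ := h₁.trans_le h₂
  have hR₁ : R₁ < t * R₁ := by nlinarith
  have hR : t * R₁ ≤ t * R₂ := by gcongr
  have hR₂ : t * R₂ < t ^ 2 * R₂ := by
    have : 0 < t * R₂ := by positivity
    nlinarith
  have htR₁ : 0 < t * R₁ := by positivity
  have hφ : IsDescendingPhase (2 * C).toNNReal fun θ => -θ := isDescendingPhase_neg.mono (by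
    rw [← NNReal.coe_le_coe, hK, NNReal.coe_one]; linarith)
  have hb : IsBoundaryDatum C' fun θ => Complex.exp ((-θ : ℝ) * Complex.I) :=
    isDescendingPhase_neg.isBoundaryDatum (by simpa using hC')
  -- A map on a degenerate annulus has no energy and only carries a boundary datum. Joining to it
  -- prescribes e^{-iθ}, admissible for every C' ≥ 1, so the cost involves C but not C'.
  have htriv : ∀ R, 0 < R → ∃ v vx vy, IsUnimodularH1 R R v vx vy
      (fun θ => Complex.exp ((-θ : ℝ) * Complex.I)) (fun θ => Complex.exp ((-θ : ℝ) * Complex.I)) ∧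
      anisoEnergy (1 + δ) (1 - δ) (openAnnulus R R) vx vy = 0 := by
    intro R hR
    obtain ⟨v, vx, vy, hv, hE, -⟩ := exists_homogeneous hφ hR le_rfl (1 + δ) (1 - δ)
    refine ⟨v, vx, vy, hv, ?_⟩
    rw [hE, div_self hR.ne', Real.log_one, zero_mul]
  have e1 : t * R₁ / R₁ = t := by field_simp
  have e2 : t ^ 2 * R₂ / (t * R₂) = t := by field_simp
  -- Dilation by t places the given annulus strictly inside the enlarged one, leaving a transition
  -- annulus of ratio t on each side.
  rw [← minEnergy_scale ht0 h₁.le h0.le (C := C), ← sub_le_iff_le_add]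
  refine le_minEnergy hδ₀ hδ₁ hC htR₁ hR fun u ux uy hu => ?_
  obtain ⟨g₁, g₂, hu, hg₁, hg₂⟩ := hu.exists_isUnimodularH1
  obtain ⟨φ₁, hφ₁, rfl⟩ := hg₁.exists_phase hC
  obtain ⟨φ₂, hφ₂, rfl⟩ := hg₂.exists_phase hC
  obtain ⟨v, vx, vy, hv, hvE⟩ := htriv R₁ h₁
  obtain ⟨v', vx', vy', hv', hvE'⟩ := htriv (t ^ 2 * R₂) (by positivity)
  obtain ⟨w, wx, wy, hw, hwE⟩ := hv.exists_join hδ₀ hδ₁ h₁ le_rfl hR₁ hR hφ hφ₁ hu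
  obtain ⟨m, mx, my, hm, hmE⟩ := hw.exists_join hδ₀ hδ₁ h₁ (hR₁.le.trans hR) hR₂ le_rfl hφ₂ hφ hv'
  have := minEnergy_le hδ₀ hδ₁ (hm.isCompetitor h₁.le (by positivity) hb hb)
  rw [hK, e1, hvE] at hwE
  rw [hK, e2, hvE'] at hmE
  linarith

/-- Constants for almost subadditivity and for the change of the boundary bound. -/
theorem exists_join_constants {δ C : ℝ} (hδ₀ : 0 ≤ δ) (hδ₁ : δ < 1) (hC : 1 ≤ C) :
    ∃ a b : ℝ, 0 ≤ a ∧ 0 ≤ b ∧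
      (∀ R₁ R₂ R₃ R₄ : ℝ, 0 < R₁ → R₁ ≤ R₂ → R₃ ≤ R₄ → 2 ≤ R₃ / R₂ →
        minEnergy δ R₁ R₄ C ≤ minEnergy δ R₁ R₂ C + minEnergy δ R₃ R₄ C
          + a * Real.log (R₃ / R₂) + b) ∧
      ∀ C' R₁ R₂ t : ℝ, 1 ≤ C' → 0 < R₁ → R₁ ≤ R₂ → 2 ≤ t →
        minEnergy δ R₁ (t * R₂) C' ≤ minEnergy δ R₁ R₂ C + a * Real.log t + b := by
  have hpi := Real.pi_pos
  have hl2 : 0 < Real.log 2 := Real.log_pos (by norm_num)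
  set A := (2 * Real.pi + 2 * (2 * C) * Real.pi) ^ 2 with hA
  have hA0 : 0 ≤ A := sq_nonneg _
  refine ⟨2 * Real.pi * (2 * C) ^ 2, 8 * Real.pi * (A / Real.log 2), by positivity,
    by positivity, ?_, ?_⟩
  · intro R₁ R₂ R₃ R₄ h₁ h₂ h₄ ht
    have h0 : 0 < R₂ := h₁.trans_le h₂
    have h₃ : R₂ < R₃ := by
      rw [le_div_iff₀ h0] at ht; linarith
    have hl : Real.log 2 ≤ Real.log (R₃ / R₂) := Real.log_le_log (by norm_num) ht
    have := minEnergy_almost_subadditive hδ₀ hδ₁ hC h₁ h₂ h₃ h₄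
    have hd : A / Real.log (R₃ / R₂) ≤ A / Real.log 2 := by gcongr
    have hd0 : 0 ≤ A / Real.log 2 := by positivity
    nlinarith
  · intro C' R₁ R₂ t hC' h₁ h₂ ht
    have hl : Real.log 2 ≤ Real.log t := Real.log_le_log (by norm_num) ht
    -- The enlargement by t is shared equally by the two sides, each of ratio √t.
    have hs : 1 < √t := Real.lt_sqrt_of_sq_lt (by linarith)
    have := minEnergy_enlarge hδ₀ hδ₁ hC hC' h₁ h₂ hs
    rw [Real.sq_sqrt (by linarith), Real.log_sqrt (by linarith), ← hA] at this
    have hd : A / (Real.log t / 2) ≤ 2 * (A / Real.log 2) := by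
      rw [show 2 * (A / Real.log 2) = A / (Real.log 2 / 2) by field_simp]
      gcongr
    nlinarith

/-! ### Logarithmic asymptotics. -/

/-- A function squeezed, up to a constant, between two shifts of a sequence of linear growth has
the same growth. -/
theorem tendsto_div_of_floor_bounds {x : ℕ → ℝ} {l c : ℝ} {G : ℝ → ℝ} (k : ℕ)
    (hx : Tendsto (fun n : ℕ => x n / n) atTop (𝓝 l))
    (hlow : ∀ s : ℝ, 1 ≤ s → x (⌊s⌋₊ + k) - c ≤ G s) (hup : ∀ s : ℝ, 1 ≤ s → G s ≤ x ⌊s⌋₊ + c) :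
    Tendsto (fun s => G s / s) atTop (𝓝 l) := by
  have hshift : ∀ j : ℕ, Tendsto (fun s : ℝ => x (⌊s⌋₊ + j) / s) atTop (𝓝 l) := by
    intro j
    have h1 : Tendsto (fun s : ℝ => ⌊s⌋₊ + j) atTop atTop :=
      (tendsto_add_atTop_nat j).comp tendsto_nat_floor_atTop
    have h2 : Tendsto (fun s : ℝ => (⌊s⌋₊ : ℝ) / s + j / s) atTop (𝓝 (1 + 0)) :=
      (tendsto_nat_floor_div_atTop).add (tendsto_const_nhds.div_atTop tendsto_id)
    have h3 := (hx.comp h1).mul h2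
    rw [add_zero, mul_one] at h3
    refine h3.congr' ?_
    filter_upwards [eventually_ge_atTop 1] with s hs
    have : (0 : ℝ) < ⌊s⌋₊ := by exact_mod_cast Nat.floor_pos.2 hs
    simp only [Function.comp, Nat.cast_add]
    field_simp
  have hc : Tendsto (fun s : ℝ => c / s) atTop (𝓝 0) := tendsto_const_nhds.div_atTop tendsto_id
  have hl := (hshift k).sub hc
  have hu := (hshift 0).add hc
  rw [sub_zero] at hl
  rw [add_zero] at hu
  refine tendsto_of_tendsto_of_tendsto_of_le_of_le' hl hu ?_ ?_
  · filter_upwards [eventually_ge_atTop 1] with s hs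
    rw [← sub_div]
    exact div_le_div_of_nonneg_right (hlow s hs) (by linarith)
  · filter_upwards [eventually_ge_atTop 1] with s hs
    rw [← add_div]
    exact div_le_div_of_nonneg_right (hup s hs) (by linarith)

theorem two_le_exp_one : 2 ≤ Real.exp 1 := by linarith [Real.add_one_le_exp (1 : ℝ)]

/-- In the variable ln(R₂/R₁), lengthening by an amount between 1 and 2 costs a bounded quantity,
even when C is replaced by C'. The lower limit 1 is used because e ≥ 2. -/
theorem minEnergy_exp_add_le {δ C C' a b : ℝ} (ha : 0 ≤ a) (hC' : 1 ≤ C')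
    (h : ∀ C' R₁ R₂ t : ℝ, 1 ≤ C' → 0 < R₁ → R₁ ≤ R₂ → 2 ≤ t →
        minEnergy δ R₁ (t * R₂) C' ≤ minEnergy δ R₁ R₂ C + a * Real.log t + b)
    {r s : ℝ} (hr : 0 ≤ r) (h₁ : r + 1 ≤ s) (h₂ : s ≤ r + 2) :
    minEnergy δ 1 (Real.exp s) C' ≤ minEnergy δ 1 (Real.exp r) C + (2 * a + b) := by
  have := h C' 1 (Real.exp r) (Real.exp (s - r)) hC' one_pos (Real.one_le_exp hr)
    (two_le_exp_one.trans (Real.exp_le_exp.2 (by linarith)))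
  rw [← Real.exp_add, Real.log_exp, sub_add_cancel] at this
  nlinarith

/-- The minimal energy grows linearly in the logarithm of the ratio of the radii. -/
theorem exists_tendsto_minEnergy {δ : ℝ} (hδ₀ : 0 ≤ δ) (hδ₁ : δ < 1) :
    ∃ l : ℝ, ∀ C : ℝ, 1 ≤ C →
      Tendsto (fun s : ℝ => minEnergy δ 1 (Real.exp s) C / s) atTop (𝓝 l) := by
  obtain ⟨a, b, ha, hb, hsub, hen⟩ := exists_join_constants hδ₀ hδ₁ (le_refl (1 : ℝ))
  -- Two pieces of logarithmic lengths m - 1 and n - 1 and a gap of ratio e fill the length m + n -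
  -- 1; the added a + b absorbs the joining cost. This makes the sequence subadditive, and Fekete's
  -- lemma applies.
  set x : ℕ → ℝ := fun n => minEnergy δ 1 (Real.exp ((n - 1 : ℕ) : ℝ)) 1 + (a + b) with hx
  have hx0 : ∀ n, 0 ≤ x n := fun n => by
    have := minEnergy_nonneg hδ₀ hδ₁ 1 (Real.exp ((n - 1 : ℕ) : ℝ)) 1
    simp only [hx]; linarith
  have hxs : Subadditive x := by
    intro m n
    rcases Nat.eq_zero_or_pos m with rfl | hm
    · rw [zero_add]; linarith [hx0 0]
    rcases Nat.eq_zero_or_pos n with rfl | hn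
    · rw [add_zero]; linarith [hx0 0]
    obtain ⟨m, rfl⟩ := Nat.exists_eq_succ_of_ne_zero hm.ne'
    obtain ⟨n, rfl⟩ := Nat.exists_eq_succ_of_ne_zero hn.ne'
    have e : (m.succ + n.succ - 1 : ℕ) = m + n + 1 := by omega
    simp only [hx, e, Nat.succ_sub_one, Nat.succ_eq_add_one]
    push_cast
    have e1 : Real.exp ((m : ℝ) + 1) / Real.exp m = Real.exp 1 := by
      rw [← Real.exp_sub]; ring_nf
    have key := hsub 1 (Real.exp m) (Real.exp (m + 1)) (Real.exp (m + n + 1)) one_pos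
      (Real.one_le_exp (by positivity)) (Real.exp_le_exp.2 (by linarith [Nat.cast_nonneg (α := ℝ) n]))
      (by rw [e1]; exact two_le_exp_one)
    have e2 := minEnergy_scale (δ := δ) (C := 1) (Real.exp_pos ((m : ℝ) + 1)) zero_le_one
      (Real.exp_pos (n : ℝ)).le
    rw [mul_one, ← Real.exp_add, show (m : ℝ) + 1 + n = m + n + 1 by ring] at e2
    rw [e1, e2, Real.log_exp] at key
    linarith
  have hbdd : BddBelow (Set.range fun n : ℕ => x n / n) :=
    ⟨0, by rintro _ ⟨n, rfl⟩; exact div_nonneg (hx0 n) (Nat.cast_nonneg n)⟩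
  refine ⟨hxs.lim, fun C hC => ?_⟩
  obtain ⟨a', b', ha', hb', -, hen'⟩ := exists_join_constants hδ₀ hδ₁ hC
  -- The indices ⌊s⌋ + 3 and ⌊s⌋ stand for the lengths ⌊s⌋ + 2 and ⌊s⌋ - 1, each at distance between
  -- 1 and 2 from s. Comparing the bound C with the bound 1 in both directions makes the limit
  -- independent of C.
  refine tendsto_div_of_floor_bounds (c := (2 * a + b) + (2 * a' + b') + (a + b)) 3
    (hxs.tendsto_lim hbdd) (fun s hs => ?_) (fun s hs => ?_)
  · have hf1 := Nat.floor_le (by linarith : 0 ≤ s)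
    have hf2 := Nat.lt_floor_add_one s
    have := minEnergy_exp_add_le ha' le_rfl hen' (r := s) (s := ((⌊s⌋₊ + 3 - 1 : ℕ) : ℝ))
      (by linarith) (by rw [Nat.add_sub_assoc (by norm_num)]; push_cast; linarith)
      (by rw [Nat.add_sub_assoc (by norm_num)]; push_cast; linarith)
    simp only [hx]
    linarith
  · have hf1 := Nat.floor_le (by linarith : 0 ≤ s)
    have hf2 := Nat.lt_floor_add_one s
    have hf3 : 1 ≤ ⌊s⌋₊ := Nat.floor_pos.2 hs
    have := minEnergy_exp_add_le ha hC hen (r := ((⌊s⌋₊ - 1 : ℕ) : ℝ)) (s := s)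
      (by positivity) (by rw [Nat.cast_sub hf3]; push_cast; linarith)
      (by rw [Nat.cast_sub hf3]; push_cast; linarith)
    simp only [hx]
    linarith

theorem exists_log_asymptotics {δ : ℝ} (hδ₀ : 0 ≤ δ) (hδ₁ : δ < 1) :
    ∃ Cδ : ℝ, (1 - δ) * Real.pi ≤ Cδ ∧ Cδ ≤ Real.pi ∧
      (∀ R₁ C : ℝ, 0 < R₁ → 1 ≤ C →
        Tendsto (fun t : ℝ => minEnergy δ R₁ (t * R₁) C / Real.log t) atTop (𝓝 Cδ)) ∧
      (0 < δ → Cδ < Real.pi) ∧ (0 < δ → (1 - δ) * Real.pi < Cδ) := by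
  have hpi := Real.pi_pos
  obtain ⟨l, hl⟩ := exists_tendsto_minEnergy hδ₀ hδ₁
  -- The perturbed competitor is used with the bound 1 + 4ε, but the limit is the same for all
  -- bounds.
  have hup : ∀ ε : ℝ, 0 ≤ ε → ε ≤ 1 / 4 → l ≤ Real.pi * (1 - 3 * δ * ε + 102 * ε ^ 2) := by
    intro ε h0 h1
    refine le_of_tendsto (hl (1 + 4 * ε) (by linarith)) ?_
    filter_upwards [eventually_gt_atTop 0] with s hs
    rw [div_le_iff₀ hs]
    simpa using minEnergy_le_wavy hδ₀ hδ₁ h0 h1 le_rfl one_pos (Real.one_le_exp hs.le)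
  have hlow : (1 - δ) * Real.pi + 3 / 32 * (δ * (1 - δ)) * Real.pi ≤ l := by
    refine ge_of_tendsto (hl 1 le_rfl) ?_
    filter_upwards [eventually_gt_atTop 0] with s hs
    rw [le_div_iff₀ hs]
    simpa using minEnergy_ge hδ₀ hδ₁ le_rfl one_pos (Real.one_le_exp hs.le)
  have hgain : 0 ≤ δ * (1 - δ) := mul_nonneg hδ₀ (by linarith)
  refine ⟨l, by nlinarith, by simpa using hup 0 le_rfl (by norm_num), fun R₁ C hR hC => ?_,
    fun hδ => ?_, fun hδ => ?_⟩
  · refine ((hl C hC).comp Real.tendsto_log_atTop).congr' ?_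
    filter_upwards [eventually_gt_atTop 0] with t ht
    simp only [Function.comp]
    rw [Real.exp_log ht, ← minEnergy_scale hR zero_le_one ht.le, mul_one, mul_comm R₁ t]
  -- The value δ/68 minimizes -3δε + 102ε².
  · have := hup (δ / 68) (by positivity) (by linarith)
    nlinarith [mul_pos hpi (mul_pos hδ hδ)]
  · have : 0 < δ * (1 - δ) := mul_pos hδ (by linarith)
    nlinarith

theorem mainTheorem8 (δ : ℝ) (hδ₀ : 0 ≤ δ) (hδ₁ : δ < 1) :
    -- the infimum that defines the minimal energy is a genuine one
    (∀ C R₁ R₂ : ℝ, 1 ≤ C → 0 < R₁ → R₁ ≤ R₂ →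
      IsGLB (competitorEnergies δ R₁ R₂ C) (minEnergy δ R₁ R₂ C) ∧
      (competitorEnergies δ R₁ R₂ C).Nonempty) ∧
    -- two-sided bound
    (∀ C R₁ R₂ : ℝ, 1 ≤ C → 0 < R₁ → R₁ ≤ R₂ →
      (1 - δ) * Real.pi * Real.log (R₂ / R₁) - (1 - δ) * Real.pi ≤ minEnergy δ R₁ R₂ C ∧
      minEnergy δ R₁ R₂ C ≤ Real.pi * Real.log (R₂ / R₁)) ∧
    -- scale invariance
    (∀ C R₁ R₂ t : ℝ, 1 ≤ C → 0 < R₁ → R₁ ≤ R₂ → 0 < t →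
      minEnergy δ (t * R₁) (t * R₂) C = minEnergy δ R₁ R₂ C) ∧
    -- almost subadditivity
    (∀ C : ℝ, 1 ≤ C → ∃ C₁ C₂ : ℝ,
      (∀ R₁ R₂ R₃ R₄ : ℝ, 0 < R₁ → R₁ ≤ R₂ → R₂ ≤ R₃ → R₃ ≤ R₄ → 2 ≤ R₃ / R₂ →
        minEnergy δ R₁ R₄ C ≤ minEnergy δ R₁ R₂ C + minEnergy δ R₃ R₄ C
          + C₁ * Real.log (R₃ / R₂) + C₂) ∧
      (∀ R₁ R₂ t : ℝ, 0 < R₁ → R₁ ≤ R₂ → 2 ≤ t →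
        minEnergy δ R₁ (t * R₂) C ≤ minEnergy δ R₁ R₂ C + C₁ * Real.log t + C₂)) ∧
    -- change of the bound on the boundary derivatives
    (∀ C : ℝ, 1 ≤ C → ∃ C₃ C₄ : ℝ, ∀ C' R₁ R₂ t : ℝ,
      1 ≤ C' → 0 < R₁ → R₁ ≤ R₂ → 2 ≤ t →
        minEnergy δ R₁ (t * R₂) C' ≤ minEnergy δ R₁ R₂ C + C₃ * Real.log t + C₄) ∧
    -- logarithmic asymptotics
    (∃ Cδ : ℝ, (1 - δ) * Real.pi ≤ Cδ ∧ Cδ ≤ Real.pi ∧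
      (∀ R₁ C : ℝ, 0 < R₁ → 1 ≤ C →
        Tendsto (fun t : ℝ => minEnergy δ R₁ (t * R₁) C / Real.log t) atTop (𝓝 Cδ)) ∧
      (0 < δ → Cδ < Real.pi) ∧
      (0 < δ → (1 - δ) * Real.pi < Cδ)) := by
  refine ⟨fun C R₁ R₂ hC h₁ h₂ => ?_, fun C R₁ R₂ hC h₁ h₂ => ⟨?_, ?_⟩,
    fun C R₁ R₂ t hC h₁ h₂ ht => minEnergy_scale ht h₁.le (h₁.le.trans h₂), fun C hC => ?_,
    fun C hC => ?_, exists_log_asymptotics hδ₀ hδ₁⟩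
  · have hne := competitorEnergies_nonempty hδ₀ hδ₁ hC h₁ h₂
    exact ⟨isGLB_csInf hne (bddBelow_competitorEnergies hδ₀ hδ₁ _ _ _), hne⟩
  · have hℓ : 0 ≤ Real.log (R₂ / R₁) := Real.log_nonneg ((one_le_div h₁).2 h₂)
    refine le_trans ?_ (minEnergy_ge hδ₀ hδ₁ hC h₁ h₂)
    have hδ : 0 ≤ (1 - δ) * Real.pi := mul_nonneg (by linarith) Real.pi_pos.le
    have : 0 ≤ δ * ((1 - δ) * Real.pi) * Real.log (R₂ / R₁) :=
      mul_nonneg (mul_nonneg hδ₀ hδ) hℓ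
    linarith
  · simpa using minEnergy_le_wavy (ε := 0) hδ₀ hδ₁ le_rfl (by norm_num) (by linarith) h₁ h₂
  · obtain ⟨a, b, -, -, h, h'⟩ := exists_join_constants hδ₀ hδ₁ hC
    exact ⟨a, b, fun R₁ R₂ R₃ R₄ h₁ h₂ _ h₄ ht => h R₁ R₂ R₃ R₄ h₁ h₂ h₄ ht,
      fun R₁ R₂ t h₁ h₂ ht => h' C R₁ R₂ t hC h₁ h₂ ht⟩
  · obtain ⟨a, b, -, -, -, h⟩ := exists_join_constants hδ₀ hδ₁ hC
    exact ⟨a, b, h⟩
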